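/- Let $\hat{\mathbb C}=\mathbb C\cup\{\infty\}$. For a Jordan curve $C\subset\hat{\mathbb C}$, one of the two components of $\hat{\mathbb C}\setminus C$ is chosen and called its interior; the other one is its exterior. A *marked T-Schottky group* on Möbius transformations $g_1,\dots,g_n$ is the group they generate, provided that there are $2n$ Jordan curves $C_i,C_i'$ ($1\le i\le n$) in $\hat{\mathbb C}$, with at most finitely many tangencies (that is, any two of the curves have at most finitely many common points) and with pairwise disjoint interiors, such that each $g_i$ maps the exterior of $C_i$ onto the interior of $C_i'$. It is *marked classical T-Schottky* on $g_1,\dots,g_n$ if there are such curves which are circles in $\hat{\mathbb C}$ (Euclidean circles, or straight lines together with $\infty$; for circles nothing is required on tangencies). A group of Möbius transformations is *T-Schottky* (respectively *classical T-Schottky*) if it is marked T-Schottky (respectively marked classical T-Schottky) on some finite family of generators. A T-Schottky group is *non-classical* if it is not classical T-Schottky, i.e. if it is classical on no set of generators. For $\lambda\in\mathbb C$ let $G_\lambda\subset PSL(2,\mathbb C)$ be the group of Möbius transformations generated by $S=\begin{pmatrix}1&0\\1&1\end{pmatrix}$ and $T_\lambda=\begin{pmatrix}1&2\lambda\\0&1\end{pmatrix}$,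 and let $K\subset\mathbb C$ be the convex hull of the circle $|z|=1$ and the points $\pm2$. **Theorem 7.2.** Suppose that $\lambda=x+iy$ lies in the closed first quadrant ($x,y\ge 0$), strictly below the classical T-Schottky parabola, i.e. $y<1-x^2/4$, and that $\lambda$ is not in the interior of $K$. Then $G_\lambda$ is a non-classical T-Schottky group: it is T-Schottky, and it is not classical T-Schottky on any set of generators. Moreover (Theorem 7.3, the T-Schottky condition in trace form): let $S,T\in SL(2,\mathbb C)$ with $\operatorname{tr}S=\operatorname{tr}T=2$, and let $w=\operatorname{tr}(ST)-2$. If $$|w|\ge 2\ \text{ and }\ \tfrac{\pi}{3}\le\operatorname{Arg}w\le\tfrac{\pi}{2},\qquad\text{or}\qquad \operatorname{Re}\bigl(w\,e^{-i\pi/3}\bigr)\ge 2\ \text{ and }\ 0\le\operatorname{Arg}w\le\tfrac{\pi}{3},$$ then the group of Möbius transformations generated by $S$ and $T$ is T-Schottky. -/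

import Mathlib

open scoped MatrixGroups

noncomputable section

namespace TSchottky

/-- The complex sphere: the one-point compactification of `ℂ`. -/
abbrev Sphere : Type := OnePoint ℂ

/-- The action of invertible `2 × 2` complex matrices on the complex sphere by
`z ↦ (a z + b) / (c z + d)`. -/
def moebius : GL (Fin 2) ℂ →* Equiv.Perm Sphere :=
  MulAction.toPermHom (GL (Fin 2) ℂ) Sphere

/-- The group of all Möbius transformations, `PSL(2, ℂ)`, realized as a group of permutations of
the complex sphere. -/
def moebiusGroup : Subgroup (Equiv.Perm Sphere) := moebius.range

/-- A Jordan curve on the complex sphere: an injective continuous image of the circle. -/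
def IsJordanCurve (C : Set Sphere) : Prop :=
  ∃ f : Circle → Sphere, Continuous f ∧ Function.Injective f ∧ Set.range f = C

/-- A circle on the complex sphere: a Euclidean circle of positive radius, or a straight line
together with `∞`. -/
def IsCircle (C : Set Sphere) : Prop :=
  (∃ (c : ℂ) (r : ℝ), 0 < r ∧ C = (fun z : ℂ => (z : Sphere)) '' Metric.sphere c r) ∨
  (∃ p v : ℂ, v ≠ 0 ∧
    C = insert OnePoint.infty (Set.range fun t : ℝ => ((p + t * v : ℂ) : Sphere)))

/-- `D` is one of the connected components of the complement of `C`. A curve on the sphere has no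
preferred side, so the side that is called its interior is a choice of such a component. -/
def IsSideOf (D C : Set Sphere) : Prop :=
  ∃ x ∈ Cᶜ, D = connectedComponentIn Cᶜ x

/-- The other side of a curve `C` of which the side `D` was chosen as interior. -/
def exteriorOf (C D : Set Sphere) : Set Sphere := (C ∪ D)ᶜ

/-- The `2n` curves `C (inl i)`, `C (inr i)` (classically written `C_i`, `C'_i`), with interiors
`D (inl i)`, `D (inr i)`, and the Möbius transformations `g i` form a side-pairing configuration:
the interiors of the `2n` curves are pairwise disjoint, and each `g i` maps the exterior of `C_i`
onto the interior of `C'_i`. The corresponding domain is the intersection of the exteriors. -/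
structure IsPairing {n : ℕ} (C D : Fin n ⊕ Fin n → Set Sphere) (g : Fin n → Equiv.Perm Sphere) :
    Prop where
  isSideOf : ∀ j, IsSideOf (D j) (C j)
  disjoint : ∀ j k, j ≠ k → Disjoint (D j) (D k)
  mem_moebiusGroup : ∀ i, g i ∈ moebiusGroup
  image_exterior : ∀ i, g i '' exteriorOf (C (Sum.inl i)) (D (Sum.inl i)) = D (Sum.inr i)

/-- The group generated by `g` is marked classical T-Schottky on the generators `g`. -/
def IsMarkedClassicalTSchottky {n : ℕ} (g : Fin n → Equiv.Perm Sphere) : Prop :=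
  ∃ C D : Fin n ⊕ Fin n → Set Sphere, (∀ j, IsCircle (C j)) ∧ IsPairing C D g

/-- The group generated by `g` is marked T-Schottky on the generators `g`: the curves are Jordan
curves with at most finitely many tangencies. As their interiors are disjoint, two of the curves
can only touch, never cross, so the tangencies are the common points of distinct curves. -/
def IsMarkedTSchottky {n : ℕ} (g : Fin n → Equiv.Perm Sphere) : Prop :=
  ∃ C D : Fin n ⊕ Fin n → Set Sphere, (∀ j, IsJordanCurve (C j)) ∧
    (∀ j k, j ≠ k → (C j ∩ C k).Finite) ∧ IsPairing C D g

/-- A group is classical T-Schottky if it is marked classical T-Schottky on some finite family of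
generators. -/
def IsClassicalTSchottky (G : Subgroup (Equiv.Perm Sphere)) : Prop :=
  ∃ (n : ℕ) (g : Fin n → Equiv.Perm Sphere),
    Subgroup.closure (Set.range g) = G ∧ IsMarkedClassicalTSchottky g

/-- A group is T-Schottky if it is marked T-Schottky on some finite family of generators. -/
def IsTSchottky (G : Subgroup (Equiv.Perm Sphere)) : Prop :=
  ∃ (n : ℕ) (g : Fin n → Equiv.Perm Sphere),
    Subgroup.closure (Set.range g) = G ∧ IsMarkedTSchottky g

/-- A T-Schottky group is non-classical if it is not classical on any set of generators. -/
def IsNonClassicalTSchottky (G : Subgroup (Equiv.Perm Sphere)) : Prop :=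
  IsTSchottky G ∧ ¬ IsClassicalTSchottky G

/-- The group of Möbius transformations generated by (the classes of) two matrices. -/
def twoGenerator (S T : SL(2, ℂ)) : Subgroup (Equiv.Perm Sphere) :=
  Subgroup.closure {moebius (S : GL (Fin 2) ℂ), moebius (T : GL (Fin 2) ℂ)}

/-- The parabolic matrix `S`. -/
def matS : SL(2, ℂ) := ⟨!![1, 0; 1, 1], by simp [Matrix.det_fin_two_of]⟩

/-- The matrix `T`, parabolic for `l ≠ 0`. -/
def matT (l : ℂ) : SL(2, ℂ) := ⟨!![1, 2 * l; 0, 1], by simp [Matrix.det_fin_two_of]⟩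

/-- The two-parabolic group with Lyndon–Ullman parameter `l`. -/
def groupG (l : ℂ) : Subgroup (Equiv.Perm Sphere) := twoGenerator matS (matT l)

/-- The Lyndon–Ullman region `K`: the convex hull of the unit circle and the points `2`, `-2`. -/
def regionK : Set ℂ := convexHull ℝ (Metric.sphere (0 : ℂ) 1 ∪ {2, -2})

end TSchottky

end

/-!
The T-Schottky property. The translation by `2 * m` pairs `-B` with the Jordan curve `B` of the
points equidistant from `{1, -1}` and `{2 * m + 1, 2 * m - 1}`, and for `1 ≤ re σ` the parabolic
`z ↦ z / (σ * z + 1)` pairs the unit circle about `-1` with a circle in the closed unit disc about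
`1`. These curves do not cross as long as the unit discs about `1` and `-1` do not meet their
translates by `2 * m`. Two parabolic elements are determined up to conjugation by
`w = tr (S T) - 2`, which is `2 * m * σ` here; `σ = 1` covers the first range of `w`, and
`m = exp (i π / 3)` the second one.

The group is not classical. In a classical configuration the group is free on the pairing
generators, and as it is generated by `S` and `T`, which do not commute, there are two of these and
the words of `S` and `T` form a basis of the free group. A parabolic element fixes a point of
tangency of two discs, and reading its cyclic word moves this point along the tangencies between
discs. Four discs have at most six tangencies, and the words of `S` and `T` use different ones;
together with the exponent determinant `±1` of a basis, this forces one of the two words to be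
conjugate to a generator `a`. The other one is then, up to conjugation, `b * a ^ N`, and here
`|N| ≤ 1`, since a higher power of `a` would use the tangency that belongs to `a` itself.
Now normalize `a` to the translation by `τ` and `b * a ^ N` to `z ↦ z / (σ * z + 1)`. The discs of
`a` become half-planes at distance at most `|τ|`, and the discs of `b` have to fit between them,
which gives `4 ≤ |τ σ| + |im (τ σ)|`. For `τ σ = 2 * λ` this says that `λ` is not strictly below the
parabola.
-/

open scoped OnePoint

open Filter Topology Set

noncomputable section

namespace TSchottky

/-! ### Möbius transformations as homeomorphisms -/

/-- The invertible matrix with rows `(a, b)` and `(c, d)`. -/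
def glMk (a b c d : ℂ) (h : a * d - b * c ≠ 0) : GL (Fin 2) ℂ :=
  Matrix.GeneralLinearGroup.mkOfDetNeZero !![a, b; c, d] (by rwa [Matrix.det_fin_two_of])

lemma mem_moebiusGroup (g : GL (Fin 2) ℂ) : moebius g ∈ moebiusGroup := ⟨g, rfl⟩

lemma moebius_infty (g : GL (Fin 2) ℂ) :
    moebius g ∞ = if g 1 0 = 0 then ∞ else ((g 0 0 / g 1 0 : ℂ) : Sphere) := by
  change g • (∞ : Sphere) = _
  convert OnePoint.smul_infty_eq_ite g

lemma moebius_coe (g : GL (Fin 2) ℂ) (z : ℂ) :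
    moebius g z = if g 1 0 * z + g 1 1 = 0 then ∞
      else (((g 0 0 * z + g 0 1) / (g 1 0 * z + g 1 1) : ℂ) : Sphere) := by
  change g • (z : Sphere) = _
  convert OnePoint.smul_some_eq_ite (g := g) (k := z)

lemma glMk_infty (a b c d : ℂ) (h : a * d - b * c ≠ 0) :
    moebius (glMk a b c d h) ∞ = if c = 0 then ∞ else ((a / c : ℂ) : Sphere) := by
  rw [moebius_infty]
  simp [glMk]

lemma glMk_coe (a b c d : ℂ) (h : a * d - b * c ≠ 0) (z : ℂ) :
    moebius (glMk a b c d h) z = if c * z + d = 0 then ∞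
      else (((a * z + b) / (c * z + d) : ℂ) : Sphere) := by
  rw [moebius_coe]
  simp [glMk]

/-- The matrix of the affine transformation `z ↦ a z + b`. -/
def affineGL (a b : ℂ) (h : a ≠ 0) : GL (Fin 2) ℂ := glMk a b 0 1 (by simpa using h)

lemma affineGL_infty (a b : ℂ) (h : a ≠ 0) : moebius (affineGL a b h) ∞ = ∞ := by
  simp [affineGL, glMk_infty]

lemma affineGL_coe (a b : ℂ) (h : a ≠ 0) (z : ℂ) :
    moebius (affineGL a b h) z = ((a * z + b : ℂ) : Sphere) := by
  simp [affineGL, glMk_coe]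

/-- The Möbius transformation `z ↦ -z`. -/
def neg : Equiv.Perm Sphere := moebius (affineGL (-1) 0 (by simp))

lemma neg_mem : neg ∈ moebiusGroup := mem_moebiusGroup _

lemma neg_infty : neg ∞ = ∞ := affineGL_infty _ _ _

lemma neg_coe (z : ℂ) : neg z = ((-z : ℂ) : Sphere) := by
  rw [neg, affineGL_coe, neg_one_mul, add_zero]

/-- The translation `z ↦ z + t`. -/
def transl (t : ℂ) : Equiv.Perm Sphere := moebius (affineGL 1 t one_ne_zero)

lemma transl_mem (t : ℂ) : transl t ∈ moebiusGroup := mem_moebiusGroup _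

lemma transl_infty (t : ℂ) : transl t ∞ = ∞ := affineGL_infty _ _ _

lemma transl_coe (t z : ℂ) : transl t z = ((z + t : ℂ) : Sphere) := by
  rw [transl, affineGL_coe, one_mul]

/-- The Möbius transformation `z ↦ 1 / z`. -/
def swap : Equiv.Perm Sphere := moebius (glMk 0 1 1 0 (by simp))

lemma swap_mem : swap ∈ moebiusGroup := mem_moebiusGroup _

lemma swap_infty : swap ∞ = ((0 : ℂ) : Sphere) := by
  simp [swap, glMk_infty]

lemma swap_zero : swap ((0 : ℂ) : Sphere) = ∞ := by
  simp [swap, glMk_coe]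

lemma swap_coe {z : ℂ} (h : z ≠ 0) : swap z = ((z⁻¹ : ℂ) : Sphere) := by
  simp [swap, glMk_coe, h]

lemma swap_mul_swap : swap * swap = 1 := by
  ext z
  induction z using OnePoint.rec with
  | infty => simp [swap_infty, swap_zero]
  | coe z =>
    rcases eq_or_ne z 0 with rfl | hz
    · simp [swap_infty, swap_zero]
    · simp [swap_coe hz, swap_coe (inv_ne_zero hz)]

lemma swap_swap (z : Sphere) : swap (swap z) = z := Equiv.congr_fun swap_mul_swap z

/-- The parabolic transformation with fixed point `0` that adds `s` to `1 / z`. -/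
def coTransl (s : ℂ) : Equiv.Perm Sphere := moebius (glMk 1 0 s 1 (by simp))

lemma coTransl_eq (s : ℂ) : coTransl s = swap * transl s * swap := by
  rw [coTransl, swap, transl, ← map_mul, ← map_mul]
  congr 1
  ext i j
  fin_cases i <;> fin_cases j <;> simp [glMk, affineGL, Matrix.mul_apply, Fin.sum_univ_two]

lemma continuous_affineGL (a b : ℂ) (h : a ≠ 0) : Continuous (moebius (affineGL a b h)) := by
  let e : ℂ ≃ₜ ℂ := (Homeomorph.mulLeft₀ a h).trans (Homeomorph.addRight b)
  have he : ⇑(moebius (affineGL a b h)) = OnePoint.map e := by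
    funext z
    induction z using OnePoint.rec with
    | infty => simp [affineGL_infty]
    | coe z => simp [affineGL_coe, e]
  rw [he]
  refine OnePoint.continuous_map e.continuous ?_
  rw [coclosedCompact_eq_cocompact]
  exact e.isClosedEmbedding.tendsto_cocompact

lemma tendsto_coe_infty_iff {ι : Type*} {l : Filter ι} {f : ι → ℂ} :
    Tendsto (fun i => (f i : Sphere)) l (𝓝 ∞) ↔ Tendsto (fun i => ‖f i‖) l atTop := by
  rw [tendsto_norm_atTop_iff_cobounded, Metric.cobounded_eq_cocompact,
    ← coclosedCompact_eq_cocompact, ← OnePoint.comap_coe_nhds_infty, tendsto_comap_iff]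
  rfl

lemma continuous_swap : Continuous swap := by
  rw [OnePoint.continuous_iff, swap_infty, continuous_iff_continuousAt,
    coclosedCompact_eq_cocompact]
  refine ⟨?_, fun z => ?_⟩
  · have hlim : Tendsto (fun z : ℂ => ((z⁻¹ : ℂ) : Sphere)) (cocompact ℂ)
        (𝓝 ((0 : ℂ) : Sphere)) := by
      refine (OnePoint.continuous_coe.tendsto 0).comp ?_
      rw [← Metric.cobounded_eq_cocompact]
      exact tendsto_inv₀_cobounded
    refine hlim.congr' ?_
    filter_upwards [(isCompact_singleton (x := (0 : ℂ))).compl_mem_cocompact] with z hz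
      using (swap_coe hz).symm
  · rcases eq_or_ne z 0 with rfl | hz
    · rw [continuousAt_iff_punctured_nhds, swap_zero]
      have hlim : Tendsto (fun z : ℂ => ((z⁻¹ : ℂ) : Sphere)) (𝓝[≠] 0) (𝓝 ∞) := by
        rw [tendsto_coe_infty_iff, tendsto_norm_atTop_iff_cobounded]
        exact tendsto_inv₀_nhdsNE_zero
      refine hlim.congr' ?_
      filter_upwards [self_mem_nhdsWithin] with w hw using (swap_coe hw).symm
    · have hinv : ContinuousAt (fun z : ℂ => ((z⁻¹ : ℂ) : Sphere)) z :=
        OnePoint.continuous_coe.continuousAt.comp (continuousAt_inv₀ hz)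
      refine hinv.congr ?_
      filter_upwards [isOpen_ne.mem_nhds hz] with w hw using (swap_coe hw).symm

lemma continuous_moebius (g : GL (Fin 2) ℂ) : Continuous (moebius g) := by
  have hdet : g 0 0 * g 1 1 - g 0 1 * g 1 0 ≠ 0 := by
    simpa only [Matrix.det_fin_two] using g.det_ne_zero
  by_cases hc : g 1 0 = 0
  · obtain ⟨ha, hd⟩ : g 0 0 ≠ 0 ∧ g 1 1 ≠ 0 := by simpa [hc] using hdet
    convert continuous_affineGL (g 0 0 / g 1 1) (g 0 1 / g 1 1) (div_ne_zero ha hd) using 1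
    funext z
    induction z using OnePoint.rec with
    | infty => rw [affineGL_infty, moebius_infty, if_pos hc]
    | coe z =>
      rw [affineGL_coe, moebius_coe, hc, zero_mul, zero_add, if_neg hd, add_div, div_mul_eq_mul_div]
  · have hb : g 0 1 - g 0 0 * g 1 1 / g 1 0 ≠ 0 := by
      contrapose! hdet
      field_simp at hdet
      linear_combination -hdet
    have hg : g = affineGL _ (g 0 0 / g 1 0) hb * glMk 0 1 1 0 (by simp) *
        affineGL (g 1 0) (g 1 1) hc := by
      ext i j
      fin_cases i <;> fin_cases j <;>
        simp [affineGL, glMk, Matrix.mul_apply, Fin.sum_univ_two, hc]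
      field_simp
      ring
    rw [hg, map_mul, map_mul]
    exact ((continuous_affineGL _ _ _).comp continuous_swap).comp (continuous_affineGL _ _ _)

lemma continuous_of_mem {f : Equiv.Perm Sphere} (hf : f ∈ moebiusGroup) : Continuous f := by
  obtain ⟨g, rfl⟩ := hf
  exact continuous_moebius g

/-- A Möbius transformation as a homeomorphism of the sphere. -/
def toHomeo (f : Equiv.Perm Sphere) (hf : f ∈ moebiusGroup) : Sphere ≃ₜ Sphere where
  toEquiv := f
  continuous_toFun := continuous_of_mem hf
  continuous_invFun := continuous_of_mem (f := f⁻¹) (inv_mem hf)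

@[simp]
lemma coe_toHomeo (f : Equiv.Perm Sphere) (hf : f ∈ moebiusGroup) : ⇑(toHomeo f hf) = f := rfl

lemma image_closure_of_mem {f : Equiv.Perm Sphere} (hf : f ∈ moebiusGroup) (s : Set Sphere) :
    f '' closure s = closure (f '' s) := (toHomeo f hf).image_closure s

lemma image_frontier_of_mem {f : Equiv.Perm Sphere} (hf : f ∈ moebiusGroup) (s : Set Sphere) :
    f '' frontier s = frontier (f '' s) := (toHomeo f hf).image_frontier s

lemma isOpen_image_of_mem {f : Equiv.Perm Sphere} (hf : f ∈ moebiusGroup) {s : Set Sphere}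
    (hs : IsOpen s) : IsOpen (f '' s) := (toHomeo f hf).isOpenMap s hs

lemma image_eq_of_mem_iff {X : Type*} (f : Equiv.Perm X) {A B : Set X}
    (h : ∀ z, f z ∈ B ↔ z ∈ A) : f '' A = B :=
  (f.eq_preimage_iff_image_eq A B).1 (Set.ext fun z => (h z).symm)

/-! ### Round discs -/

/-- The open upper half-plane. -/
def upper : Set Sphere := (↑) '' {z : ℂ | 0 < z.im}

/-- The open lower half-plane. -/
def lower : Set Sphere := (↑) '' {z : ℂ | z.im < 0}

/-- The extended real line. -/
def realLine : Set Sphere := insert ∞ ((↑) '' {z : ℂ | z.im = 0})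

lemma coe_mem_upper {z : ℂ} : (z : Sphere) ∈ upper ↔ 0 < z.im := by simp [upper]

lemma coe_mem_lower {z : ℂ} : (z : Sphere) ∈ lower ↔ z.im < 0 := by simp [lower]

lemma coe_mem_realLine {z : ℂ} : (z : Sphere) ∈ realLine ↔ z.im = 0 := by simp [realLine]

lemma infty_notMem_upper : ∞ ∉ upper := by simp [upper]

lemma infty_notMem_lower : ∞ ∉ lower := by simp [lower]

lemma infty_mem_realLine : ∞ ∈ realLine := by simp [realLine]

lemma isOpen_upper : IsOpen upper :=
  OnePoint.isOpen_image_coe.2 (isOpen_lt continuous_const Complex.continuous_im)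

lemma isOpen_lower : IsOpen lower :=
  OnePoint.isOpen_image_coe.2 (isOpen_lt Complex.continuous_im continuous_const)

lemma isPreconnected_upper : IsPreconnected upper :=
  (convex_halfSpace_im_gt 0).isPreconnected.image _ OnePoint.continuous_coe.continuousOn

lemma compl_lower : lowerᶜ = upper ∪ realLine := by
  ext z
  induction z using OnePoint.rec with
  | infty => simp [infty_notMem_lower, infty_mem_realLine]
  | coe z =>
    rw [Set.mem_compl_iff, Set.mem_union, coe_mem_upper, coe_mem_lower, coe_mem_realLine, not_lt,
      le_iff_lt_or_eq, eq_comm (a := (0 : ℝ))]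

lemma disjoint_upper_realLine : Disjoint upper realLine := by
  rw [Set.disjoint_left]
  rintro _ ⟨z, hz, rfl⟩ h
  exact hz.ne' (coe_mem_realLine.1 h)

lemma realLine_subset_closure_upper : realLine ⊆ closure upper := by
  rw [realLine, Set.insert_subset_iff]
  constructor
  · have h : Tendsto (fun n : ℕ => (((n + 1 : ℕ) * Complex.I : ℂ) : Sphere)) atTop (𝓝 ∞) := by
      rw [tendsto_coe_infty_iff]
      simp only [norm_mul, Complex.norm_natCast, Complex.norm_I, mul_one]
      exact tendsto_natCast_atTop_atTop.comp (tendsto_add_atTop_nat 1)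
    refine mem_closure_of_tendsto h (Eventually.of_forall fun n => ?_)
    rw [coe_mem_upper, Complex.mul_I_im, Complex.natCast_re]
    positivity
  · have hsub : {z : ℂ | z.im = 0} ⊆ closure {z : ℂ | 0 < z.im} := by
      rw [Complex.closure_setOfPred_lt_im]
      exact fun z hz => hz.ge
    exact (Set.image_mono hsub).trans (image_closure_subset_closure_image OnePoint.continuous_coe)

lemma closure_upper : closure upper = lowerᶜ := by
  apply Set.Subset.antisymm
  · refine closure_minimal ?_ isOpen_lower.isClosed_compl
    exact compl_lower ▸ Set.subset_union_left
  · exact compl_lower ▸ Set.union_subset subset_closure realLine_subset_closure_upper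

lemma frontier_upper : frontier upper = realLine := by
  rw [isOpen_upper.frontier_eq, closure_upper, compl_lower, Set.union_sdiff_left,
    disjoint_upper_realLine.symm.sdiff_eq_left]

lemma image_neg_upper : neg '' upper = lower := by
  refine image_eq_of_mem_iff _ fun z => ?_
  induction z using OnePoint.rec with
  | infty => simp [neg_infty, infty_notMem_lower, infty_notMem_upper]
  | coe z => simp [neg_coe, coe_mem_lower, coe_mem_upper]

lemma image_neg_lower : neg '' lower = upper := by
  refine image_eq_of_mem_iff _ fun z => ?_
  induction z using OnePoint.rec with
  | infty => simp [neg_infty, infty_notMem_lower, infty_notMem_upper]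
  | coe z => simp [neg_coe, coe_mem_lower, coe_mem_upper]

lemma closure_lower : closure lower = upperᶜ := by
  rw [← image_neg_upper, ← image_closure_of_mem neg_mem, closure_upper,
    Set.image_compl_eq (Equiv.bijective _), image_neg_lower]

/-- An open round disc on the sphere, i.e. a Möbius image of the upper half-plane. -/
def IsDisc (D : Set Sphere) : Prop := ∃ f ∈ moebiusGroup, f '' upper = D

lemma isDisc_upper : IsDisc upper := ⟨1, one_mem _, by simp⟩

namespace IsDisc

variable {D : Set Sphere}

lemma image (h : IsDisc D) {f : Equiv.Perm Sphere} (hf : f ∈ moebiusGroup) : IsDisc (f '' D) := by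
  obtain ⟨k, hk, rfl⟩ := h
  exact ⟨f * k, mul_mem hf hk, by rw [Equiv.Perm.coe_mul, Set.image_comp]⟩

lemma isOpen (h : IsDisc D) : IsOpen D := by
  obtain ⟨k, hk, rfl⟩ := h
  exact isOpen_image_of_mem hk isOpen_upper

lemma nonempty (h : IsDisc D) : D.Nonempty := by
  obtain ⟨k, -, rfl⟩ := h
  exact ⟨_, _, (coe_mem_upper (z := Complex.I)).2 (by simp), rfl⟩

lemma isPreconnected (h : IsDisc D) : IsPreconnected D := by
  obtain ⟨k, hk, rfl⟩ := h
  exact isPreconnected_upper.image _ (continuous_of_mem hk).continuousOn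

lemma compl_closure (h : IsDisc D) : IsDisc (closure D)ᶜ := by
  obtain ⟨k, hk, rfl⟩ := h
  rw [← image_closure_of_mem hk, ← Set.image_compl_eq k.bijective, closure_upper, compl_compl,
    ← image_neg_upper]
  exact (isDisc_upper.image neg_mem).image hk

lemma closure_compl_closure (h : IsDisc D) : closure (closure D)ᶜ = Dᶜ := by
  obtain ⟨k, hk, rfl⟩ := h
  rw [← image_closure_of_mem hk, ← Set.image_compl_eq k.bijective, closure_upper, compl_compl,
    ← image_closure_of_mem hk, ← Set.image_compl_eq k.bijective, closure_lower]

lemma frontier_compl_closure (h : IsDisc D) : frontier (closure D)ᶜ = frontier D := by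
  rw [h.compl_closure.isOpen.frontier_eq, h.closure_compl_closure, h.isOpen.frontier_eq,
    sdiff_compl]
  exact Set.inter_comm _ _

end IsDisc

lemma isSideOf_of_isOpen {D C : Set Sphere} (hne : D.Nonempty) (ho : IsOpen D)
    (hc : IsPreconnected D) (hdis : Disjoint D C) (hcl : closure D ⊆ C ∪ D) : IsSideOf D C := by
  obtain ⟨x, hx⟩ := hne
  have hDC : D ⊆ Cᶜ := Set.subset_compl_iff_disjoint_right.2 hdis
  refine ⟨x, hDC hx, Set.Subset.antisymm (hc.subset_connectedComponentIn hx hDC) ?_⟩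
  have hcover : connectedComponentIn Cᶜ x ⊆ D ∪ (closure D)ᶜ := by
    intro z hz
    by_cases h : z ∈ closure D
    · exact Or.inl ((hcl h).resolve_left (connectedComponentIn_subset _ _ hz))
    · exact Or.inr h
  exact isPreconnected_connectedComponentIn.subset_left_of_subset_union ho
    isClosed_closure.isOpen_compl (Set.disjoint_compl_right_iff_subset.2 subset_closure) hcover
    ⟨x, mem_connectedComponentIn (hDC hx), hx⟩

lemma IsDisc.isSideOf {D : Set Sphere} (h : IsDisc D) : IsSideOf D (frontier D) := by
  refine isSideOf_of_isOpen h.nonempty h.isOpen h.isPreconnected ?_ ?_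
  · exact h.isOpen.frontier_eq ▸ Set.disjoint_sdiff_right
  · rw [h.isOpen.frontier_eq, Set.sdiff_union_of_subset subset_closure]

/-- The Cayley transformation `z ↦ (z - i) / (z + i)`, which carries the real line to the unit
circle. -/
def cayley : Equiv.Perm Sphere :=
  moebius (glMk 1 (-Complex.I) 1 Complex.I (by simp [← two_mul]))

lemma image_cayley_realLine : cayley '' realLine = (↑) '' Metric.sphere (0 : ℂ) 1 := by
  refine image_eq_of_mem_iff _ fun z => ?_
  induction z using OnePoint.rec with
  | infty => simp [cayley, glMk_infty, infty_mem_realLine]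
  | coe z =>
    rw [cayley, glMk_coe, coe_mem_realLine]
    simp only [one_mul, ← sub_eq_add_neg]
    by_cases hz : z + Complex.I = 0
    · simp [eq_neg_of_add_eq_zero_left hz]
    · rw [if_neg hz, OnePoint.coe_injective.mem_set_image, mem_sphere_zero_iff_norm, norm_div,
        div_eq_one_iff_eq (norm_ne_zero_iff.2 hz), ← sq_eq_sq₀ (norm_nonneg _) (norm_nonneg _),
        ← Complex.normSq_eq_norm_sq, ← Complex.normSq_eq_norm_sq, Complex.normSq_apply,
        Complex.normSq_apply]
      simp only [Complex.sub_re, Complex.sub_im, Complex.add_re, Complex.add_im, Complex.I_re,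
        Complex.I_im]
      constructor <;> intro h
      · linear_combination -h / 4
      · linear_combination -4 * h

lemma image_affineGL_sphere (c : ℂ) {r : ℝ} (hr : 0 < r) (h : (r : ℂ) ≠ 0) :
    moebius (affineGL r c h) '' ((↑) '' Metric.sphere (0 : ℂ) 1) = (↑) '' Metric.sphere c r := by
  refine image_eq_of_mem_iff _ fun z => ?_
  induction z using OnePoint.rec with
  | infty => simp [affineGL_infty]
  | coe z => simp [affineGL_coe, abs_of_pos hr, hr.ne']

lemma IsCircle.exists_image {C : Set Sphere} (hC : IsCircle C) :
    ∃ f ∈ moebiusGroup, f '' realLine = C := by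
  rcases hC with ⟨c, r, hr, rfl⟩ | ⟨p, v, hv, rfl⟩
  · have hr' : (r : ℂ) ≠ 0 := Complex.ofReal_ne_zero.2 hr.ne'
    refine ⟨moebius (affineGL r c hr') * cayley, mul_mem (mem_moebiusGroup _) (mem_moebiusGroup _),
      ?_⟩
    rw [Equiv.Perm.coe_mul, Set.image_comp, image_cayley_realLine, image_affineGL_sphere c hr]
  · refine ⟨_, mem_moebiusGroup (affineGL v p hv), image_eq_of_mem_iff _ fun z => ?_⟩
    induction z using OnePoint.rec with
    | infty => simp [affineGL_infty, infty_mem_realLine]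
    | coe z =>
      have hline (t : ℝ) : p + t * v = v * z + p ↔ (t : ℂ) = z := by
        rw [add_comm, add_left_inj, mul_comm, mul_right_inj' hv]
      simp only [affineGL_coe, coe_mem_realLine, Set.mem_insert_iff, OnePoint.coe_ne_infty,
        false_or, Set.mem_range, OnePoint.coe_eq_coe, hline]
      exact ⟨fun ⟨t, ht⟩ => ht ▸ Complex.ofReal_im t, fun h => ⟨z.re, Complex.ext rfl h.symm⟩⟩

lemma IsSideOf.isDisc {D C : Set Sphere} (h : IsSideOf D C) (hC : IsCircle C) :
    IsDisc D ∧ frontier D = C := by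
  obtain ⟨f, hf, rfl⟩ := hC.exists_image
  obtain ⟨x, hx, rfl⟩ := h
  have hU : IsDisc (f '' upper) := isDisc_upper.image hf
  have hUfr : frontier (f '' upper) = f '' realLine := by
    rw [← image_frontier_of_mem hf, frontier_upper]
  have of_mem {E : Set Sphere} (hE : IsDisc E) (hfr : frontier E = f '' realLine) (hx : x ∈ E) :
      IsDisc (connectedComponentIn (f '' realLine)ᶜ x) ∧
        frontier (connectedComponentIn (f '' realLine)ᶜ x) = f '' realLine := by
    obtain ⟨y, -, hy⟩ := hE.isSideOf
    rw [hfr] at hy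
    rw [← connectedComponentIn_eq (hy ▸ hx), ← hy]
    exact ⟨hE, hfr⟩
  by_cases hcl : x ∈ closure (f '' upper)
  · refine of_mem hU hUfr ?_
    by_contra hxU
    exact hx (hUfr ▸ hU.isOpen.frontier_eq ▸ ⟨hcl, hxU⟩)
  · exact of_mem hU.compl_closure (hU.frontier_compl_closure.trans hUfr) hcl

/-! ### Side pairings by Jordan curves -/

lemma IsJordanCurve.image {C : Set Sphere} (h : IsJordanCurve C) (f : Sphere ≃ₜ Sphere) :
    IsJordanCurve (f '' C) := by
  obtain ⟨k, hk, hi, rfl⟩ := h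
  exact ⟨f ∘ k, f.continuous.comp hk, f.injective.comp hi, Set.range_comp _ _⟩

lemma IsSideOf.image {D C : Set Sphere} (h : IsSideOf D C) (f : Sphere ≃ₜ Sphere) :
    IsSideOf (f '' D) (f '' C) := by
  obtain ⟨x, hx, rfl⟩ := h
  refine ⟨f x, by simpa using hx, ?_⟩
  rw [f.image_connectedComponentIn hx, Set.image_compl_eq f.bijective]

lemma image_exteriorOf (f : Equiv.Perm Sphere) (C D : Set Sphere) :
    f '' exteriorOf C D = exteriorOf (f '' C) (f '' D) := by
  rw [exteriorOf, exteriorOf, Set.image_compl_eq f.bijective, Set.image_union]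

lemma IsPairing.conj {n : ℕ} {C D : Fin n ⊕ Fin n → Set Sphere} {g : Fin n → Equiv.Perm Sphere}
    (h : IsPairing C D g) {f : Equiv.Perm Sphere} (hf : f ∈ moebiusGroup) :
    IsPairing (fun j => f '' C j) (fun j => f '' D j) (fun i => f * g i * f⁻¹) where
  isSideOf j := (h.isSideOf j).image (toHomeo f hf)
  disjoint j k hjk := (Set.disjoint_image_iff f.injective).2 (h.disjoint j k hjk)
  mem_moebiusGroup i := mul_mem (mul_mem hf (h.mem_moebiusGroup i)) (inv_mem hf)
  image_exterior i := by
    rw [← image_exteriorOf, ← h.image_exterior i, ← Set.image_comp, ← Set.image_comp,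
      ← Equiv.Perm.coe_mul, ← Equiv.Perm.coe_mul, inv_mul_cancel_right]

lemma IsMarkedTSchottky.conj {n : ℕ} {g : Fin n → Equiv.Perm Sphere} (h : IsMarkedTSchottky g)
    {f : Equiv.Perm Sphere} (hf : f ∈ moebiusGroup) :
    IsMarkedTSchottky (fun i => f * g i * f⁻¹) := by
  obtain ⟨C, D, hC, hfin, hCD⟩ := h
  refine ⟨_, _, fun j => (hC j).image (toHomeo f hf), fun j k hjk => ?_, hCD.conj hf⟩
  rw [coe_toHomeo, ← Set.image_inter f.injective]
  exact (hfin j k hjk).image _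

lemma isJordanCurve_sphere (c : ℂ) {r : ℝ} (hr : 0 < r) :
    IsJordanCurve ((↑) '' Metric.sphere c r) := by
  have hr' : (r : ℂ) ≠ 0 := Complex.ofReal_ne_zero.2 hr.ne'
  refine ⟨fun z => moebius (affineGL r c hr') (z : ℂ), ?_, ?_, ?_⟩
  · exact (continuous_affineGL _ _ _).comp (OnePoint.continuous_coe.comp continuous_subtype_val)
  · exact (Equiv.injective _).comp (OnePoint.coe_injective.comp Circle.coe_injective)
  · rw [← image_affineGL_sphere c hr hr', ← Set.image_comp, ← Subtype.range_coe (s := Metric.sphere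
      (0 : ℂ) 1), ← Set.range_comp]
    rfl

lemma isJordanCurve_realLine : IsJordanCurve realLine := by
  have h := (isJordanCurve_sphere 0 one_pos).image (toHomeo cayley (mem_moebiusGroup _)).symm
  rwa [← image_cayley_realLine, Homeomorph.image_symm, ← coe_toHomeo cayley (mem_moebiusGroup _),
    Homeomorph.preimage_image] at h

lemma isSideOf_ball (c : ℂ) {r : ℝ} (hr : 0 < r) :
    IsSideOf ((↑) '' Metric.ball c r) ((↑) '' Metric.sphere c r) := by
  refine isSideOf_of_isOpen ((Metric.nonempty_ball.2 hr).image _)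
    (OnePoint.isOpen_image_coe.2 Metric.isOpen_ball)
    ((convex_ball c r).isPreconnected.image _ OnePoint.continuous_coe.continuousOn) ?_ ?_
  · rw [Set.disjoint_image_iff OnePoint.coe_injective]
    exact Metric.sphere_disjoint_ball.symm
  · rw [← Set.image_union, Set.union_comm, Metric.ball_union_sphere]
    refine closure_minimal (Set.image_mono Metric.ball_subset_closedBall) ?_
    exact ((isCompact_closedBall c r).image OnePoint.continuous_coe).isClosed

lemma neg_image_coe (s : Set ℂ) : neg '' ((↑) '' s) = (↑) '' (-s) := by
  simp_rw [← Set.image_neg_eq_neg, Set.image_image, neg_coe]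

lemma sq_norm_sub (z c : ℂ) : ‖z - c‖ ^ 2 = (z.re - c.re) ^ 2 + (z.im - c.im) ^ 2 := by
  rw [← Complex.normSq_eq_norm_sq, Complex.normSq_apply, Complex.sub_re, Complex.sub_im, sq, sq]

/-- The parameters `m` in the upper half-plane, with nonnegative real part, for which the open unit
discs about `1` and `-1` do not meet their translates by `2 * m`. -/
structure IsHexParameter (m : ℂ) : Prop where
  im_pos : 0 < m.im
  re_nonneg : 0 ≤ m.re
  one_le_norm : 1 ≤ ‖m‖
  one_le_norm_sub : 1 ≤ ‖m - 1‖

lemma isHexParameter_iff {m : ℂ} : IsHexParameter m ↔ 0 < m.im ∧ 0 ≤ m.re ∧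
    1 ≤ m.re ^ 2 + m.im ^ 2 ∧ 1 ≤ (m.re - 1) ^ 2 + m.im ^ 2 := by
  have h0 := sq_norm_sub m 0
  have h1 := sq_norm_sub m 1
  simp only [sub_zero, Complex.zero_re, Complex.zero_im, Complex.one_re, Complex.one_im] at h0 h1
  rw [← h0, ← h1, one_le_sq_iff₀ (norm_nonneg _), one_le_sq_iff₀ (norm_nonneg _)]
  exact ⟨fun ⟨h1, h2, h3, h4⟩ => ⟨h1, h2, h3, h4⟩, fun ⟨h1, h2, h3, h4⟩ => ⟨h1, h2, h3, h4⟩⟩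

section Bisector

variable {m : ℂ}

/-- Half the excess of `|z - p| ^ 2` over `|z - q| ^ 2`, where `p` is the point of `{1, -1}` and
`q` the point of `{2 m + 1, 2 m - 1}` closest to `z`. -/
def bisectorFun (m z : ℂ) : ℝ :=
  2 * m.im * z.im + 2 * m.re * z.re - 2 * (m.re ^ 2 + m.im ^ 2) + |z.re - 2 * m.re| - |z.re|

lemma bisectorFun_reflect (z : ℂ) : bisectorFun m (2 * m - z) = -bisectorFun m z := by
  have habs : |2 * m.re - z.re| = |z.re - 2 * m.re| := abs_sub_comm _ _
  simp only [bisectorFun, Complex.sub_re, Complex.sub_im, Complex.mul_re, Complex.mul_im,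
    Complex.re_ofNat, Complex.im_ofNat, zero_mul, sub_zero, add_zero, habs, sub_sub_cancel_left,
    abs_neg]
  ring

lemma continuous_bisectorFun : Continuous (bisectorFun m) := by
  unfold bisectorFun
  fun_prop

lemma continuous_complex_mk {X : Type*} [TopologicalSpace X] {f g : X → ℝ} (hf : Continuous f)
    (hg : Continuous g) : Continuous fun x => (⟨f x, g x⟩ : ℂ) :=
  Complex.equivRealProdCLM.symm.continuous.comp (hf.prodMk hg)

/-- The homeomorphism of the plane that straightens the bisector. -/
def bisectorHomeo (hm : 0 < m.im) : ℂ ≃ₜ ℂ where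
  toFun z := ⟨z.re, bisectorFun m z⟩
  invFun w := ⟨w.re, (w.im - bisectorFun m w.re) / (2 * m.im)⟩
  left_inv z := by
    refine Complex.ext rfl ?_
    simp only [bisectorFun, Complex.ofReal_re, Complex.ofReal_im]
    field_simp
    ring
  right_inv z := by
    refine Complex.ext rfl ?_
    simp only [bisectorFun, Complex.ofReal_re, Complex.ofReal_im]
    field_simp
    ring
  continuous_toFun := continuous_complex_mk Complex.continuous_re continuous_bisectorFun
  continuous_invFun := continuous_complex_mk Complex.continuous_re <|
    (Complex.continuous_im.sub <| continuous_bisectorFun.comp <|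
      Complex.continuous_ofReal.comp Complex.continuous_re).div_const _

/-- The bisector of `{1, -1}` and `{2 m + 1, 2 m - 1}`, together with `∞`. -/
def bisector (m : ℂ) : Set Sphere := insert ∞ ((↑) '' {z : ℂ | bisectorFun m z = 0})

/-- The points closer to `{2 m + 1, 2 m - 1}` than to `{1, -1}`. -/
def aboveBisector (m : ℂ) : Set Sphere := (↑) '' {z : ℂ | 0 < bisectorFun m z}

lemma coe_mem_bisector {z : ℂ} : (z : Sphere) ∈ bisector m ↔ bisectorFun m z = 0 := by
  simp [bisector]

lemma coe_mem_aboveBisector {z : ℂ} : (z : Sphere) ∈ aboveBisector m ↔ 0 < bisectorFun m z := by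
  simp [aboveBisector]

lemma infty_mem_bisector : ∞ ∈ bisector m := by simp [bisector]

lemma infty_notMem_aboveBisector : ∞ ∉ aboveBisector m := by simp [aboveBisector]

lemma bisector_eq_image (hm : 0 < m.im) :
    bisector m = (bisectorHomeo hm).onePointCongr.symm '' realLine := by
  ext z
  rw [Homeomorph.image_symm, Set.mem_preimage]
  induction z using OnePoint.rec with
  | infty => exact iff_of_true infty_mem_bisector infty_mem_realLine
  | coe z =>
    rw [coe_mem_bisector, ← show (bisectorHomeo hm z).im = bisectorFun m z from rfl]
    exact coe_mem_realLine.symm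

lemma aboveBisector_eq_image (hm : 0 < m.im) :
    aboveBisector m = (bisectorHomeo hm).onePointCongr.symm '' upper := by
  ext z
  rw [Homeomorph.image_symm, Set.mem_preimage]
  induction z using OnePoint.rec with
  | infty => exact iff_of_false infty_notMem_aboveBisector infty_notMem_upper
  | coe z =>
    rw [coe_mem_aboveBisector, ← show (bisectorHomeo hm z).im = bisectorFun m z from rfl]
    exact coe_mem_upper.symm

lemma isJordanCurve_bisector (hm : 0 < m.im) : IsJordanCurve (bisector m) := by
  rw [bisector_eq_image hm]
  exact isJordanCurve_realLine.image _

lemma isSideOf_bisector (hm : 0 < m.im) : IsSideOf (aboveBisector m) (bisector m) := by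
  rw [bisector_eq_image hm, aboveBisector_eq_image hm, ← frontier_upper]
  exact isDisc_upper.isSideOf.image _

lemma exists_two_mul_bisectorFun_add_le (m z : ℂ) {e : ℝ} (he : e = 1 ∨ e = -1) :
    ∃ d : ℝ, (d = 1 ∨ d = -1) ∧
      2 * bisectorFun m z + ‖z - (2 * m + d)‖ ^ 2 ≤ ‖z - e‖ ^ 2 := by
  obtain ⟨d, hd, habs⟩ :
      ∃ d : ℝ, (d = 1 ∨ d = -1) ∧ |z.re - 2 * m.re| = d * (z.re - 2 * m.re) := by
    rcases abs_cases (z.re - 2 * m.re) with h | h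
    · exact ⟨1, Or.inl rfl, by linarith⟩
    · exact ⟨-1, Or.inr rfl, by linarith⟩
  have hle : e * z.re ≤ |z.re| := by
    rcases he with rfl | rfl
    · exact (one_mul z.re).trans_le (le_abs_self _)
    · exact (neg_one_mul z.re).trans_le (neg_le_abs _)
  have he2 : e ^ 2 = 1 := by rcases he with rfl | rfl <;> norm_num
  have hd2 : d ^ 2 = 1 := by rcases hd with rfl | rfl <;> norm_num
  refine ⟨d, hd, ?_⟩
  rw [sq_norm_sub, sq_norm_sub, bisectorFun, habs]
  simp only [Complex.add_re, Complex.add_im, Complex.mul_re, Complex.mul_im, Complex.re_ofNat,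
    Complex.im_ofNat, Complex.ofReal_re, Complex.ofReal_im, zero_mul, sub_zero, add_zero]
  linarith

lemma IsHexParameter.two_le_norm (hm : IsHexParameter m) {d e : ℝ} (hd : d = 1 ∨ d = -1)
    (he : e = 1 ∨ e = -1) : 2 ≤ ‖2 * m + d - e‖ := by
  have hadd : 1 ≤ ‖m + 1‖ := by
    rw [← one_le_sq_iff₀ (norm_nonneg _)]
    have h0 := sq_norm_sub m 0
    have h1 := sq_norm_sub m (-1)
    simp only [sub_zero, Complex.zero_re, Complex.zero_im, sub_neg_eq_add, Complex.neg_re,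
      Complex.one_re, Complex.neg_im, Complex.one_im, neg_zero] at h0 h1
    nlinarith [hm.re_nonneg, hm.one_le_norm]
  have two_le_norm_two_mul {w : ℂ} (hw : 1 ≤ ‖w‖) : 2 ≤ ‖2 * w‖ := by
    rw [norm_mul, Complex.norm_ofNat]
    linarith
  rcases hd with rfl | rfl <;> rcases he with rfl | rfl <;> push_cast
  · convert two_le_norm_two_mul hm.one_le_norm using 2
    ring
  · convert two_le_norm_two_mul hadd using 2
    ring
  · convert two_le_norm_two_mul hm.one_le_norm_sub using 2
    ring
  · convert two_le_norm_two_mul hm.one_le_norm using 2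
    ring

lemma eq_midpoint_of_norm_le_one {z p q : ℂ} (hp : ‖z - p‖ ≤ 1) (hq : ‖z - q‖ ≤ 1)
    (hpq : 2 ≤ ‖q - p‖) : ‖z - p‖ = 1 ∧ ‖z - q‖ = 1 ∧ z = midpoint ℝ p q := by
  have htri : ‖q - p‖ ≤ ‖z - p‖ + ‖z - q‖ := by
    simpa only [norm_sub_rev q z, add_comm] using norm_sub_le_norm_sub_add_norm_sub q z p
  have h2 : ‖q - p‖ = 2 := le_antisymm (by linarith) hpq
  have hp1 : ‖z - p‖ = 1 := by linarith
  have hq1 : ‖z - q‖ = 1 := by linarith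
  refine ⟨hp1, hq1, eq_midpoint_of_dist_eq_half ?_ ?_⟩
  · rw [dist_comm, dist_eq_norm, dist_comm, dist_eq_norm, hp1, h2]
    norm_num
  · rw [dist_eq_norm, dist_comm, dist_eq_norm, hq1, h2]
    norm_num

lemma IsHexParameter.bisectorFun_nonneg (hm : IsHexParameter m) {z : ℂ} {e : ℝ}
    (he : e = 1 ∨ e = -1) (hz : ‖z - e‖ ≤ 1) (hnonneg : 0 ≤ bisectorFun m z) :
    ‖z - e‖ = 1 ∧ bisectorFun m z = 0 ∧ z ∈ ({m, m + 1, m - 1} : Set ℂ) := by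
  obtain ⟨d, hd, hle⟩ := exists_two_mul_bisectorFun_add_le m z he
  have hd1 : ‖z - (2 * m + d)‖ ≤ 1 := by
    rw [← sq_le_one_iff₀ (norm_nonneg _)]
    nlinarith [norm_nonneg (z - e)]
  obtain ⟨hze, hzd, hmid⟩ := eq_midpoint_of_norm_le_one hz hd1 (hm.two_le_norm hd he)
  refine ⟨hze, ?_, ?_⟩
  · rw [hze, hzd] at hle
    linarith
  · rw [hmid, midpoint_eq_smul_add, invOf_eq_inv, Complex.real_smul]
    rcases hd with rfl | rfl <;> rcases he with rfl | rfl <;> push_cast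
    · exact Or.inr (Or.inl (by ring))
    · exact Or.inl (by ring)
    · exact Or.inl (by ring)
    · exact Or.inr (Or.inr (Set.mem_singleton_iff.2 (by ring)))

lemma IsHexParameter.bisectorFun_add_neg (hm : IsHexParameter m) (z : ℂ) :
    bisectorFun m z + bisectorFun m (-z) < 0 := by
  obtain ⟨-, hre, h0, h1⟩ := isHexParameter_iff.1 hm
  have hz : |z.re - 2 * m.re| ≤ |z.re| + 2 * m.re := by
    simpa only [abs_mul, abs_two, abs_of_nonneg hre] using abs_sub z.re (2 * m.re)
  have hz' : |-z.re - 2 * m.re| ≤ |z.re| + 2 * m.re := by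
    simpa only [abs_neg, abs_mul, abs_two, abs_of_nonneg hre] using abs_sub (-z.re) (2 * m.re)
  simp only [bisectorFun, Complex.neg_re, Complex.neg_im, abs_neg]
  nlinarith

lemma IsHexParameter.finite_bisector_inter (hm : IsHexParameter m) {e : ℝ} (he : e = 1 ∨ e = -1) :
    (bisector m ∩ (↑) '' Metric.closedBall (e : ℂ) 1).Finite := by
  refine ((Set.toFinite {m, m + 1, m - 1}).image (↑)).subset ?_
  rintro _ ⟨hb, z, hz, rfl⟩
  rw [coe_mem_bisector] at hb
  exact Set.mem_image_of_mem _
    (hm.bisectorFun_nonneg he (mem_closedBall_iff_norm.1 hz) hb.ge).2.2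

lemma IsHexParameter.disjoint_aboveBisector (hm : IsHexParameter m) {e : ℝ}
    (he : e = 1 ∨ e = -1) : Disjoint (aboveBisector m) ((↑) '' Metric.ball (e : ℂ) 1) := by
  rw [aboveBisector, Set.disjoint_image_iff OnePoint.coe_injective, Set.disjoint_left]
  intro z hb hz
  rw [mem_ball_iff_norm] at hz
  exact hb.ne' (hm.bisectorFun_nonneg he hz.le (le_of_lt hb)).2.1

lemma neg_image_closedBall (e : ℝ) :
    neg '' ((↑) '' Metric.closedBall (e : ℂ) 1) = (↑) '' Metric.closedBall ((-e : ℝ) : ℂ) 1 := by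
  rw [neg_image_coe, neg_closedBall, Complex.ofReal_neg]

lemma neg_image_ball (e : ℝ) :
    neg '' ((↑) '' Metric.ball (e : ℂ) 1) = (↑) '' Metric.ball ((-e : ℝ) : ℂ) 1 := by
  rw [neg_image_coe, neg_ball, Complex.ofReal_neg]

lemma neg_eq_one_or {e : ℝ} (he : e = 1 ∨ e = -1) : -e = 1 ∨ -e = -1 := by
  rcases he with rfl | rfl <;> simp

lemma IsHexParameter.finite_neg_bisector_inter (hm : IsHexParameter m) {e : ℝ}
    (he : e = 1 ∨ e = -1) : (neg '' bisector m ∩ (↑) '' Metric.closedBall (e : ℂ) 1).Finite := by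
  rw [← neg_neg e, ← neg_image_closedBall, ← Set.image_inter neg.injective]
  exact (hm.finite_bisector_inter (neg_eq_one_or he)).image _

lemma IsHexParameter.disjoint_neg_aboveBisector (hm : IsHexParameter m) {e : ℝ}
    (he : e = 1 ∨ e = -1) : Disjoint (neg '' aboveBisector m) ((↑) '' Metric.ball (e : ℂ) 1) := by
  rw [← neg_neg e, ← neg_image_ball, Set.disjoint_image_iff neg.injective]
  exact hm.disjoint_aboveBisector (neg_eq_one_or he)

lemma IsHexParameter.bisector_inter_neg (hm : IsHexParameter m) :
    (neg '' bisector m ∩ bisector m).Finite := by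
  refine (Set.finite_singleton ∞).subset ?_
  rintro _ ⟨⟨z, hz, rfl⟩, hz'⟩
  induction z using OnePoint.rec with
  | infty => exact neg_infty
  | coe z =>
    rw [neg_coe, coe_mem_bisector] at hz'
    rw [coe_mem_bisector] at hz
    linarith [hm.bisectorFun_add_neg z]

lemma IsHexParameter.disjoint_aboveBisector_neg (hm : IsHexParameter m) :
    Disjoint (neg '' aboveBisector m) (aboveBisector m) := by
  rw [aboveBisector, neg_image_coe, Set.disjoint_image_iff OnePoint.coe_injective,
    Set.disjoint_left]
  intro z hz hz'
  rw [Set.mem_neg, Set.mem_ofPred_eq] at hz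
  rw [Set.mem_ofPred_eq] at hz'
  linarith [hm.bisectorFun_add_neg z]

lemma image_transl_exterior_bisector :
    transl (2 * m) '' exteriorOf (neg '' bisector m) (neg '' aboveBisector m) =
      aboveBisector m := by
  rw [← image_exteriorOf, ← Set.image_comp]
  refine image_eq_of_mem_iff (transl (2 * m) * neg) fun z => ?_
  induction z using OnePoint.rec with
  | infty =>
    simp [neg_infty, transl_infty, infty_notMem_aboveBisector, exteriorOf, infty_mem_bisector]
  | coe z =>
    have hz : -z + 2 * m = 2 * m - z := by ring
    rw [Equiv.Perm.mul_apply, neg_coe, transl_coe, coe_mem_aboveBisector, hz, bisectorFun_reflect,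
      exteriorOf, Set.mem_compl_iff, Set.mem_union, coe_mem_bisector, coe_mem_aboveBisector,
      or_comm, eq_comm, ← le_iff_lt_or_eq, not_le, neg_pos]

end Bisector

/-- The half-plane of the points with real part greater than `c`. -/
def rightOf (c : ℝ) : Set Sphere := (↑) '' {z : ℂ | c < z.re}

lemma image_transl_rightOf (t : ℂ) (c : ℝ) : transl t '' rightOf c = rightOf (c + t.re) := by
  refine image_eq_of_mem_iff _ fun z => ?_
  induction z using OnePoint.rec with
  | infty => simp [rightOf, transl_infty]
  | coe z => simp [rightOf, transl_coe]

lemma image_swap_exteriorOf_sphere :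
    swap '' exteriorOf ((↑) '' Metric.sphere (-1 : ℂ) 1) ((↑) '' Metric.ball (-1 : ℂ) 1) =
      rightOf (-(1 / 2)) := by
  rw [exteriorOf, ← Set.image_union, Set.union_comm, Metric.ball_union_sphere]
  refine image_eq_of_mem_iff _ fun z => ?_
  induction z using OnePoint.rec with
  | infty => simp [swap_infty, rightOf]
  | coe z =>
    rcases eq_or_ne z 0 with rfl | hz
    · simp [swap_zero, rightOf]
    have hpos : 0 < z.re ^ 2 + z.im ^ 2 := by
      simpa only [Complex.normSq_apply, sq] using Complex.normSq_pos.2 hz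
    rw [swap_coe hz, rightOf, OnePoint.coe_injective.mem_set_image, Set.mem_compl_iff,
      OnePoint.coe_injective.mem_set_image, mem_closedBall_iff_norm, not_le,
      ← one_lt_sq_iff₀ (norm_nonneg _), sq_norm_sub, Set.mem_ofPred_eq, Complex.inv_re,
      Complex.normSq_apply, ← sq, ← sq, lt_div_iff₀ hpos]
    simp only [Complex.neg_re, Complex.neg_im, Complex.one_re, Complex.one_im]
    constructor <;> intro h <;> linarith

lemma image_swap_rightOf {c : ℝ} (hc : 0 < c) :
    swap '' rightOf c = (↑) '' Metric.ball (((2 * c)⁻¹ : ℝ) : ℂ) (2 * c)⁻¹ := by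
  refine image_eq_of_mem_iff _ fun z => ?_
  induction z using OnePoint.rec with
  | infty => simp [swap_infty, rightOf, abs_of_pos hc]
  | coe z =>
    rcases eq_or_ne z 0 with rfl | hz
    · simp [swap_zero, rightOf, hc.le]
    have hpos : 0 < z.re ^ 2 + z.im ^ 2 := by
      simpa only [Complex.normSq_apply, sq] using Complex.normSq_pos.2 hz
    have hexcess : ((z⁻¹).re - (2 * c)⁻¹) ^ 2 + (z⁻¹).im ^ 2 - ((2 * c)⁻¹) ^ 2 =
        (c - z.re) / (c * (z.re ^ 2 + z.im ^ 2)) := by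
      rw [Complex.inv_re, Complex.inv_im, Complex.normSq_apply, ← sq, ← sq]
      field_simp
      ring
    rw [swap_coe hz, rightOf, OnePoint.coe_injective.mem_set_image,
      OnePoint.coe_injective.mem_set_image, mem_ball_iff_norm,
      ← sq_lt_sq₀ (norm_nonneg _) (by positivity), sq_norm_sub, Set.mem_ofPred_eq,
      Complex.ofReal_re, Complex.ofReal_im, sub_zero, ← sub_neg, hexcess,
      div_lt_iff₀ (by positivity), zero_mul, sub_neg]

section Pairing

variable {m σ : ℂ}

/-- The curves for the pair `transl (2 * m)`, `coTransl σ`. -/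
def hexCurve (m σ : ℂ) : Fin 2 ⊕ Fin 2 → Set Sphere
  | Sum.inl 0 => neg '' bisector m
  | Sum.inr 0 => bisector m
  | Sum.inl 1 => (↑) '' Metric.sphere (-1 : ℂ) 1
  | Sum.inr 1 => (↑) '' Metric.sphere (((2 * σ.re - 1)⁻¹ : ℝ) : ℂ) (2 * σ.re - 1)⁻¹

/-- The interiors of the curves for the pair `transl (2 * m)`, `coTransl σ`. -/
def hexSide (m σ : ℂ) : Fin 2 ⊕ Fin 2 → Set Sphere
  | Sum.inl 0 => neg '' aboveBisector m
  | Sum.inr 0 => aboveBisector m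
  | Sum.inl 1 => (↑) '' Metric.ball (-1 : ℂ) 1
  | Sum.inr 1 => (↑) '' Metric.ball (((2 * σ.re - 1)⁻¹ : ℝ) : ℂ) (2 * σ.re - 1)⁻¹

lemma image_coTransl_hexSide (hσ : 1 ≤ σ.re) :
    coTransl σ '' exteriorOf (hexCurve m σ (Sum.inl 1)) (hexSide m σ (Sum.inl 1)) =
      hexSide m σ (Sum.inr 1) := by
  have hdouble : 2 * (-(1 / 2) + σ.re) = 2 * σ.re - 1 := by ring
  rw [coTransl_eq, Equiv.Perm.coe_mul, Set.image_comp, Equiv.Perm.coe_mul, Set.image_comp,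
    hexCurve, hexSide, image_swap_exteriorOf_sphere, image_transl_rightOf,
    image_swap_rightOf (by linarith), hdouble, hexSide]

lemma dist_inv_one_add_inv {s : ℝ} (hs : 1 ≤ s) : s⁻¹ + dist ((s⁻¹ : ℝ) : ℂ) 1 ≤ 1 := by
  rw [← Complex.ofReal_one, dist_comm, dist_eq_norm, ← Complex.ofReal_sub, Complex.norm_real,
    Real.norm_of_nonneg (sub_nonneg.2 (inv_le_one_of_one_le₀ hs)), add_sub_cancel]

lemma sphere_inter_closedBall_subset :
    Metric.sphere (-1 : ℂ) 1 ∩ Metric.closedBall 1 1 ⊆ {0} := by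
  rintro z ⟨hz, hz'⟩
  have hmid := (eq_midpoint_of_norm_le_one (mem_sphere_iff_norm.1 hz).le
    (mem_closedBall_iff_norm.1 hz') (by norm_num)).2.2
  rw [hmid, midpoint_eq_smul_add, neg_add_cancel, smul_zero, Set.mem_singleton_iff]

lemma pairwise_of_symmetric {r : Fin 2 ⊕ Fin 2 → Fin 2 ⊕ Fin 2 → Prop}
    (hr : ∀ j k, r j k → r k j)
    (h00 : r (Sum.inl 0) (Sum.inr 0)) (h11 : r (Sum.inl 1) (Sum.inr 1))
    (hll : r (Sum.inl 0) (Sum.inl 1)) (hlr : r (Sum.inl 0) (Sum.inr 1))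
    (hrl : r (Sum.inr 0) (Sum.inl 1)) (hrr : r (Sum.inr 0) (Sum.inr 1)) : Pairwise r := by
  rintro (j | j) (k | k) hjk <;> fin_cases j <;> fin_cases k <;>
    first
    | exact absurd rfl hjk
    | assumption
    | exact hr _ _ (by assumption)

lemma IsHexParameter.pairwise_finite_hexCurve (hm : IsHexParameter m) (hσ : 1 ≤ σ.re) :
    Pairwise fun j k => (hexCurve m σ j ∩ hexCurve m σ k).Finite := by
  have hsmall : Metric.sphere (((2 * σ.re - 1)⁻¹ : ℝ) : ℂ) (2 * σ.re - 1)⁻¹ ⊆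
      Metric.closedBall ((1 : ℝ) : ℂ) 1 :=
    Metric.sphere_subset_closedBall.trans <| Metric.closedBall_subset_closedBall' <| by
      simpa only [Complex.ofReal_one] using dist_inv_one_add_inv (by linarith)
  have hleft : Metric.sphere (-1 : ℂ) 1 ⊆ Metric.closedBall ((-1 : ℝ) : ℂ) 1 := by
    simpa only [Complex.ofReal_neg, Complex.ofReal_one] using Metric.sphere_subset_closedBall
  refine pairwise_of_symmetric (fun j k h => by rwa [Set.inter_comm]) hm.bisector_inter_neg ?_ ?_
    ?_ ?_ ?_
  · rw [hexCurve, hexCurve, ← Set.image_inter OnePoint.coe_injective]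
    refine ((Set.finite_singleton 0).subset fun z hz => ?_).image _
    exact sphere_inter_closedBall_subset ⟨hz.1, by simpa using hsmall hz.2⟩
  · exact (hm.finite_neg_bisector_inter (Or.inr rfl)).subset
      (Set.inter_subset_inter_right _ (Set.image_mono hleft))
  · exact (hm.finite_neg_bisector_inter (Or.inl rfl)).subset
      (Set.inter_subset_inter_right _ (Set.image_mono hsmall))
  · exact (hm.finite_bisector_inter (Or.inr rfl)).subset
      (Set.inter_subset_inter_right _ (Set.image_mono hleft))
  · exact (hm.finite_bisector_inter (Or.inl rfl)).subset
      (Set.inter_subset_inter_right _ (Set.image_mono hsmall))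

lemma IsHexParameter.pairwise_disjoint_hexSide (hm : IsHexParameter m) (hσ : 1 ≤ σ.re) :
    Pairwise fun j k => Disjoint (hexSide m σ j) (hexSide m σ k) := by
  have hsmall : Metric.ball (((2 * σ.re - 1)⁻¹ : ℝ) : ℂ) (2 * σ.re - 1)⁻¹ ⊆
      Metric.ball ((1 : ℝ) : ℂ) 1 :=
    Metric.ball_subset_ball' <| by
      simpa only [Complex.ofReal_one] using dist_inv_one_add_inv (by linarith)
  have hleft : Metric.ball (-1 : ℂ) 1 ⊆ Metric.ball ((-1 : ℝ) : ℂ) 1 := by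
    simp only [Complex.ofReal_neg, Complex.ofReal_one, subset_refl]
  refine pairwise_of_symmetric (fun j k h => h.symm) hm.disjoint_aboveBisector_neg ?_ ?_ ?_ ?_ ?_
  · rw [hexSide, hexSide, Set.disjoint_image_iff OnePoint.coe_injective]
    refine Set.disjoint_of_subset_right hsmall (Metric.ball_disjoint_ball ?_)
    norm_num [dist_eq_norm]
  · exact (hm.disjoint_neg_aboveBisector (Or.inr rfl)).mono_right (Set.image_mono hleft)
  · exact (hm.disjoint_neg_aboveBisector (Or.inl rfl)).mono_right (Set.image_mono hsmall)
  · exact (hm.disjoint_aboveBisector (Or.inr rfl)).mono_right (Set.image_mono hleft)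
  · exact (hm.disjoint_aboveBisector (Or.inl rfl)).mono_right (Set.image_mono hsmall)

lemma IsHexParameter.isMarkedTSchottky (hm : IsHexParameter m) (hσ : 1 ≤ σ.re) :
    IsMarkedTSchottky ![transl (2 * m), coTransl σ] := by
  have hr : 0 < (2 * σ.re - 1)⁻¹ := inv_pos.2 (by linarith)
  refine ⟨hexCurve m σ, hexSide m σ, ?_, hm.pairwise_finite_hexCurve hσ, ?_,
    hm.pairwise_disjoint_hexSide hσ, ?_, ?_⟩
  · rintro (j | j) <;> fin_cases j
    · exact (isJordanCurve_bisector hm.im_pos).image (toHomeo _ neg_mem)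
    · exact isJordanCurve_sphere _ one_pos
    · exact isJordanCurve_bisector hm.im_pos
    · exact isJordanCurve_sphere _ hr
  · rintro (j | j) <;> fin_cases j
    · exact (isSideOf_bisector hm.im_pos).image (toHomeo _ neg_mem)
    · exact isSideOf_ball _ one_pos
    · exact isSideOf_bisector hm.im_pos
    · exact isSideOf_ball _ hr
  · intro i
    fin_cases i <;> exact mem_moebiusGroup _
  · intro i
    fin_cases i
    · exact image_transl_exterior_bisector
    · exact image_coTransl_hexSide hσ

end Pairing

section NormalForm

variable {N A : Matrix (Fin 2) (Fin 2) ℂ} {u : Fin 2 → ℂ}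

lemma mulVec_mulVec_eq_zero (htr : N.trace = 0) (hdet : N.det = 0) :
    N.mulVec (N.mulVec u) = 0 := by
  rw [Matrix.trace_fin_two] at htr
  rw [Matrix.det_fin_two] at hdet
  ext i
  fin_cases i
  · simp only [Fin.zero_eta, Matrix.mulVec, dotProduct, Fin.sum_univ_two, Pi.zero_apply]
    linear_combination (N 0 0 * u 0 + N 0 1 * u 1) * htr - u 0 * hdet
  · simp only [Fin.mk_one, Matrix.mulVec, dotProduct, Fin.sum_univ_two, Pi.zero_apply]
    linear_combination (N 1 0 * u 0 + N 1 1 * u 1) * htr - u 1 * hdet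

lemma mulVec_mulVec_eq_trace_smul (htr : N.trace = 0) (hu : N.mulVec u = 0) :
    N.mulVec (A.mulVec u) = (N * A).trace • u := by
  have h0 := congr_fun hu 0
  have h1 := congr_fun hu 1
  simp only [Matrix.mulVec, dotProduct, Fin.sum_univ_two, Pi.zero_apply] at h0 h1
  rw [Matrix.trace_fin_two] at htr
  ext i
  rw [Matrix.trace_fin_two, Matrix.mul_apply, Matrix.mul_apply]
  fin_cases i <;>
    simp only [Fin.zero_eta, Fin.mk_one, Matrix.mulVec, dotProduct, Fin.sum_univ_two,
      Pi.smul_apply, smul_eq_mul]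
  · linear_combination A 1 1 * h0 - A 0 1 * h1 + (A 0 1 * u 1 - A 1 1 * u 0) * htr
  · linear_combination A 0 0 * h1 - A 1 0 * h0 + (A 1 0 * u 0 - A 0 0 * u 1) * htr

lemma det_sub_one_eq_zero {s : Matrix (Fin 2) (Fin 2) ℂ} (htr : s.trace = 2) (hdet : s.det = 1) :
    (s - 1).det = 0 := by
  rw [Matrix.trace_fin_two] at htr
  rw [Matrix.det_fin_two] at hdet
  rw [Matrix.det_fin_two]
  simp only [Matrix.sub_apply, Matrix.one_apply_eq, Matrix.one_apply_ne, ne_eq, zero_ne_one,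
    one_ne_zero, not_false_eq_true, sub_zero]
  linear_combination hdet - htr

/-- The basis is a fixed vector `u` of `s` together with `v = τ⁻¹ (t - 1) u`. -/
lemma exists_adapted_basis {s t : Matrix (Fin 2) (Fin 2) ℂ} (hs : s.trace = 2) (ht : t.trace = 2)
    (hsd : s.det = 1) (htd : t.det = 1) {τ σ : ℂ} (hτ : τ ≠ 0) (hσ : σ ≠ 0)
    (hw : τ * σ = (s * t).trace - 2) :
    ∃ u v : Fin 2 → ℂ, v 0 * u 1 - u 0 * v 1 ≠ 0 ∧ s.mulVec u = u ∧ s.mulVec v = v + σ • u ∧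
      t.mulVec v = v ∧ t.mulVec u = u + τ • v := by
  have htrace (r : Matrix (Fin 2) (Fin 2) ℂ) : (r - 1).trace = r.trace - 2 := by
    rw [Matrix.trace_sub, Matrix.trace_one, Fintype.card_fin, Nat.cast_two]
  have hsplit (r : Matrix (Fin 2) (Fin 2) ℂ) (x : Fin 2 → ℂ) :
      r.mulVec x = x + (r - 1).mulVec x := by
    rw [Matrix.sub_mulVec, Matrix.one_mulVec, add_sub_cancel]
  obtain ⟨u, hu, hsu⟩ := Matrix.exists_mulVec_eq_zero_iff.2 (det_sub_one_eq_zero hs hsd)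
  have hst : ((s - 1) * (t - 1)).trace = τ * σ := by
    rw [hw, sub_mul, mul_sub, mul_one, one_mul, Matrix.trace_sub, Matrix.trace_sub, htrace, hs, ht]
    ring
  have htu : (t - 1).mulVec u = τ • τ⁻¹ • (t - 1).mulVec u := (smul_inv_smul₀ hτ _).symm
  have hsv : (s - 1).mulVec (τ⁻¹ • (t - 1).mulVec u) = σ • u := by
    rw [Matrix.mulVec_smul, mulVec_mulVec_eq_trace_smul (by rw [htrace, hs, sub_self]) hsu, hst,
      smul_smul, inv_mul_cancel_left₀ hτ]
  have htv : (t - 1).mulVec (τ⁻¹ • (t - 1).mulVec u) = 0 := by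
    rw [Matrix.mulVec_smul, mulVec_mulVec_eq_zero (by rw [htrace, ht, sub_self])
      (det_sub_one_eq_zero ht htd), smul_zero]
  set v := τ⁻¹ • (t - 1).mulVec u
  refine ⟨u, v, fun hdet => hu ?_, by rw [hsplit, hsu, add_zero], by rw [hsplit, hsv],
    by rw [hsplit, htv, add_zero], by rw [hsplit, htu]⟩
  have hsu' := congr_fun hsu
  have hsv' := congr_fun hsv
  simp only [Matrix.mulVec, dotProduct, Fin.sum_univ_two, Pi.zero_apply, Pi.smul_apply,
    smul_eq_mul] at hsu' hsv'
  have h0 : σ * u 0 ^ 2 = 0 := by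
    linear_combination -u 0 * hsv' 0 + v 0 * hsu' 0 - (s - 1) 0 1 * hdet
  have h1 : σ * u 1 ^ 2 = 0 := by
    linear_combination -u 1 * hsv' 1 + v 1 * hsu' 1 + (s - 1) 1 0 * hdet
  exact funext <| Fin.forall_fin_two.2
    ⟨by simpa [hσ] using h0, by simpa [hσ] using h1⟩

lemma mul_of_columns {M B : Matrix (Fin 2) (Fin 2) ℂ} {v : Fin 2 → ℂ}
    (h₀ : M.mulVec v = B 0 0 • v + B 1 0 • u) (h₁ : M.mulVec u = B 0 1 • v + B 1 1 • u) :
    M * !![v 0, u 0; v 1, u 1] = !![v 0, u 0; v 1, u 1] * B := by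
  ext i j
  have h₀' := congr_fun h₀ i
  have h₁' := congr_fun h₁ i
  simp only [Matrix.mulVec, dotProduct, Fin.sum_univ_two, Pi.add_apply, Pi.smul_apply,
    smul_eq_mul] at h₀' h₁'
  rw [Matrix.mul_apply, Matrix.mul_apply, Fin.sum_univ_two, Fin.sum_univ_two]
  fin_cases i <;> fin_cases j
  all_goals
    simp only [Fin.zero_eta, Fin.mk_one, Matrix.of_apply, Matrix.cons_val', Matrix.cons_val_zero,
      Matrix.cons_val_one, Matrix.cons_val_fin_one] at h₀' h₁' ⊢
    first | linear_combination h₀' | linear_combination h₁'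

lemma exists_conj_normalForm (S T : SL(2, ℂ)) (hS : (S : Matrix (Fin 2) (Fin 2) ℂ).trace = 2)
    (hT : (T : Matrix (Fin 2) (Fin 2) ℂ).trace = 2) {τ σ : ℂ} (hτ : τ ≠ 0) (hσ : σ ≠ 0)
    (hw : τ * σ = ((S * T : SL(2, ℂ)) : Matrix (Fin 2) (Fin 2) ℂ).trace - 2) :
    ∃ H : GL (Fin 2) ℂ,
      moebius (T : GL (Fin 2) ℂ) = moebius H * transl τ * (moebius H)⁻¹ ∧
      moebius (S : GL (Fin 2) ℂ) = moebius H * coTransl σ * (moebius H)⁻¹ := by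
  obtain ⟨u, v, hdet, hsu, hsv, htv, htu⟩ :=
    exists_adapted_basis hS hT S.2 T.2 hτ hσ (by rwa [Matrix.SpecialLinearGroup.coe_mul] at hw)
  refine ⟨glMk (v 0) (u 0) (v 1) (u 1) hdet, ?_, ?_⟩
  · rw [transl, ← map_mul, ← map_inv, ← map_mul]
    congr 1
    refine eq_mul_inv_iff_mul_eq.2 (Units.ext (mul_of_columns ?_ ?_))
    · simp [htv, affineGL, glMk]
    · simp [htu, affineGL, glMk, add_comm]
  · rw [coTransl, ← map_mul, ← map_inv, ← map_mul]
    congr 1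
    refine eq_mul_inv_iff_mul_eq.2 (Units.ext (mul_of_columns ?_ ?_))
    · simp [hsv, glMk]
    · simp [hsu, glMk]

end NormalForm

lemma isHexParameter_sixthRoot : IsHexParameter ⟨1 / 2, √3 / 2⟩ := by
  have h3 : √3 ^ 2 = 3 := Real.sq_sqrt (by norm_num)
  refine isHexParameter_iff.2 ⟨by positivity, by positivity, ?_, ?_⟩ <;> nlinarith

lemma sixthRoot_mul_conj (w : ℂ) :
    (⟨1 / 2, √3 / 2⟩ : ℂ) * (w * ⟨1 / 2, -(√3 / 2)⟩) = w := by
  have h3 : √3 ^ 2 = 3 := Real.sq_sqrt (by norm_num)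
  have hone : (⟨1 / 2, √3 / 2⟩ : ℂ) * ⟨1 / 2, -(√3 / 2)⟩ = 1 := by
    apply Complex.ext
    · simp only [Complex.mul_re, Complex.one_re]
      linear_combination h3 / 4
    · simp only [Complex.mul_im, Complex.one_im]
      ring
  rw [mul_left_comm, hone, mul_one]

lemma exp_neg_pi_div_three_mul_I :
    Complex.exp (-(Real.pi / 3 * Complex.I)) = ⟨1 / 2, -(√3 / 2)⟩ := by
  have hcast : -(Real.pi / 3 * Complex.I) = ((-(Real.pi / 3) : ℝ) : ℂ) * Complex.I := by
    push_cast
    ring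
  rw [hcast]
  apply Complex.ext
  · rw [Complex.exp_ofReal_mul_I_re, Real.cos_neg, Real.cos_pi_div_three]
  · rw [Complex.exp_ofReal_mul_I_im, Real.sin_neg, Real.sin_pi_div_three]

lemma isHexParameter_half {w : ℂ} (hw : 2 ≤ ‖w‖) (h : Real.pi / 3 ≤ w.arg)
    (h' : w.arg ≤ Real.pi / 2) : IsHexParameter (w / 2) := by
  have hpi := Real.pi_pos
  have hcos : Real.cos w.arg ≤ 1 / 2 := by
    rw [← Real.cos_pi_div_three]
    exact Real.cos_le_cos_of_nonneg_of_le_pi (by linarith) (by linarith) h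
  have hre : 0 ≤ w.re := by
    rw [← Complex.norm_mul_cos_arg w]
    exact mul_nonneg (norm_nonneg w) (Real.cos_nonneg_of_mem_Icc ⟨by linarith, h'⟩)
  have hre' : w.re ≤ ‖w‖ / 2 := by
    rw [← Complex.norm_mul_cos_arg w]
    nlinarith
  have him : 0 < w.im := by
    rw [← Complex.norm_mul_sin_arg w]
    exact mul_pos (by linarith) (Real.sin_pos_of_pos_of_lt_pi (by linarith) (by linarith))
  have hnorm : w.re ^ 2 + w.im ^ 2 = ‖w‖ ^ 2 := by
    rw [← Complex.normSq_eq_norm_sq, Complex.normSq_apply, ← sq, ← sq]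
  rw [isHexParameter_iff, Complex.div_ofNat_re, Complex.div_ofNat_im]
  exact ⟨by positivity, by positivity, by nlinarith, by nlinarith⟩

lemma exists_hexParameter {w : ℂ}
    (hw : (2 ≤ ‖w‖ ∧ Real.pi / 3 ≤ w.arg ∧ w.arg ≤ Real.pi / 2) ∨
      2 ≤ (w * Complex.exp (-(Real.pi / 3 * Complex.I))).re) :
    ∃ m σ : ℂ, 2 * m * σ = w ∧ IsHexParameter m ∧ 1 ≤ σ.re := by
  rcases hw with ⟨hnorm, h, h'⟩ | hre
  · exact ⟨w / 2, 1, by ring, isHexParameter_half hnorm h h', le_rfl⟩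
  · rw [exp_neg_pi_div_three_mul_I] at hre
    refine ⟨_, w * ⟨1 / 2, -(√3 / 2)⟩ / 2, ?_, isHexParameter_sixthRoot, ?_⟩
    · linear_combination sixthRoot_mul_conj w
    · rw [Complex.div_ofNat_re]
      linarith

lemma isTSchottky_of_isHexParameter (S T : SL(2, ℂ))
    (hS : (S : Matrix (Fin 2) (Fin 2) ℂ).trace = 2) (hT : (T : Matrix (Fin 2) (Fin 2) ℂ).trace = 2)
    {m σ : ℂ} (hmσ : 2 * m * σ = ((S * T : SL(2, ℂ)) : Matrix (Fin 2) (Fin 2) ℂ).trace - 2)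
    (hm : IsHexParameter m) (hσ : 1 ≤ σ.re) : IsTSchottky (twoGenerator S T) := by
  have hm₀ : 2 * m ≠ 0 := mul_ne_zero two_ne_zero fun h => by simpa [h] using hm.im_pos
  have hσ₀ : σ ≠ 0 := by
    rintro rfl
    norm_num at hσ
  obtain ⟨H, hHT, hHS⟩ := exists_conj_normalForm S T hS hT hm₀ hσ₀ hmσ
  refine ⟨2, _, ?_, (hm.isMarkedTSchottky hσ).conj (mem_moebiusGroup H)⟩
  rw [twoGenerator, hHT, hHS]
  congr 1
  ext f
  simp [eq_comm, or_comm]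

lemma isTSchottky_twoGenerator (S T : SL(2, ℂ))
    (hS : (S : Matrix (Fin 2) (Fin 2) ℂ).trace = 2) (hT : (T : Matrix (Fin 2) (Fin 2) ℂ).trace = 2)
    {w : ℂ} (hw : w = ((S * T : SL(2, ℂ)) : Matrix (Fin 2) (Fin 2) ℂ).trace - 2)
    (h : (2 ≤ ‖w‖ ∧ Real.pi / 3 ≤ w.arg ∧ w.arg ≤ Real.pi / 2) ∨
      2 ≤ (w * Complex.exp (-(Real.pi / 3 * Complex.I))).re) :
    IsTSchottky (twoGenerator S T) := by
  obtain ⟨m, σ, hmσ, hm, hσ⟩ := exists_hexParameter h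
  exact isTSchottky_of_isHexParameter S T hS hT (hmσ.trans hw) hm hσ

lemma mem_interior_regionK_of_norm_lt {l : ℂ} (h : ‖l‖ < 1) : l ∈ interior regionK := by
  have hball : Metric.ball (0 : ℂ) 1 ⊆ regionK := by
    refine Metric.ball_subset_closedBall.trans ?_
    rw [← convexHull_sphere_eq_closedBall (0 : ℂ) zero_le_one]
    exact convexHull_mono Set.subset_union_left
  exact interior_maximal hball Metric.isOpen_ball (by simpa using h)

lemma ne_zero_of_notMem_interior_regionK {l : ℂ} (h : l ∉ interior regionK) : l ≠ 0 := by
  rintro rfl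
  exact h (mem_interior_regionK_of_norm_lt (norm_zero.trans_lt one_pos))

/-- The open triangle with vertices `2` and the points `1 / 2 ± √3 / 2 * I`, at which the tangents
from `2` touch the unit circle. -/
def tangentTriangle : Set ℂ :=
  {z | 1 / 2 < z.re ∧ z.re + √3 * z.im < 2 ∧ z.re - √3 * z.im < 2}

lemma isOpen_tangentTriangle : IsOpen tangentTriangle :=
  (isOpen_lt continuous_const Complex.continuous_re).inter
    ((isOpen_lt (by fun_prop : Continuous fun z : ℂ => z.re + √3 * z.im) continuous_const).inter
      (isOpen_lt (by fun_prop : Continuous fun z : ℂ => z.re - √3 * z.im) continuous_const))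

lemma tangentTriangle_subset_regionK : tangentTriangle ⊆ regionK := by
  rintro z ⟨h0, h1, h2⟩
  have h3 : √3 ^ 2 = 3 := Real.sq_sqrt (by norm_num)
  have hvertex (s : ℝ) (hs : s ^ 2 = 3) : (⟨1 / 2, s / 2⟩ : ℂ) ∈ regionK := by
    refine subset_convexHull ℝ _ (Or.inl ?_)
    rw [mem_sphere_iff_norm, ← sq_eq_sq₀ (norm_nonneg _) zero_le_one, sq_norm_sub]
    simp only [Complex.zero_re, Complex.zero_im]
    linear_combination (1 / 4) * hs
  have hcomb := (convex_convexHull ℝ _ : Convex ℝ regionK).sum_mem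
    (t := (Finset.univ : Finset (Fin 3)))
    (w := ![(2 * z.re - 1) / 3, (2 - z.re + √3 * z.im) / 3, (2 - z.re - √3 * z.im) / 3])
    (z := ![2, ⟨1 / 2, √3 / 2⟩, ⟨1 / 2, -√3 / 2⟩])
    (fun i _ => by
      fin_cases i <;> simp only [Fin.zero_eta, Fin.mk_one, Fin.reduceFinMk, Matrix.cons_val_zero,
        Matrix.cons_val_one, Matrix.cons_val] <;> linarith)
    (by
      rw [Fin.sum_univ_three]
      simp only [Matrix.cons_val_zero, Matrix.cons_val_one, Matrix.cons_val]
      ring)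
    (fun i _ => by
      fin_cases i
      · exact subset_convexHull ℝ _ (Or.inr (by simp))
      · exact hvertex _ h3
      · exact hvertex _ (by rwa [neg_sq]))
  convert! hcomb using 1
  rw [Fin.sum_univ_three]
  apply Complex.ext
  · simp only [Matrix.cons_val_zero, Matrix.cons_val_one, Matrix.cons_val, Complex.add_re,
      Complex.smul_re, smul_eq_mul, Complex.re_ofNat]
    ring
  · simp only [Matrix.cons_val_zero, Matrix.cons_val_one, Matrix.cons_val, Complex.add_im,
      Complex.smul_im, smul_eq_mul, Complex.im_ofNat]
    linear_combination (-1 / 3 * z.im) * h3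

lemma trace_matS : (matS : Matrix (Fin 2) (Fin 2) ℂ).trace = 2 := by
  simp [matS, Matrix.trace_fin_two, one_add_one_eq_two]

lemma trace_matT (l : ℂ) : (matT l : Matrix (Fin 2) (Fin 2) ℂ).trace = 2 := by
  simp [matT, Matrix.trace_fin_two, one_add_one_eq_two]

lemma trace_matS_mul_matT (l : ℂ) :
    ((matS * matT l : SL(2, ℂ)) : Matrix (Fin 2) (Fin 2) ℂ).trace - 2 = 2 * l := by
  rw [Matrix.SpecialLinearGroup.coe_mul]
  simp only [matS, matT, Matrix.trace_fin_two, Matrix.mul_apply, Fin.sum_univ_two,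
    Matrix.of_apply, Matrix.cons_val', Matrix.cons_val_zero, Matrix.cons_val_one,
    Matrix.cons_val_fin_one]
  ring

lemma isTSchottky_groupG {l : ℂ} (hre : 0 ≤ l.re) (him : 0 ≤ l.im)
    (hK : l ∉ interior regionK) : IsTSchottky (groupG l) := by
  have hnorm : 1 ≤ ‖l‖ := le_of_not_gt fun h => hK (mem_interior_regionK_of_norm_lt h)
  have hsq : 1 ≤ l.re ^ 2 + l.im ^ 2 := by
    rw [← one_le_sq_iff₀ (norm_nonneg l), ← Complex.normSq_eq_norm_sq, Complex.normSq_apply,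
      ← sq, ← sq] at hnorm
    exact hnorm
  have htriangle : l ∉ tangentTriangle := fun h =>
    hK (interior_maximal tangentTriangle_subset_regionK isOpen_tangentTriangle h)
  by_cases hhex : 0 < l.im ∧ 1 ≤ (l.re - 1) ^ 2 + l.im ^ 2
  · exact isTSchottky_of_isHexParameter _ _ trace_matS (trace_matT l) (m := l) (σ := 1)
      (by rw [trace_matS_mul_matT, mul_one]) (isHexParameter_iff.2 ⟨hhex.1, hre, hsq, hhex.2⟩)
      le_rfl
  have hhalf : 1 / 2 < l.re := by
    rcases him.eq_or_lt with h | h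
    · rw [← h] at hsq
      nlinarith
    · have := not_le.1 fun h' => hhex ⟨h, h'⟩
      nlinarith
  have htangent : 2 ≤ l.re + √3 * l.im := by
    by_contra! h
    exact htriangle ⟨hhalf, h, by nlinarith [Real.sqrt_nonneg 3]⟩
  refine isTSchottky_of_isHexParameter _ _ trace_matS (trace_matT l)
    (σ := l * ⟨1 / 2, -(√3 / 2)⟩) ?_ isHexParameter_sixthRoot ?_
  · rw [trace_matS_mul_matT, mul_assoc, sixthRoot_mul_conj]
  · rw [Complex.mul_re]
    linarith

/-- All forward and backward orbits of `f` converge to `p`. For a Möbius transformation this says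
that `f` is parabolic with fixed point `p`. -/
def IsParabolicAt (f : Equiv.Perm Sphere) (p : Sphere) : Prop :=
  (∀ z, Tendsto (fun n : ℕ => (f ^ n) z) atTop (𝓝 p)) ∧
    ∀ z, Tendsto (fun n : ℕ => (f⁻¹ ^ n) z) atTop (𝓝 p)

namespace IsParabolicAt

variable {f h : Equiv.Perm Sphere} {p q : Sphere}

lemma inv (hf : IsParabolicAt f p) : IsParabolicAt f⁻¹ p := ⟨hf.2, by simpa using hf.1⟩

lemma conj (hf : IsParabolicAt f p) (hh : h ∈ moebiusGroup) :
    IsParabolicAt (h * f * h⁻¹) (h p) := by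
  constructor <;> intro z
  · simpa only [conj_pow, Equiv.Perm.mul_apply, Function.comp_def] using
      ((continuous_of_mem hh).tendsto p).comp (hf.1 (h⁻¹ z))
  · simpa only [conj_inv, conj_pow, Equiv.Perm.mul_apply, Function.comp_def] using
      ((continuous_of_mem hh).tendsto p).comp (hf.2 (h⁻¹ z))

lemma unique (hf : IsParabolicAt f p) (hf' : IsParabolicAt f q) : p = q :=
  tendsto_nhds_unique (hf.1 ∞) (hf'.1 ∞)

lemma ne_one (hf : IsParabolicAt f p) : f ≠ 1 := by
  rintro rfl
  have hp (z : Sphere) : z = p := by simpa using hf.1 z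
  exact OnePoint.infty_ne_coe (0 : ℂ) ((hp _).trans (hp _).symm)

lemma mem_closure (hf : IsParabolicAt f p) {D : Set Sphere} (hne : D.Nonempty)
    (hD : f '' D ⊆ D) : p ∈ closure D := by
  obtain ⟨z, hz⟩ := hne
  refine mem_closure_of_tendsto (hf.1 z) (Eventually.of_forall fun n => ?_)
  rw [Equiv.Perm.coe_pow]
  exact (Set.mapsTo_iff_image_subset.2 hD).iterate n hz

end IsParabolicAt

lemma transl_pow_coe (t z : ℂ) (n : ℕ) :
    (transl t ^ n) (z : Sphere) = ((z + n * t : ℂ) : Sphere) := by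
  induction n with
  | zero => simp
  | succ n ih =>
    rw [pow_succ', Equiv.Perm.mul_apply, ih, transl_coe]
    congr 1
    push_cast
    ring

lemma transl_inv (t : ℂ) : (transl t)⁻¹ = transl (-t) := by
  rw [inv_eq_iff_mul_eq_one]
  ext1 z
  induction z using OnePoint.rec with
  | infty => simp [transl_infty]
  | coe z => simp [transl_coe]

lemma tendsto_transl_pow {t : ℂ} (ht : t ≠ 0) (z : Sphere) :
    Tendsto (fun n : ℕ => (transl t ^ n) z) atTop (𝓝 ∞) := by
  induction z using OnePoint.rec with
  | infty =>
    simp only [Equiv.Perm.coe_pow, Function.iterate_fixed (transl_infty t)]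
    exact tendsto_const_nhds
  | coe z =>
    simp only [transl_pow_coe]
    rw [tendsto_coe_infty_iff]
    have hlower : Tendsto (fun n : ℕ => (n : ℝ) * ‖t‖ - ‖z‖) atTop atTop :=
      tendsto_atTop_add_const_right _ _
        (tendsto_natCast_atTop_atTop.atTop_mul_const (norm_pos_iff.2 ht))
    refine tendsto_atTop_mono (fun n => ?_) hlower
    have htri := norm_sub_le (z + n * t) z
    rw [add_sub_cancel_left, norm_mul, Complex.norm_natCast] at htri
    linarith

lemma isParabolicAt_transl {t : ℂ} (ht : t ≠ 0) : IsParabolicAt (transl t) ∞ := by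
  refine ⟨tendsto_transl_pow ht, ?_⟩
  rw [transl_inv]
  exact tendsto_transl_pow (neg_ne_zero.2 ht)

lemma swap_inv : swap⁻¹ = swap := inv_eq_of_mul_eq_one_left swap_mul_swap

lemma transl_eq (s : ℂ) : transl s = swap * coTransl s * swap⁻¹ := by
  rw [coTransl_eq, swap_inv, ← mul_assoc, ← mul_assoc, swap_mul_swap, one_mul, mul_assoc,
    swap_mul_swap, mul_one]

lemma isParabolicAt_coTransl {s : ℂ} (hs : s ≠ 0) :
    IsParabolicAt (coTransl s) ((0 : ℂ) : Sphere) := by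
  have hconj := (isParabolicAt_transl hs).conj swap_mem
  rwa [swap_inv, ← coTransl_eq, swap_infty] at hconj

/-- The half-plane of the `z` with `k < ⟪n, z⟫`, where `n` is the inner normal. -/
def halfPlane (n : ℂ) (k : ℝ) : Set Sphere := (↑) '' {z : ℂ | k < inner ℝ n z}

lemma coe_mem_halfPlane {n z : ℂ} {k : ℝ} : (z : Sphere) ∈ halfPlane n k ↔ k < inner ℝ n z := by
  simp [halfPlane]

lemma infty_notMem_halfPlane {n : ℂ} {k : ℝ} : ∞ ∉ halfPlane n k := by
  simp [halfPlane]

lemma inner_eq_re_mul_re_add_im_mul_im (n z : ℂ) :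
    inner ℝ n z = n.re * z.re + n.im * z.im := by
  rw [Complex.inner, Complex.mul_re, Complex.conj_re, Complex.conj_im]
  ring

lemma image_affineGL_upper {a b : ℂ} (ha : a ≠ 0) :
    moebius (affineGL a b ha) '' upper = halfPlane (Complex.I * a) (inner ℝ (Complex.I * a) b) := by
  refine image_eq_of_mem_iff _ fun z => ?_
  induction z using OnePoint.rec with
  | infty =>
    rw [affineGL_infty]
    exact iff_of_false infty_notMem_halfPlane infty_notMem_upper
  | coe z =>
    have hinner : inner ℝ (Complex.I * a) (a * z) = Complex.normSq a * z.im := by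
      simp only [inner_eq_re_mul_re_add_im_mul_im, Complex.mul_re, Complex.mul_im, Complex.I_re,
        Complex.I_im, Complex.normSq_apply]
      ring
    rw [affineGL_coe, coe_mem_halfPlane, coe_mem_upper, inner_add_right, lt_add_iff_pos_left,
      hinner, mul_pos_iff_of_pos_left (Complex.normSq_pos.2 ha)]

lemma image_affineGL_lower {a b : ℂ} (ha : a ≠ 0) :
    moebius (affineGL a b ha) '' lower =
      halfPlane (-(Complex.I * a)) (-inner ℝ (Complex.I * a) b) := by
  have hneg : moebius (affineGL (-a) b (neg_ne_zero.2 ha)) = moebius (affineGL a b ha) * neg := by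
    ext1 z
    induction z using OnePoint.rec with
    | infty => rw [Equiv.Perm.mul_apply, neg_infty, affineGL_infty, affineGL_infty]
    | coe z => rw [Equiv.Perm.mul_apply, neg_coe, affineGL_coe, affineGL_coe, mul_neg, neg_mul]
  rw [← image_neg_upper, ← Set.image_comp, ← Equiv.Perm.coe_mul, ← hneg, image_affineGL_upper,
    mul_neg, inner_neg_left]

lemma halfPlane_smul {n : ℂ} {k c : ℝ} (hc : 0 < c) :
    halfPlane (c • n) (c * k) = halfPlane n k := by
  simp only [halfPlane, real_inner_smul_left, mul_lt_mul_iff_right₀ hc]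

lemma exists_image_upper_of_mem_realLine {q : Sphere} (hq : q ∈ realLine) :
    ∃ r ∈ moebiusGroup, r ∞ = q ∧ r '' upper = upper := by
  induction q using OnePoint.rec with
  | infty => exact ⟨1, one_mem _, rfl, by simp⟩
  | coe t =>
    rw [coe_mem_realLine] at hq
    refine ⟨_, mem_moebiusGroup (glMk t (-1) 1 0 (by simp)), by rw [glMk_infty]; simp, ?_⟩
    refine image_eq_of_mem_iff _ fun z => ?_
    induction z using OnePoint.rec with
    | infty => simp [glMk_infty, coe_mem_upper, infty_notMem_upper, hq]
    | coe z =>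
      rw [glMk_coe, one_mul, add_zero]
      split_ifs with hz
      · simp [hz, coe_mem_upper, infty_notMem_upper]
      · have him : ((t * z + -1) / z).im = z.im / Complex.normSq z := by
          rw [← sub_eq_add_neg, sub_div, mul_div_cancel_right₀ t hz, one_div, Complex.sub_im, hq,
            Complex.inv_im, neg_div, zero_sub, neg_neg]
        rw [coe_mem_upper, coe_mem_upper, him]
        exact div_pos_iff_of_pos_right (Complex.normSq_pos.2 hz)

lemma exists_eq_affineGL {g : GL (Fin 2) ℂ} (hg : moebius g ∞ = ∞) :
    ∃ (a b : ℂ) (ha : a ≠ 0), moebius g = moebius (affineGL a b ha) := by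
  have hc : g 1 0 = 0 := by
    by_contra hc
    rw [moebius_infty, if_neg hc] at hg
    exact OnePoint.coe_ne_infty _ hg
  have hdet := g.det_ne_zero
  rw [Matrix.det_fin_two, hc, mul_zero, sub_zero] at hdet
  have hd : g 1 1 ≠ 0 := right_ne_zero_of_mul hdet
  refine ⟨g 0 0 / g 1 1, g 0 1 / g 1 1, div_ne_zero (left_ne_zero_of_mul hdet) hd, ?_⟩
  ext1 z
  induction z using OnePoint.rec with
  | infty => rw [hg, affineGL_infty]
  | coe z =>
    rw [moebius_coe, affineGL_coe, hc, zero_mul, zero_add, if_neg hd, add_div, mul_div_right_comm]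

lemma IsDisc.eq_halfPlane {D : Set Sphere} (hD : IsDisc D) (hcl : ∞ ∈ closure D) (hmem : ∞ ∉ D) :
    ∃ (n : ℂ) (k : ℝ), ‖n‖ = 1 ∧ D = halfPlane n k := by
  have hfr : ∞ ∈ frontier D := by
    rw [hD.isOpen.frontier_eq]
    exact ⟨hcl, hmem⟩
  obtain ⟨f, hf, rfl⟩ := hD
  rw [← image_frontier_of_mem hf, frontier_upper] at hfr
  obtain ⟨q, hq, hfq⟩ := hfr
  obtain ⟨r, hr, hrq, hru⟩ := exists_image_upper_of_mem_realLine hq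
  obtain ⟨g, hg⟩ := mul_mem hf hr
  obtain ⟨a, b, ha, hgab⟩ :=
    exists_eq_affineGL (g := g) (by rw [hg, Equiv.Perm.mul_apply, hrq, hfq])
  have hIa : 0 < ‖Complex.I * a‖ := norm_pos_iff.2 (mul_ne_zero Complex.I_ne_zero ha)
  refine ⟨‖Complex.I * a‖⁻¹ • (Complex.I * a),
    ‖Complex.I * a‖⁻¹ * inner ℝ (Complex.I * a) b, ?_, ?_⟩
  · rw [norm_smul, norm_inv, norm_norm, inv_mul_cancel₀ hIa.ne']
  · rw [halfPlane_smul (inv_pos.2 hIa), ← image_affineGL_upper ha, ← hgab, hg, Equiv.Perm.coe_mul,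
      Set.image_comp, hru]

lemma closure_halfPlane {n : ℂ} (hn : n ≠ 0) (k : ℝ) :
    closure (halfPlane n k) = (halfPlane (-n) (-k))ᶜ := by
  have ha : -Complex.I * n ≠ 0 := mul_ne_zero (neg_ne_zero.2 Complex.I_ne_zero) hn
  have hIa : Complex.I * (-Complex.I * n) = n := by
    rw [← mul_assoc, mul_neg, Complex.I_mul_I, neg_neg, one_mul]
  have hk : inner ℝ n ((k / ‖n‖ ^ 2) • n) = k := by
    rw [real_inner_smul_right, real_inner_self_eq_norm_sq,
      div_mul_cancel₀ k (pow_ne_zero 2 (norm_ne_zero_iff.2 hn))]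
  have hupper := image_affineGL_upper (b := (k / ‖n‖ ^ 2) • n) ha
  have hlower := image_affineGL_lower (b := (k / ‖n‖ ^ 2) • n) ha
  rw [hIa, hk] at hupper hlower
  rw [← hupper, ← hlower, ← image_closure_of_mem (mem_moebiusGroup _), closure_upper,
    Set.image_compl_eq (Equiv.bijective _)]

lemma exists_apply_eq_infty (p : Sphere) : ∃ f ∈ moebiusGroup, f p = ∞ := by
  induction p using OnePoint.rec with
  | infty => exact ⟨1, one_mem _, rfl⟩
  | coe z =>
    refine ⟨swap * transl (-z), mul_mem swap_mem (transl_mem _), ?_⟩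
    rw [Equiv.Perm.mul_apply, transl_coe, add_neg_cancel, swap_zero]

lemma disjoint_halfPlane_iff {n m : ℂ} {k l : ℝ} : Disjoint (halfPlane n k) (halfPlane m l) ↔
    ∀ z : ℂ, k < inner ℝ n z → inner ℝ m z ≤ l := by
  simp only [halfPlane, Set.disjoint_image_iff OnePoint.coe_injective, Set.disjoint_left,
    Set.mem_ofPred_eq, not_lt]

lemma eq_neg_of_disjoint_halfPlane {n m : ℂ} {k l : ℝ} (hn : ‖n‖ = 1) (hm : ‖m‖ = 1)
    (h : Disjoint (halfPlane n k) (halfPlane m l)) : m = -n := by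
  by_contra hne
  have hpos : 0 < 1 + inner ℝ n m := by
    have hle := (abs_le.1 (abs_real_inner_le_norm n m)).1
    have hne' : inner ℝ n m ≠ -1 := fun h =>
      hne (neg_eq_iff_eq_neg.1 ((inner_eq_neg_one_iff_of_norm_eq_one hn hm).1 h).symm)
    rw [hn, hm, one_mul] at hle
    linarith [lt_of_le_of_ne hle hne'.symm]
  obtain ⟨t, ht⟩ := exists_gt (max (k / (1 + inner ℝ n m)) (l / (1 + inner ℝ n m)))
  rw [max_lt_iff, div_lt_iff₀ hpos, div_lt_iff₀ hpos] at ht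
  refine (disjoint_halfPlane_iff.1 h (t • (n + m)) ?_).not_gt ?_
  · rw [real_inner_smul_right, inner_add_right, real_inner_self_eq_norm_sq, hn, one_pow]
    exact ht.1
  · rw [real_inner_smul_right, inner_add_right, real_inner_self_eq_norm_sq, hm, one_pow,
      real_inner_comm, add_comm]
    exact ht.2

lemma add_nonneg_of_disjoint_halfPlane {n : ℂ} {k l : ℝ} (hn : ‖n‖ = 1)
    (h : Disjoint (halfPlane n k) (halfPlane (-n) l)) : 0 ≤ k + l := by
  by_contra! hlt
  refine (disjoint_halfPlane_iff.1 h (((k - l) / 2) • n) ?_).not_gt ?_ <;>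
  · simp only [inner_neg_left, real_inner_smul_right, real_inner_self_eq_norm_sq, hn, one_pow]
    linarith

section Tangent

variable {D₁ D₂ D₃ : Set Sphere} {p q : Sphere}

lemma notMem_of_mem_closure (hD : IsOpen D₁) (h : Disjoint D₁ D₂) (hp : p ∈ closure D₂) :
    p ∉ D₁ := fun hpD => (h.closure_right hD).notMem_of_mem_left hpD hp

/-- Sending the point of tangency to `∞` turns tangent discs into opposite half-planes. -/
lemma IsDisc.exists_halfPlane_of_tangent (h1 : IsDisc D₁) (h2 : IsDisc D₂) (h12 : Disjoint D₁ D₂)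
    (p1 : p ∈ closure D₁) (p2 : p ∈ closure D₂) {f : Equiv.Perm Sphere} (hf : f ∈ moebiusGroup)
    (hfp : f p = ∞) : ∃ (n : ℂ) (k l : ℝ), ‖n‖ = 1 ∧ f '' D₁ = halfPlane n k ∧
      f '' D₂ = halfPlane (-n) l ∧ 0 ≤ k + l := by
  have hinfty {D : Set Sphere} (hp : p ∈ closure D) : ∞ ∈ closure (f '' D) := by
    rw [← image_closure_of_mem hf, ← hfp]
    exact Set.mem_image_of_mem f hp
  have hdisj : Disjoint (f '' D₁) (f '' D₂) := (Set.disjoint_image_iff f.injective).2 h12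
  obtain ⟨n, k, hn, hk⟩ := (h1.image hf).eq_halfPlane (hinfty p1)
    (notMem_of_mem_closure (h1.image hf).isOpen hdisj (hinfty p2))
  obtain ⟨m, l, hm, hl⟩ := (h2.image hf).eq_halfPlane (hinfty p2)
    (notMem_of_mem_closure (h2.image hf).isOpen hdisj.symm (hinfty p1))
  rw [hk, hl] at hdisj
  obtain rfl := eq_neg_of_disjoint_halfPlane hn hm hdisj
  exact ⟨n, k, l, hn, hk, hl, add_nonneg_of_disjoint_halfPlane hn hdisj⟩

lemma notMem_closure_of_pairwise_disjoint (h1 : IsDisc D₁) (h2 : IsDisc D₂) (h3 : IsDisc D₃)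
    (h12 : Disjoint D₁ D₂) (h13 : Disjoint D₁ D₃) (h23 : Disjoint D₂ D₃)
    (p1 : p ∈ closure D₁) (p2 : p ∈ closure D₂) : p ∉ closure D₃ := by
  intro p3
  obtain ⟨f, hf, hfp⟩ := exists_apply_eq_infty p
  obtain ⟨n, k, l, hn, -, hl, -⟩ := h1.exists_halfPlane_of_tangent h2 h12 p1 p2 hf hfp
  obtain ⟨n', k', l', hn', hk', hl', -⟩ := h1.exists_halfPlane_of_tangent h3 h13 p1 p3 hf hfp
  have himage {D E : Set Sphere} (h : Disjoint D E) : Disjoint (f '' D) (f '' E) :=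
    (Set.disjoint_image_iff f.injective).2 h
  have hnn' := eq_neg_of_disjoint_halfPlane hn' (norm_neg n ▸ hn) (hk' ▸ hl ▸ himage h12)
  have hneg := eq_neg_of_disjoint_halfPlane (norm_neg n ▸ hn) (norm_neg n' ▸ hn')
    (hl ▸ hl' ▸ himage h23)
  rw [← hnn', neg_neg, neg_eq_self] at hneg
  exact norm_ne_zero_iff.1 (hn ▸ one_ne_zero) hneg

/-- Discs tangent at two points are complementary, which leaves no room for a third one. -/
lemma eq_of_mem_closure_of_mem_closure (h1 : IsDisc D₁) (h2 : IsDisc D₂) (h3 : D₃.Nonempty)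
    (h12 : Disjoint D₁ D₂) (h13 : Disjoint D₁ D₃) (h23 : Disjoint D₂ D₃) (ho3 : IsOpen D₃)
    (p1 : p ∈ closure D₁) (p2 : p ∈ closure D₂) (q1 : q ∈ closure D₁) (q2 : q ∈ closure D₂) :
    p = q := by
  by_contra hpq
  obtain ⟨f, hf, hfp⟩ := exists_apply_eq_infty p
  obtain ⟨n, k, l, hn, hk, hl, hkl⟩ := h1.exists_halfPlane_of_tangent h2 h12 p1 p2 hf hfp
  have hn₀ : n ≠ 0 := norm_ne_zero_iff.1 (hn ▸ one_ne_zero)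
  obtain ⟨w, hw⟩ := OnePoint.ne_infty_iff_exists.1 fun h => hpq (f.injective (hfp.trans h.symm))
  have hkw := Set.mem_image_of_mem f q1
  have hlw := Set.mem_image_of_mem f q2
  rw [image_closure_of_mem hf, hk, closure_halfPlane hn₀, ← hw, Set.mem_compl_iff,
    coe_mem_halfPlane, inner_neg_left] at hkw
  rw [image_closure_of_mem hf, hl, closure_halfPlane (neg_ne_zero.2 hn₀), ← hw,
    Set.mem_compl_iff, coe_mem_halfPlane, neg_neg] at hlw
  obtain rfl : l = -k := by linarith
  have hcompl : f '' D₂ = (f '' closure D₁)ᶜ := by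
    rw [hl, image_closure_of_mem hf, hk, closure_halfPlane hn₀, compl_compl]
  rw [← Set.image_compl_eq f.bijective, f.injective.image_injective.eq_iff] at hcompl
  have hsub : D₃ ⊆ D₂ := hcompl ▸ Set.subset_compl_iff_disjoint_right.2 (h13.symm.closure_right ho3)
  exact h3.ne_empty (h23.eq_bot_of_ge hsub)

end Tangent

/-! ### Words read off bi-infinite sequences of letters -/

section Words

variable {α H K : Type*} [Group H] [Group K]

/-- The inverse of a letter of a free group. -/
def linv (x : α × Bool) : α × Bool := (x.1, !x.2)

@[simp] lemma linv_linv (x : α × Bool) : linv (linv x) = x := by simp [linv]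

lemma linv_ne (x : α × Bool) : linv x ≠ x := fun h => Bool.not_ne_self _ (congrArg Prod.snd h)

lemma linv_injective : Function.Injective (linv : α × Bool → α × Bool) :=
  Function.LeftInverse.injective linv_linv

lemma exists_third_letter [Nontrivial α] (x y : α × Bool) : ∃ z : α × Bool, z ≠ x ∧ z ≠ y := by
  obtain ⟨i, hi⟩ := exists_ne x.1
  by_cases h : (i, true) = y
  · exact ⟨(i, false), fun h' => hi (congrArg Prod.fst h'), h ▸ by simp⟩
  · exact ⟨(i, true), fun h' => hi (congrArg Prod.fst h'), h⟩

/-- The group element that a letter stands for, when the generators are sent to `g`. -/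
def letter (g : α → H) (x : α × Bool) : H := bif x.2 then g x.1 else (g x.1)⁻¹

@[simp] lemma letter_linv (g : α → H) (x : α × Bool) : letter g (linv x) = (letter g x)⁻¹ := by
  obtain ⟨i, b⟩ := x
  cases b <;> simp [letter, linv]

lemma map_letter (f : H →* K) (g : α → H) (x : α × Bool) :
    f (letter g x) = letter (f ∘ g) x := by
  obtain ⟨i, b⟩ := x
  cases b <;> simp [letter]

/-- The product of the `k` letters of the sequence `x` starting at position `i`. -/
def window (g : α → H) (x : ℤ → α × Bool) : ℤ → ℕ → H
  | _, 0 => 1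
  | i, k + 1 => letter g (x i) * window g x (i + 1) k

variable (g : α → H) {x : ℤ → α × Bool} {k : ℕ}

lemma window_zero (x : ℤ → α × Bool) (i : ℤ) : window g x i 0 = 1 := rfl

lemma window_succ (x : ℤ → α × Bool) (i : ℤ) (k : ℕ) :
    window g x i (k + 1) = letter g (x i) * window g x (i + 1) k := rfl

lemma window_one (x : ℤ → α × Bool) (i : ℤ) : window g x i 1 = letter g (x i) := mul_one _

lemma window_add (x : ℤ → α × Bool) (i : ℤ) (m n : ℕ) :
    window g x i (m + n) = window g x i m * window g x (i + m) n := by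
  induction m generalizing i with
  | zero => simp [window_zero]
  | succ m ih =>
    rw [Nat.add_right_comm, window_succ, ih, window_succ, mul_assoc, Nat.cast_succ, add_assoc i 1,
      add_comm (1 : ℤ)]

lemma map_window (f : H →* K) (x : ℤ → α × Bool) (i : ℤ) (k : ℕ) :
    f (window g x i k) = window (f ∘ g) x i k := by
  induction k generalizing i with
  | zero => exact map_one f
  | succ k ih => rw [window_succ, map_mul, ih, map_letter, window_succ]

lemma window_congr {x y : ℤ → α × Bool} {i j : ℤ} (h : ∀ m : ℤ, x (i + m) = y (j + m)) (k : ℕ) :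
    window g x i k = window g y j k := by
  induction k generalizing i j with
  | zero => rfl
  | succ k ih =>
    rw [window_succ, window_succ, ih (i := i + 1) (j := j + 1)
      fun m => by simpa only [add_assoc] using h (1 + m)]
    exact congrArg (letter g · * _) (by simpa using h 0)

lemma window_mul (hx : Function.Periodic x k) (i : ℤ) (n : ℕ) :
    window g x i (n * k) = window g x i k ^ n := by
  induction n with
  | zero => simp [window_zero]
  | succ n ih =>
    rw [Nat.succ_mul, window_add, ih, pow_succ]
    congr 1
    refine window_congr g (fun m => ?_) k
    rw [add_right_comm, Nat.cast_mul]
    exact hx.nat_mul n _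

lemma window_add_one (hx : Function.Periodic x k) (i : ℤ) :
    window g x (i + 1) k = (letter g (x i))⁻¹ * window g x i k * letter g (x i) := by
  have h : window g x i k * letter g (x i) = letter g (x i) * window g x (i + 1) k := by
    rw [← window_succ, window_add, window_one, hx]
  rw [mul_assoc, h, inv_mul_cancel_left]

end Words

/-! ### Classical ping-pong configurations -/

/-- Pairwise disjoint discs `D x`, indexed by the letters of a free group, such that the letter `x`
maps the exterior of `D x⁻¹` onto `D x`. -/
structure PingPong {α : Type*} (g : α → Equiv.Perm Sphere) (D : α × Bool → Set Sphere) : Prop where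
  isDisc : ∀ x, IsDisc (D x)
  disjoint : ∀ x y, x ≠ y → Disjoint (D x) (D y)
  mem_moebiusGroup : ∀ i, g i ∈ moebiusGroup
  image : ∀ x, ⇑(letter g x) '' (closure (D (linv x)))ᶜ = D x

lemma IsMarkedClassicalTSchottky.exists_pingPong {n : ℕ} {g : Fin n → Equiv.Perm Sphere}
    (h : IsMarkedClassicalTSchottky g) : ∃ D, PingPong g D := by
  obtain ⟨C, D, hC, hp⟩ := h
  have hd (j) := (hp.isSideOf j).isDisc (hC j)
  have hext (j) : exteriorOf (C j) (D j) = (closure (D j))ᶜ := by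
    rw [exteriorOf, ← (hd j).2, (hd j).1.isOpen.frontier_eq,
      Set.sdiff_union_of_subset subset_closure]
  refine ⟨fun x => D (bif x.2 then Sum.inr x.1 else Sum.inl x.1), fun x => (hd _).1, ?_,
    hp.mem_moebiusGroup, ?_⟩
  · rintro ⟨i, b⟩ ⟨j, c⟩ hne
    apply hp.disjoint
    revert hne
    cases b <;> cases c <;> simp
  · rintro ⟨i, b⟩
    have him := hp.image_exterior i
    rw [hext] at him
    cases b
    · simp only [letter, linv, cond_false, Bool.not_false, cond_true]
      rw [← him, ← image_closure_of_mem (hp.mem_moebiusGroup i), (hd _).1.closure_compl_closure,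
        ← Set.image_compl_eq (g i).bijective, compl_compl, ← Set.image_comp]
      simp
    · simpa [letter, linv] using him

namespace PingPong

variable {α : Type*} {g : α → Equiv.Perm Sphere} {D : α × Bool → Set Sphere}

lemma letter_mem (h : PingPong g D) (x : α × Bool) : letter g x ∈ moebiusGroup := by
  obtain ⟨i, b⟩ := x
  cases b
  · exact inv_mem (h.mem_moebiusGroup i)
  · exact h.mem_moebiusGroup i

lemma lift_mem (h : PingPong g D) (u : FreeGroup α) : FreeGroup.lift g u ∈ moebiusGroup := by
  have hle : (FreeGroup.lift g).range ≤ moebiusGroup := by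
    rw [FreeGroup.range_lift_eq_closure, Subgroup.closure_le]
    rintro _ ⟨i, rfl⟩
    exact h.mem_moebiusGroup i
  exact hle ⟨u, rfl⟩

lemma letter_image_subset (h : PingPong g D) {x y : α × Bool} (hxy : y ≠ linv x) :
    ⇑(letter g x) '' D y ⊆ D x := by
  rw [← h.image x]
  exact Set.image_mono (Set.subset_compl_iff_disjoint_right.2
    ((h.disjoint _ _ hxy).closure_right (h.isDisc y).isOpen))

lemma window_image_subset (h : PingPong g D) {x : ℤ → α × Bool}
    (hx : ∀ i, x (i + 1) ≠ linv (x i)) (k : ℕ) (i : ℤ) {y : α × Bool}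
    (hy : y ≠ linv (x (i + k))) : ⇑(window g x i (k + 1)) '' D y ⊆ D (x i) := by
  induction k generalizing i with
  | zero => simpa [window_one] using h.letter_image_subset (by simpa using hy)
  | succ k ih =>
    rw [window_succ, Equiv.Perm.coe_mul, Set.image_comp]
    refine (Set.image_mono (ih (i + 1) ?_)).trans (h.letter_image_subset (hx i))
    rwa [add_assoc, add_comm 1, ← Nat.cast_succ]

lemma window_inv_image_subset (h : PingPong g D) {x : ℤ → α × Bool}
    (hx : ∀ i, x (i + 1) ≠ linv (x i)) (k : ℕ) (i : ℤ) {y : α × Bool}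
    (hy : y ≠ x i) : ⇑(window g x i (k + 1))⁻¹ '' D y ⊆ D (linv (x (i + k))) := by
  induction k with
  | zero =>
    rw [window_one, Nat.cast_zero, add_zero, ← letter_linv]
    exact h.letter_image_subset (by rwa [linv_linv])
  | succ k ih =>
    have hne := hx (i + k)
    rw [add_assoc, ← Nat.cast_succ] at hne
    rw [window_add, window_one, mul_inv_rev, Equiv.Perm.coe_mul, Set.image_comp, ← letter_linv]
    refine (Set.image_mono ih).trans (h.letter_image_subset ?_)
    rw [linv_linv]
    exact hne.symm

end PingPong

/-! ### Itineraries of parabolic fixed points -/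

/-- The periodic itinerary of a parabolic cyclic word: `p (i + 1)` is the point of tangency of the
discs `D (x (i + 1))` and `D (x i)⁻¹`. -/
structure Itinerary {α : Type*} (g : α → Equiv.Perm Sphere) (D : α × Bool → Set Sphere) (k : ℕ)
    (x : ℤ → α × Bool) (p : ℤ → Sphere) : Prop where
  pos : 0 < k
  reduced : ∀ i, x (i + 1) ≠ linv (x i)
  periodic : Function.Periodic x k
  step : ∀ i, p (i + 1) = (letter g (x i))⁻¹ (p i)
  mem_closure : ∀ i, p i ∈ closure (D (x i))
  mem_closure_linv : ∀ i, p (i + 1) ∈ closure (D (linv (x i)))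

section Itineraries

variable {α : Type*} {g : α → Equiv.Perm Sphere} {D : α × Bool → Set Sphere}
  {x y : ℤ → α × Bool} {p q : ℤ → Sphere} {k l : ℕ}

lemma PingPong.exists_isParabolicAt_window (h : PingPong g D) (hper : Function.Periodic x k)
    {q : Sphere} (hq : IsParabolicAt (window g x 0 k) q) :
    ∃ p : ℤ → Sphere, (∀ i, IsParabolicAt (window g x i k) (p i)) ∧
      ∀ i, p (i + 1) = (letter g (x i))⁻¹ (p i) := by
  have succ_point {i p} (hp : IsParabolicAt (window g x i k) p) :
      IsParabolicAt (window g x (i + 1) k) ((letter g (x i))⁻¹ p) := by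
    simpa [window_add_one g hper] using hp.conj (inv_mem (h.letter_mem (x i)))
  have pred_point {i p} (hp : IsParabolicAt (window g x (i + 1) k) p) :
      IsParabolicAt (window g x i k) (letter g (x i) p) := by
    simpa [window_add_one g hper, mul_assoc] using hp.conj (h.letter_mem (x i))
  have hex (i : ℤ) : ∃ p, IsParabolicAt (window g x i k) p := by
    induction i using Int.induction_on with
    | zero => exact ⟨q, hq⟩
    | succ i ih => exact ih.imp' _ fun _ => succ_point
    | pred i ih => exact ih.imp' _ fun _ hp => pred_point (by rwa [sub_add_cancel])
  choose p hp using hex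
  exact ⟨p, hp, fun i => (hp _).unique (succ_point (hp i))⟩

lemma PingPong.exists_itinerary (h : PingPong g D) (hk : 0 < k)
    (hx : ∀ i, x (i + 1) ≠ linv (x i)) (hper : Function.Periodic x k) {q : Sphere}
    (hq : IsParabolicAt (window g x 0 k) q) : ∃ p, Itinerary g D k x p ∧ p 0 = q := by
  obtain ⟨p, hp, hstep⟩ := h.exists_isParabolicAt_window hper hq
  obtain ⟨l, rfl⟩ := Nat.exists_eq_add_one.2 hk
  have hlast (i : ℤ) : x (i + 1 + l) = x i := by
    rw [add_assoc, add_comm 1, ← Nat.cast_succ, hper]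
  refine ⟨p, ⟨hk, hx, hper, hstep, fun i => ?_, fun i => ?_⟩, (hp 0).unique hq⟩
  · refine (hp i).mem_closure (h.isDisc _).nonempty (h.window_image_subset hx l i ?_)
    have hne := hx (i - 1)
    rwa [← hlast (i - 1), sub_add_cancel] at hne
  · rw [← hlast]
    refine (hp (i + 1)).inv.mem_closure (h.isDisc _).nonempty
      (h.window_inv_image_subset hx l (i + 1) ?_)
    rw [hlast]
    exact (hx i).symm

namespace Itinerary

lemma reverse (h : Itinerary g D k x p) :
    Itinerary g D k (fun i => linv (x (-i))) (fun i => p (1 - i)) where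
  pos := h.pos
  reduced i := by
    have hne := h.reduced (-(i + 1))
    rw [neg_add_rev, neg_add_cancel_comm] at hne
    rw [linv_linv, neg_add_rev]
    intro heq
    exact hne (by rw [heq])
  periodic i := by
    change linv (x (-(i + k))) = linv (x (-i))
    rw [← h.periodic (-(i + k)), neg_add_rev, neg_add_cancel_comm]
  step i := by
    rw [letter_linv, inv_inv, show 1 - i = -i + 1 by ring, h.step, Equiv.Perm.coe_inv,
      Equiv.apply_symm_apply]
    congr 1; ring
  mem_closure i := by
    rw [sub_eq_neg_add]
    exact h.mem_closure_linv (-i)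
  mem_closure_linv i := by
    rw [linv_linv, sub_add_cancel_right]
    exact h.mem_closure (-i)

lemma point_eq [Nontrivial α] (hD : PingPong g D) (hx : Itinerary g D k x p)
    (hy : Itinerary g D l y q) {i j : ℤ} (h : x i = y j) (h' : x (i + 1) = y (j + 1)) :
    p (i + 1) = q (j + 1) := by
  obtain ⟨z, hz, hz'⟩ := exists_third_letter (x (i + 1)) (linv (x i))
  exact eq_of_mem_closure_of_mem_closure (hD.isDisc _) (hD.isDisc _) (hD.isDisc z).nonempty
    (hD.disjoint _ _ (hx.reduced i)) (hD.disjoint _ _ hz.symm) (hD.disjoint _ _ hz'.symm)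
    (hD.isDisc z).isOpen (hx.mem_closure _) (hx.mem_closure_linv i) (h' ▸ hy.mem_closure _)
    (h ▸ hy.mem_closure_linv j)

lemma succ_eq (hD : PingPong g D) (hx : Itinerary g D k x p) (hy : Itinerary g D l y q) {i j : ℤ}
    (hp : p i = q j) (h : x i = y j) : p (i + 1) = q (j + 1) ∧ x (i + 1) = y (j + 1) := by
  have hp' : p (i + 1) = q (j + 1) := by rw [hx.step, hy.step, hp, h]
  refine ⟨hp', ?_⟩
  by_contra hne
  exact notMem_closure_of_pairwise_disjoint (hD.isDisc _) (hD.isDisc _) (hD.isDisc _)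
    (hD.disjoint _ _ hne) (hD.disjoint _ _ (hx.reduced i))
    (hD.disjoint _ _ (h ▸ hy.reduced j)) (hx.mem_closure _) (hp' ▸ hy.mem_closure _)
    (hx.mem_closure_linv i)

lemma eq_of_eq [Nontrivial α] (hD : PingPong g D) (hx : Itinerary g D k x p)
    (hy : Itinerary g D l y q) {i j : ℤ} (h : x i = y j) (h' : x (i + 1) = y (j + 1)) (m : ℤ) :
    x (i + m) = y (j + m) := by
  have forward (n : ℕ) : p (i + 1 + n) = q (j + 1 + n) ∧ x (i + 1 + n) = y (j + 1 + n) := by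
    induction n with
    | zero => simpa using ⟨hx.point_eq hD hy h h', h'⟩
    | succ n ih => simpa only [Nat.cast_succ, add_assoc] using hx.succ_eq hD hy ih.1 ih.2
  set N : ℤ := |m - 1| * (k * l) with hN
  have hxN : x (i + m + N) = x (i + m) := by
    rw [hN, mul_left_comm, mul_comm]
    exact hx.periodic.int_mul _ _
  have hyN : y (j + m + N) = y (j + m) := by
    rw [hN, ← mul_assoc]
    exact hy.periodic.int_mul _ _
  have hpos : 0 ≤ m - 1 + N := by
    have hkl : (1 : ℤ) ≤ k * l := by exact_mod_cast Nat.mul_pos hx.pos hy.pos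
    have := neg_abs_le (m - 1)
    have := le_mul_of_one_le_right (abs_nonneg (m - 1)) hkl
    omega
  have hshift (a : ℤ) : a + m + N = a + 1 + (m - 1 + N).toNat := by omega
  rw [← hxN, ← hyN, hshift, hshift]
  exact (forward _).2

end Itinerary

end Itineraries

/-! ### Cyclic words and exponents in free groups -/

section Repetition

variable {β : Type*}

/-- The bi-infinite periodic repetition of a nonempty list. -/
def repetition (L : List β) (hL : L ≠ []) (i : ℤ) : β :=
  L[(i % L.length).toNat]'(by
    have hpos := List.length_pos_iff.2 hL
    have := Int.emod_lt_of_pos i (Int.natCast_pos.2 hpos)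
    omega)

lemma repetition_periodic {L : List β} (hL : L ≠ []) :
    Function.Periodic (repetition L hL) L.length := fun i => by simp [repetition]

lemma repetition_natCast {L : List β} (hL : L ≠ []) {j : ℕ} (hj : j < L.length) :
    repetition L hL j = L[j] := by
  simp [repetition, ← Int.natCast_emod, Nat.mod_eq_of_lt hj]

lemma repetition_add_one_ne_linv {α : Type*} {L : List (α × Bool)} (hL : L ≠ [])
    (h : FreeGroup.IsCyclicallyReduced L) (i : ℤ) :
    repetition L hL (i + 1) ≠ linv (repetition L hL i) := by
  have ne_linv {x y : α × Bool} (hxy : x.1 = y.1 → x.2 = y.2) : y ≠ linv x := by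
    rintro rfl
    simp [linv] at hxy
  have hpos := List.length_pos_iff.2 hL
  obtain ⟨j, hj⟩ := Int.eq_ofNat_of_zero_le (Int.emod_nonneg i (Int.natCast_ne_zero.2 hpos.ne'))
  have hlt : j < L.length := by
    have := Int.emod_lt_of_pos i (Int.natCast_pos.2 hpos)
    omega
  have hshift (m : ℤ) : repetition L hL (i + m) = repetition L hL (j + m) := by
    rw [← hj, ← Int.mul_ediv_add_emod i L.length, add_assoc, add_comm, mul_comm]
    simpa using (repetition_periodic hL).int_mul (i / L.length) (i % L.length + m)
  rw [hshift, ← add_zero i, hshift, add_zero, repetition_natCast hL hlt]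
  apply ne_linv
  rcases (Nat.succ_le_of_lt hlt).lt_or_eq with hj' | hj'
  · rw [← Nat.cast_succ, repetition_natCast hL hj']
    exact List.isChain_iff_getElem.1 h.1 j hj'
  · have hzero : repetition L hL (j + 1) = L[0] := by
      rw [← Nat.cast_succ, hj', (repetition_periodic hL).eq, ← Nat.cast_zero,
        repetition_natCast hL hpos]
    rw [hzero]
    refine h.2 _ ?_ _ (by simp [List.head?_eq_getElem?, hpos])
    simp [List.getLast?_eq_getElem?, ← hj']

end Repetition

section Conjugation

variable {α : Type*}

lemma letter_of (x : α × Bool) : letter FreeGroup.of x = FreeGroup.mk [x] := by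
  obtain ⟨i, b⟩ := x
  cases b <;> simp [letter, FreeGroup.of, FreeGroup.invRev]

lemma window_of_eq_mk (x : ℤ → α × Bool) (L : List (α × Bool)) (i : ℤ)
    (h : ∀ (j : ℕ) (hj : j < L.length), x (i + j) = L[j]) :
    window FreeGroup.of x i L.length = FreeGroup.mk L := by
  induction L generalizing i with
  | nil => rfl
  | cons a L ih =>
    have hhead : x i = a := (congrArg x (add_zero i)).symm.trans (h 0 (by simp))
    rw [List.length_cons, window_succ, ih, hhead, letter_of, FreeGroup.mul_mk,
      List.singleton_append]
    intro j hj
    rw [add_assoc, add_comm 1, ← Nat.cast_succ]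
    exact h (j + 1) (by simpa using hj)

lemma exists_conj_window {s : FreeGroup α} (hs : s ≠ 1) :
    ∃ (h : FreeGroup α) (k : ℕ) (x : ℤ → α × Bool), 0 < k ∧ (∀ i, x (i + 1) ≠ linv (x i)) ∧
      Function.Periodic x k ∧ s = h * window FreeGroup.of x 0 k * h⁻¹ := by
  classical
  set L := FreeGroup.reduceCyclically s.toWord with hL_def
  set c := FreeGroup.reduceCyclically.conjugator s.toWord with hc_def
  have hsL : s = FreeGroup.mk c * FreeGroup.mk L * (FreeGroup.mk c)⁻¹ := by
    rw [FreeGroup.inv_mk, FreeGroup.mul_mk, FreeGroup.mul_mk, hL_def, hc_def,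
      FreeGroup.reduceCyclically.conj_conjugator_reduceCyclically, FreeGroup.mk_toWord]
  have hL : L ≠ [] := by
    intro h
    rw [h, ← FreeGroup.one_eq_mk, mul_one, mul_inv_cancel] at hsL
    exact hs hsL
  refine ⟨FreeGroup.mk c, L.length, repetition L hL, List.length_pos_iff.2 hL,
    repetition_add_one_ne_linv hL
      (FreeGroup.reduceCyclically.isCyclicallyReduced FreeGroup.isReduced_toWord),
    repetition_periodic hL, ?_⟩
  rwa [window_of_eq_mk]
  intro j hj
  rw [zero_add, repetition_natCast hL hj]

lemma lift_comp_of {H : Type*} [Group H] (g : α → H) : FreeGroup.lift g ∘ FreeGroup.of = g :=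
  funext fun _ => FreeGroup.lift_apply_of

lemma PingPong.lift_injective [Nontrivial α] {g : α → Equiv.Perm Sphere}
    {D : α × Bool → Set Sphere} (hD : PingPong g D) : Function.Injective (FreeGroup.lift g) := by
  rw [injective_iff_map_eq_one]
  intro s hs
  by_contra hne
  obtain ⟨h, k, x, hk, hx, -, rfl⟩ := exists_conj_window hne
  obtain ⟨l, rfl⟩ := Nat.exists_eq_add_one.2 hk
  have hw : window g x 0 (l + 1) = 1 := by
    rwa [map_mul, map_mul, map_inv, conj_eq_one_iff, map_window, lift_comp_of] at hs
  obtain ⟨y, hy, hyl⟩ := exists_third_letter (x 0) (linv (x (0 + l)))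
  have hsub := hD.window_image_subset hx l 0 hyl
  obtain ⟨z, hz⟩ := (hD.isDisc y).nonempty
  exact Set.disjoint_left.1 (hD.disjoint _ _ hy) hz (hsub ⟨z, hz, by rw [hw]; rfl⟩)

end Conjugation

section Exponents

variable {α : Type*} [DecidableEq α]

/-- The exponent sums of an element of a free group: its image in the abelianization. -/
def exponents (u : FreeGroup α) : α → ℤ :=
  (FreeGroup.lift (fun i => Multiplicative.ofAdd (Pi.single i (1 : ℤ))) u).toAdd

@[simp] lemma exponents_of (i : α) : exponents (FreeGroup.of i) = Pi.single i 1 := by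
  simp [exponents]

@[simp] lemma exponents_one : exponents (1 : FreeGroup α) = 0 := rfl

@[simp] lemma exponents_mul (u v : FreeGroup α) :
    exponents (u * v) = exponents u + exponents v := by
  simp [exponents]

@[simp] lemma exponents_inv (u : FreeGroup α) : exponents u⁻¹ = -exponents u := by
  simp [exponents]

@[simp] lemma exponents_pow (u : FreeGroup α) (n : ℕ) : exponents (u ^ n) = n • exponents u := by
  simp [exponents]

@[simp] lemma exponents_zpow (u : FreeGroup α) (n : ℤ) : exponents (u ^ n) = n • exponents u := by
  simp [exponents]

lemma exponents_conj (h u : FreeGroup α) : exponents (h * u * h⁻¹) = exponents u := by simp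

lemma span_exponents [Finite α] {S : Set (FreeGroup α)} (h : Subgroup.closure S = ⊤) :
    Submodule.span ℤ (exponents '' S) = ⊤ := by
  have hmem (u : FreeGroup α) : exponents u ∈ Submodule.span ℤ (exponents '' S) := by
    have hu : u ∈ Subgroup.closure S := h ▸ Subgroup.mem_top u
    induction hu using Subgroup.closure_induction with
    | mem u hu => exact Submodule.subset_span ⟨u, hu, rfl⟩
    | one => simp
    | mul u v _ _ hu hv => simpa using add_mem hu hv
    | inv u _ hu => simpa using hu
  rw [eq_top_iff, ← (Pi.basisFun ℤ α).span_eq, Submodule.span_le]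
  rintro _ ⟨i, rfl⟩
  simpa using hmem (FreeGroup.of i)

lemma card_le_of_closure_eq_top {β : Type*} [Fintype β] {S : Finset (FreeGroup β)}
    (h : Subgroup.closure (S : Set (FreeGroup β)) = ⊤) : Fintype.card β ≤ S.card := by
  classical
  have hle := finrank_span_finset_le_card (R := ℤ) (S.image exponents)
  rw [Finset.coe_image, Set.finrank, span_exponents h, finrank_top, Module.finrank_pi] at hle
  exact hle.trans Finset.card_image_le

/-- The determinant of two exponent vectors. -/
def exponentDet (s t : FreeGroup (Fin 2)) : ℤ :=
  exponents s 0 * exponents t 1 - exponents s 1 * exponents t 0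

lemma isUnit_exponentDet {s t : FreeGroup (Fin 2)} (h : Subgroup.closure {s, t} = ⊤) :
    IsUnit (exponentDet s t) := by
  have hspan (v : Fin 2 → ℤ) : ∃ a b : ℤ, a • exponents s + b • exponents t = v := by
    rw [← Submodule.mem_span_pair, ← Set.image_pair, span_exponents h]
    trivial
  obtain ⟨a, b, hab⟩ := hspan ![1, 0]
  obtain ⟨c, d, hcd⟩ := hspan ![0, 1]
  have ha := congrFun hab
  have hc := congrFun hcd
  simp only [Pi.add_apply, Pi.smul_apply, smul_eq_mul, Fin.forall_fin_two, Matrix.cons_val_zero,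
    Matrix.cons_val_one] at ha hc
  refine IsUnit.of_mul_eq_one (a * d - b * c) ?_
  rw [exponentDet]
  linear_combination (c * exponents s 1 + d * exponents t 1) * ha.1 + hc.2 -
    (c * exponents s 0 + d * exponents t 0) * ha.2

end Exponents

/-! ### Bases of a free group of rank two containing a generator -/

section StartsEnds

lemma exists_append_append {β : Type*} (P : β → Prop) (L : List β) :
    ∃ A M B, A ++ M ++ B = L ∧ (∀ x ∈ A, P x) ∧ (∀ x ∈ B, P x) ∧
      (∀ x ∈ M.head?, ¬P x) ∧ ∀ x ∈ M.getLast?, ¬P x := by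
  classical
  set R := L.dropWhile fun x => decide (P x) with hR
  set M := R.rdropWhile fun x => decide (P x)
  have hMB : M ++ R.rtakeWhile (fun x => decide (P x)) = R := List.rdropWhile_append_rtakeWhile ..
  refine ⟨L.takeWhile fun x => decide (P x), M, R.rtakeWhile fun x => decide (P x), ?_,
    fun x hx => by simpa using List.mem_takeWhile_imp hx,
    fun x hx => by simpa using List.mem_rtakeWhile_imp hx, fun x hx => ?_, fun x hx => ?_⟩
  · rw [List.append_assoc, hMB, List.takeWhile_append_dropWhile]
  · have hhead : R.head? = some x := by
      rw [← hMB]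
      exact List.mem_head?_append_of_mem_head? hx
    simpa [← hR, hhead] using List.head?_dropWhile_not (fun x => decide (P x)) L
  · have hne : M ≠ [] := by
      rintro h
      simp [h] at hx
    rw [List.getLast?_eq_some_getLast hne, Option.mem_some] at hx
    simpa [← hx] using List.rdropWhile_last_not (fun x => decide (P x)) R hne

variable {α : Type*}

lemma mk_mem_zpowers {i : α} {L : List (α × Bool)} (h : ∀ x ∈ L, x.1 = i) :
    FreeGroup.mk L ∈ Subgroup.zpowers (FreeGroup.of i) := by
  induction L with
  | nil => exact one_mem _
  | cons x L ih =>
    rw [← List.singleton_append, ← FreeGroup.mul_mk, ← letter_of]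
    refine mul_mem ?_ (ih fun y hy => h y (List.mem_cons_of_mem _ hy))
    obtain ⟨j, b⟩ := x
    obtain rfl : j = i := h _ List.mem_cons_self
    cases b
    · exact inv_mem (Subgroup.mem_zpowers _)
    · exact Subgroup.mem_zpowers _

lemma exists_eq_letter_of_zpow_eq {u : FreeGroup α} {j : α} {k : ℤ} (h : u ^ k = FreeGroup.of j) :
    ∃ b, u = letter FreeGroup.of (j, b) := by
  classical
  have hexp := congrFun (congrArg exponents h) j
  rw [exponents_zpow, exponents_of, Pi.smul_apply, smul_eq_mul, Pi.single_eq_same] at hexp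
  rcases Int.eq_one_or_neg_one_of_mul_eq_one hexp with rfl | rfl
  · exact ⟨true, by simpa [letter] using h⟩
  · exact ⟨false, by simpa [letter, inv_eq_iff_eq_inv] using h⟩

variable [DecidableEq α] {p q r s : α} {f f' : FreeGroup α}

/-- The reduced word of `f` is nonempty, starts with a letter of the generator `p` and ends with a
letter of the generator `q`. -/
def StartsEnds (p q : α) (f : FreeGroup α) : Prop :=
  (∃ x ∈ f.toWord.head?, x.1 = p) ∧ ∃ x ∈ f.toWord.getLast?, x.1 = q

lemma startsEnds_of (i : α) : StartsEnds i i (FreeGroup.of i) := by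
  simp [StartsEnds]

namespace StartsEnds

lemma length_pos (hf : StartsEnds p q f) : 0 < f.toWord.length := by
  obtain ⟨⟨x, hx, -⟩, -⟩ := hf
  exact List.length_pos_iff.2 fun h => by simp [h] at hx

lemma toWord_mul (hf : StartsEnds p q f) (hf' : StartsEnds r s f') (h : q ≠ r) :
    (f * f').toWord = f.toWord ++ f'.toWord := by
  rw [FreeGroup.toWord_mul, ← FreeGroup.isReduced_iff_reduce_eq, FreeGroup.IsReduced,
    List.isChain_append]
  refine ⟨FreeGroup.isReduced_toWord, FreeGroup.isReduced_toWord, ?_⟩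
  obtain ⟨-, x, hx, rfl⟩ := hf
  obtain ⟨⟨y, hy, rfl⟩, -⟩ := hf'
  intro a ha b hb hab
  rw [Option.mem_unique ha hx, Option.mem_unique hb hy] at hab
  exact absurd hab h

lemma mul (hf : StartsEnds p q f) (hf' : StartsEnds r s f') (h : q ≠ r) :
    StartsEnds p s (f * f') := by
  rw [StartsEnds, hf.toWord_mul hf' h]
  obtain ⟨⟨x, hx, hxp⟩, -⟩ := hf
  obtain ⟨-, y, hy, hyq⟩ := hf'
  exact ⟨⟨x, List.mem_head?_append_of_mem_head? hx, hxp⟩,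
    y, List.mem_getLast?_append_of_mem_getLast? hy, hyq⟩

lemma inv (hf : StartsEnds p q f) : StartsEnds q p f⁻¹ := by
  obtain ⟨⟨x, hx, hxp⟩, y, hy, hyq⟩ := hf
  rw [Option.mem_def] at hx hy
  rw [StartsEnds, FreeGroup.toWord_inv]
  exact ⟨⟨linv y, by simp [FreeGroup.invRev, linv, hy], hyq⟩,
    linv x, by simp [FreeGroup.invRev, linv, hx], hxp⟩

lemma pow (hf : StartsEnds p q f) (n : ℕ) : StartsEnds p q (f ^ (n + 1)) := by
  set c := FreeGroup.reduceCyclically.conjugator f.toWord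
  set L := FreeGroup.reduceCyclically f.toWord
  have hw : f.toWord = c ++ L ++ FreeGroup.invRev c :=
    (FreeGroup.reduceCyclically.conj_conjugator_reduceCyclically _).symm
  have hpow : (f ^ (n + 1)).toWord =
      c ++ (List.replicate (n + 1) L).flatten ++ FreeGroup.invRev c := by
    rw [FreeGroup.toWord_pow,
      FreeGroup.reduceCyclically.reduce_flatten_replicate_succ FreeGroup.isReduced_toWord]
  have hhead : (f ^ (n + 1)).toWord.head? = f.toWord.head? := by
    simp only [hpow, hw, List.append_assoc, List.head?_append,
      List.head?_flatten_replicate n.succ_ne_zero]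
  have hlast : (f ^ (n + 1)).toWord.getLast? = f.toWord.getLast? := by
    simp only [hpow, hw, List.getLast?_append,
      List.getLast?_flatten_replicate n.succ_ne_zero]
  rwa [StartsEnds, hhead, hlast]

lemma zpow (hf : StartsEnds p p f) {n : ℤ} (hn : n ≠ 0) : StartsEnds p p (f ^ n) := by
  obtain ⟨m, rfl | rfl⟩ := n.eq_nat_or_neg
  · obtain ⟨l, rfl⟩ := Nat.exists_eq_succ_of_ne_zero (n := m) (by simpa using hn)
    rw [zpow_natCast]
    exact hf.pow l
  · obtain ⟨l, rfl⟩ := Nat.exists_eq_succ_of_ne_zero (n := m) (by simpa using hn)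
    rw [zpow_neg, zpow_natCast]
    exact (hf.pow l).inv

lemma lift_neWord {v : α → FreeGroup α} (hv : ∀ p, StartsEnds p p (v p))
    (w : Monoid.CoprodI.NeWord (fun _ : α => Multiplicative ℤ) p q) :
    StartsEnds p q (Monoid.CoprodI.lift (fun p => zpowersHom _ (v p)) w.prod) ∧
      (2 ≤ (Monoid.CoprodI.lift (fun p => zpowersHom _ (v p)) w.prod).toWord.length ∨
        ∃ k : ℤ, Monoid.CoprodI.lift (fun p => zpowersHom _ (v p)) w.prod = v p ^ k) := by
  induction w with
  | singleton x hx =>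
    rw [Monoid.CoprodI.NeWord.prod_singleton, Monoid.CoprodI.lift_of, zpowersHom_apply]
    exact ⟨(hv _).zpow (by simpa using hx), Or.inr ⟨_, rfl⟩⟩
  | append w₁ hne w₂ ih₁ ih₂ =>
    rw [Monoid.CoprodI.NeWord.append_prod, map_mul]
    refine ⟨ih₁.1.mul ih₂.1 hne, Or.inl ?_⟩
    rw [ih₁.1.toWord_mul ih₂.1 hne, List.length_append]
    have := ih₁.1.length_pos
    have := ih₂.1.length_pos
    omega

lemma exists_zpow_eq_of {v : α → FreeGroup α} (hv : ∀ p, StartsEnds p p (v p)) {j : α}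
    (hj : FreeGroup.of j ∈ Subgroup.closure (range v)) : ∃ k : ℤ, v j ^ k = FreeGroup.of j := by
  set φ := Monoid.CoprodI.lift fun p => zpowersHom (FreeGroup α) (v p) with hφ
  have hle : Subgroup.closure (range v) ≤ φ.range := by
    rw [Subgroup.closure_le]
    rintro _ ⟨p, rfl⟩
    exact ⟨Monoid.CoprodI.of (i := p) (Multiplicative.ofAdd 1), by simp [hφ]⟩
  obtain ⟨c, hc⟩ := hle hj
  have hne : Monoid.CoprodI.Word.equiv c ≠ Monoid.CoprodI.Word.empty := by
    intro h
    rw [← Equiv.eq_symm_apply] at h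
    rw [h] at hc
    exact FreeGroup.one_ne_of j (hc ▸ (map_one φ).symm)
  obtain ⟨p, q, w, hw⟩ := Monoid.CoprodI.NeWord.of_word _ hne
  have hwc : w.prod = c := Monoid.CoprodI.Word.equiv.injective
    ((Equiv.apply_symm_apply _ _).trans hw)
  obtain ⟨⟨⟨x, hx, hxp⟩, -⟩, hlen | ⟨k, hk⟩⟩ := lift_neWord hv w
  · simp [← hφ, hwc, hc] at hlen
  · rw [← hφ, hwc, hc] at hx hk
    obtain rfl : j = p := by
      rw [FreeGroup.toWord_of, List.head?_singleton, Option.mem_some] at hx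
      rw [← hxp, ← hx]
    exact ⟨k, hk.symm⟩

end StartsEnds

lemma exists_eq_zpow_mul_mul_zpow {i j : Fin 2} (hij : i ≠ j) (t : FreeGroup (Fin 2)) :
    t ∈ Subgroup.zpowers (FreeGroup.of i) ∨ ∃ (m n : ℤ) (u : FreeGroup (Fin 2)),
      t = FreeGroup.of i ^ m * u * FreeGroup.of i ^ n ∧ StartsEnds j j u := by
  have eq_j {a : Fin 2} (ha : a ≠ i) : a = j := by omega
  obtain ⟨A, M, B, hw, hA, hB, hhead, hlast⟩ := exists_append_append (fun x => x.1 = i) t.toWord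
  obtain ⟨m, hm⟩ := Subgroup.mem_zpowers_iff.1 (mk_mem_zpowers hA)
  obtain ⟨n, hn⟩ := Subgroup.mem_zpowers_iff.1 (mk_mem_zpowers hB)
  have ht : t = FreeGroup.of i ^ m * FreeGroup.mk M * FreeGroup.of i ^ n := by
    rw [hm, hn, FreeGroup.mul_mk, FreeGroup.mul_mk, hw, FreeGroup.mk_toWord]
  by_cases hne : M = []
  · left
    rw [ht, hne, ← FreeGroup.one_eq_mk, mul_one, ← zpow_add]
    exact Subgroup.zpow_mem_zpowers _ _
  · have hred : FreeGroup.IsReduced M :=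
      (FreeGroup.isReduced_toWord (x := t)).infix ⟨A, B, hw⟩
    refine Or.inr ⟨m, n, _, ht, ?_⟩
    rw [StartsEnds, FreeGroup.toWord_mk, hred.reduce_eq]
    exact ⟨⟨_, List.head_mem_head? hne, eq_j (hhead _ (List.head_mem_head? hne))⟩,
      _, List.getLast_mem_getLast? hne, eq_j (hlast _ (List.getLast_mem_getLast? hne))⟩

lemma exists_eq_of_closure_eq_top {i j : Fin 2} (hij : i ≠ j) {t : FreeGroup (Fin 2)}
    (h : Subgroup.closure {FreeGroup.of i, t} = ⊤) :
    ∃ (m n : ℤ) (b : Bool),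
      t = FreeGroup.of i ^ m * letter FreeGroup.of (j, b) * FreeGroup.of i ^ n := by
  have hmem (H : Subgroup (FreeGroup (Fin 2))) (hi : FreeGroup.of i ∈ H) (ht : t ∈ H) :
      FreeGroup.of j ∈ H :=
    (Subgroup.closure_le H).2 (Set.pair_subset hi ht) (h ▸ Subgroup.mem_top _)
  rcases exists_eq_zpow_mul_mul_zpow hij t with ht | ⟨m, n, u, rfl, hu⟩
  · obtain ⟨k, hk⟩ := Subgroup.mem_zpowers_iff.1 (hmem _ (Subgroup.mem_zpowers _) ht)
    simpa [hij.symm] using congrFun (congrArg exponents hk) j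
  · set v : Fin 2 → FreeGroup (Fin 2) := Function.update FreeGroup.of j u with hv_def
    have hvi : v i = FreeGroup.of i := Function.update_of_ne hij _ _
    have hvj : v j = u := Function.update_self ..
    have hv (p : Fin 2) : StartsEnds p p (v p) := by
      rcases eq_or_ne p j with rfl | hp
      · rwa [hvj]
      · rw [hv_def, Function.update_of_ne hp]
        exact startsEnds_of p
    have hi : FreeGroup.of i ∈ Subgroup.closure (range v) :=
      Subgroup.subset_closure ⟨i, hvi⟩
    obtain ⟨k, hk⟩ := StartsEnds.exists_zpow_eq_of hv (hmem _ hi (mul_mem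
      (mul_mem (zpow_mem hi _) (Subgroup.subset_closure ⟨j, hvj⟩)) (zpow_mem hi _)))
    obtain ⟨b, hb⟩ := exists_eq_letter_of_zpow_eq (hvj ▸ hk)
    exact ⟨m, n, b, by rw [hb]⟩

end StartsEnds

/-! ### Tangencies along parabolic words -/

section Tangencies

variable {α : Type*}

lemma window_reverse {H : Type*} [Group H] (g : α → H) (x : ℤ → α × Bool) (i : ℤ) (k : ℕ) :
    window g (fun i => linv (x (-i))) i k = (window g x (1 - i - k) k)⁻¹ := by
  induction k generalizing i with
  | zero => simp [window_zero]
  | succ k ih =>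
    have hstart : 1 - i - (k + 1 : ℕ) = 1 - (i + 1) - k := by
      push_cast
      ring
    have hend : 1 - (i + 1) - k + k = -i := by ring
    rw [window_succ, ih, letter_linv, ← mul_inv_rev, hstart, window_add, window_one, hend]

section Exponents

variable [DecidableEq α] {x y : ℤ → α × Bool} {k l : ℕ}

lemma exponents_window_eq (hx : Function.Periodic x k) (i : ℤ) :
    exponents (window FreeGroup.of x i k) = exponents (window FreeGroup.of x 0 k) := by
  have hstep (i : ℤ) :
      exponents (window FreeGroup.of x (i + 1) k) = exponents (window FreeGroup.of x i k) := by
    simp [window_add_one FreeGroup.of hx]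
  induction i using Int.induction_on with
  | zero => rfl
  | succ i ih => rw [hstep, ih]
  | pred i ih => rw [← ih, ← hstep, sub_add_cancel]

lemma smul_exponents_window (hx : Function.Periodic x k) (hy : Function.Periodic y l) {i j : ℤ}
    (h : ∀ m, x (i + m) = y (j + m)) :
    l • exponents (window FreeGroup.of x 0 k) = k • exponents (window FreeGroup.of y 0 l) := by
  rw [← exponents_window_eq hx i, ← exponents_window_eq hy j, ← exponents_pow, ← exponents_pow,
    ← window_mul _ hx, ← window_mul _ hy, mul_comm l, window_congr _ h]

/-- The exponents of a single letter. -/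
def letterExponents (x : α × Bool) : α → ℤ := Pi.single x.1 (bif x.2 then 1 else -1)

lemma exponents_letter (x : α × Bool) : exponents (letter FreeGroup.of x) = letterExponents x := by
  obtain ⟨i, b⟩ := x
  cases b <;> simp [letter, letterExponents, Pi.single_neg]

lemma exponents_window (x : ℤ → α × Bool) (k : ℕ) :
    exponents (window FreeGroup.of x 0 k) = ∑ j : Fin k, letterExponents (x j) := by
  induction k with
  | zero => simp [window_zero]
  | succ k ih =>
    rw [window_add, exponents_mul, ih, window_one, exponents_letter, zero_add,
      Fin.sum_univ_castSucc]
    rfl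

end Exponents

/-- The pair of letters whose discs touch between the positions `i` and `i + 1`. -/
def tangency (x : ℤ → α × Bool) (i : ℤ) : Sym2 (α × Bool) := s(x (i + 1), linv (x i))

/-- The pairs of letters whose discs touch along a cyclic word. -/
def cyclicTangency {k : ℕ} (u : Fin (k + 1) → α × Bool) (j : Fin (k + 1)) : Sym2 (α × Bool) :=
  s(u (j + 1), linv (u j))

lemma cyclicTangency_eq {x : ℤ → α × Bool} {k : ℕ} (hx : Function.Periodic x (k + 1 : ℕ))
    (j : Fin (k + 1)) : cyclicTangency (fun i => x i) j = tangency x j := by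
  have hmod : x ((j + 1 : Fin (k + 1)) : ℕ) = x (j + 1) := by
    rw [Fin.val_add_one]
    split_ifs with h
    · rw [h, Fin.val_last, ← Nat.cast_succ, hx.eq, Nat.cast_zero]
    · rw [Nat.cast_succ]
  rw [cyclicTangency, tangency, hmod]

variable {g : α → Equiv.Perm Sphere} {D : α × Bool → Set Sphere} {x y : ℤ → α × Bool}
  {p q : ℤ → Sphere} {k l : ℕ} {i j : ℤ}

namespace Itinerary

lemma smul_exponents_eq_neg [DecidableEq α] [Nontrivial α] (hD : PingPong g D)
    (hx : Itinerary g D k x p) (hy : Itinerary g D l y q) (h : x i = linv (y (j + 1)))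
    (h' : x (i + 1) = linv (y j)) :
    l • exponents (window FreeGroup.of x 0 k) = -(k • exponents (window FreeGroup.of y 0 l)) := by
  have heq := hx.eq_of_eq hD hy.reverse (i := i) (j := -(j + 1)) (by rw [h, neg_neg])
    (by rw [h']; congr 2; ring)
  rw [smul_exponents_window hx.periodic hy.reverse.periodic heq, window_reverse, exponents_inv,
    exponents_window_eq hy.periodic, smul_neg]

lemma tangency_cases [Nontrivial α] [DecidableEq α] (hD : PingPong g D)
    (hx : Itinerary g D k x p) (hy : Itinerary g D l y q) (h : tangency x i = tangency y j) :
    (∀ m, x (i + m) = y (j + m)) ∨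
      l • exponents (window FreeGroup.of x 0 k) =
        -(k • exponents (window FreeGroup.of y 0 l)) := by
  rcases Sym2.eq_iff.1 h with ⟨h1, h2⟩ | ⟨h1, h2⟩
  · exact Or.inl (hx.eq_of_eq hD hy (linv_injective h2) h1)
  · exact Or.inr (hx.smul_exponents_eq_neg hD hy (by rw [← h2, linv_linv]) h1)

end Itinerary

end Tangencies

section Enumeration

variable {g : Fin 2 → Equiv.Perm Sphere} {D : Fin 2 × Bool → Set Sphere}
  {x y : ℤ → Fin 2 × Bool} {p q : ℤ → Sphere} {k l : ℕ}

lemma exponentDet_swap (s t : FreeGroup (Fin 2)) : exponentDet t s = -exponentDet s t := by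
  rw [exponentDet, exponentDet]
  ring

lemma mul_exponentDet_eq {s s' : FreeGroup (Fin 2)} {m n : ℤ}
    (h : m • exponents s = n • exponents s') (t : FreeGroup (Fin 2)) :
    m * exponentDet s t = n * exponentDet s' t := by
  have h' := congrFun h
  simp only [Pi.smul_apply, smul_eq_mul] at h'
  rw [exponentDet, exponentDet]
  linear_combination exponents t 1 * h' 0 - exponents t 0 * h' 1

lemma exponentDet_self (s : FreeGroup (Fin 2)) : exponentDet s s = 0 := by
  rw [exponentDet, mul_comm, sub_self]

namespace Itinerary

lemma tangency_ne_tangency (hD : PingPong g D) (hx : Itinerary g D k x p)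
    (hy : Itinerary g D l y q)
    (hdet : exponentDet (window FreeGroup.of x 0 k) (window FreeGroup.of y 0 l) ≠ 0) (i j : ℤ) :
    tangency x i ≠ tangency y j := by
  intro h
  obtain ⟨n, hn⟩ : ∃ n : ℤ, (l : ℤ) • exponents (window FreeGroup.of x 0 k) =
      n • exponents (window FreeGroup.of y 0 l) := by
    rcases hx.tangency_cases hD hy h with h | h
    · exact ⟨k, by exact_mod_cast smul_exponents_window hx.periodic hy.periodic h⟩
    · exact ⟨-k, by rw [neg_smul]; exact_mod_cast h⟩
  have hzero := mul_exponentDet_eq hn (window FreeGroup.of y 0 l)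
  rw [exponentDet_self, mul_zero] at hzero
  exact hdet ((mul_eq_zero.1 hzero).resolve_left (Int.natCast_ne_zero.2 hy.pos.ne'))

lemma tangency_ne_of_lt (hD : PingPong g D) (hx : Itinerary g D k x p)
    {t : FreeGroup (Fin 2)} (hdet : IsUnit (exponentDet (window FreeGroup.of x 0 k) t)) {i j : ℤ}
    (hij : i < j) (hjk : j < i + k) : tangency x i ≠ tangency x j := by
  intro h
  rcases hx.tangency_cases hD hx h with h | h
  · obtain ⟨e, rfl⟩ : ∃ e : ℕ, j = i + e := ⟨(j - i).toNat, by omega⟩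
    have hper : Function.Periodic x e := by
      intro n
      have := h (n - i)
      rw [add_right_comm, add_sub_cancel] at this
      exact this.symm
    have hsmul : (e : ℤ) • exponents (window FreeGroup.of x 0 k) =
        (k : ℤ) • exponents (window FreeGroup.of x 0 e) := by
      exact_mod_cast smul_exponents_window hx.periodic hper (i := 0) (j := 0) fun _ => rfl
    have hdvd : (k : ℤ) ∣ e := by
      rw [← hdet.dvd_mul_right, mul_exponentDet_eq hsmul t]
      exact dvd_mul_right _ _
    have := Int.le_of_dvd (by omega) hdvd
    omega
  · have hzero : exponents (window FreeGroup.of x 0 k) = 0 :=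
      (smul_eq_zero.1 (self_eq_neg.1 h)).resolve_left hx.pos.ne'
    simp [exponentDet, hzero] at hdet

end Itinerary

/-- The cyclic words whose consecutive discs are distinct and touch in pairwise distinct pairs. -/
def HasSimpleTangencies {k : ℕ} (u : Fin (k + 1) → Fin 2 × Bool) : Prop :=
  (∀ j, ¬(cyclicTangency u j).IsDiag) ∧ Function.Injective (cyclicTangency u)

instance {k : ℕ} (u : Fin (k + 1) → Fin 2 × Bool) : Decidable (HasSimpleTangencies u) := by
  unfold HasSimpleTangencies
  infer_instance

lemma HasSimpleTangencies.add_le {k l : ℕ} {u : Fin (k + 1) → Fin 2 × Bool}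
    {v : Fin (l + 1) → Fin 2 × Bool} (hu : HasSimpleTangencies u) (hv : HasSimpleTangencies v)
    (huv : ∀ i j, cyclicTangency u i ≠ cyclicTangency v j) : k + l ≤ 4 := by
  let f : Fin (k + 1) ⊕ Fin (l + 1) → {z : Sym2 (Fin 2 × Bool) // ¬z.IsDiag} :=
    Sum.elim (fun i => ⟨_, hu.1 i⟩) (fun j => ⟨_, hv.1 j⟩)
  have hf : Function.Injective f :=
    Function.Injective.sumElim (fun i j h => hu.2 (congrArg Subtype.val h))
      (fun i j h => hv.2 (congrArg Subtype.val h)) fun i j h => huv i j (congrArg Subtype.val h)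
  have hcard := Fintype.card_le_of_injective f hf
  rw [Sym2.card_subtype_not_diag, Fintype.card_sum, Fintype.card_prod, Fintype.card_fin,
    Fintype.card_fin, Fintype.card_fin, Fintype.card_bool] at hcard
  have : Nat.choose (2 * 2) 2 = 6 := by decide
  omega

set_option maxRecDepth 100000 in
set_option synthInstance.maxSize 4000 in
set_option synthInstance.maxHeartbeats 400000 in
-- Four of the six tangencies join letters of different generators, and a word of length at least
-- two uses at least two of them. Hence each word uses exactly two, which makes them `a ^ m * b ^ n`
-- and `a ^ p * b ^ (-q)` with `m * p` and `n * q` positive, and `|m * q + n * p| ≥ 2`.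
lemma natAbs_det_letterExponents_ne_one {k l : ℕ} (hk : 0 < k) (hl : 0 < l)
    {u : Fin (k + 1) → Fin 2 × Bool} {v : Fin (l + 1) → Fin 2 × Bool}
    (hu : HasSimpleTangencies u) (hv : HasSimpleTangencies v)
    (huv : ∀ i j, cyclicTangency u i ≠ cyclicTangency v j) :
    ((∑ i, letterExponents (u i) 0) * (∑ j, letterExponents (v j) 1) -
      (∑ i, letterExponents (u i) 1) * ∑ j, letterExponents (v j) 0).natAbs ≠ 1 := by
  have hkl := hu.add_le hv huv
  have hk' : k ≤ 3 := by omega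
  have hl' : l ≤ 4 - k := by omega
  clear hkl
  revert u v
  interval_cases k <;> interval_cases l <;> decide +kernel

namespace Itinerary

lemma hasSimpleTangencies (hD : PingPong g D) (hx : Itinerary g D (k + 1) x p)
    {t : FreeGroup (Fin 2)}
    (hdet : IsUnit (exponentDet (window FreeGroup.of x 0 (k + 1)) t)) :
    HasSimpleTangencies fun i : Fin (k + 1) => x i := by
  refine ⟨fun j h => ?_, fun i j h => ?_⟩
  · rw [cyclicTangency_eq hx.periodic, tangency, Sym2.mk_isDiag_iff] at h
    exact hx.reduced j h
  · rw [cyclicTangency_eq hx.periodic, cyclicTangency_eq hx.periodic] at h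
    by_contra hne
    rcases lt_or_gt_of_ne hne with hlt | hlt
    · exact hx.tangency_ne_of_lt hD hdet (by omega) (by omega) h
    · exact hx.tangency_ne_of_lt hD hdet (by omega) (by omega) h.symm

lemma length_eq_one (hD : PingPong g D) (hx : Itinerary g D k x p) (hy : Itinerary g D l y q)
    (hdet : IsUnit (exponentDet (window FreeGroup.of x 0 k) (window FreeGroup.of y 0 l))) :
    k = 1 ∨ l = 1 := by
  obtain ⟨k, rfl⟩ := Nat.exists_eq_add_one.2 hx.pos
  obtain ⟨l, rfl⟩ := Nat.exists_eq_add_one.2 hy.pos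
  by_contra! h
  refine natAbs_det_letterExponents_ne_one (k := k) (l := l) (by omega) (by omega)
    (hx.hasSimpleTangencies hD hdet)
    (hy.hasSimpleTangencies hD (by rw [exponentDet_swap]; exact hdet.neg)) (fun i j => ?_) ?_
  · rw [cyclicTangency_eq hx.periodic, cyclicTangency_eq hy.periodic]
    exact hx.tangency_ne_tangency hD hy hdet.ne_zero i j
  · rw [← Int.isUnit_iff_natAbs_eq]
    simpa only [exponentDet, exponents_window, Finset.sum_apply] using hdet

end Itinerary

end Enumeration

/-! ### Half-planes and discs tangent at the origin -/

section TangentDisc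

open ComplexConjugate

variable {D E : Set Sphere} {m n σ τ : ℂ} {k l : ℝ}

lemma image_transl_halfPlane (n τ : ℂ) (k : ℝ) :
    transl τ '' halfPlane n k = halfPlane n (k + inner ℝ n τ) := by
  refine image_eq_of_mem_iff _ fun z => ?_
  induction z using OnePoint.rec with
  | infty => simp only [transl_infty, infty_notMem_halfPlane]
  | coe z =>
    rw [transl_coe, coe_mem_halfPlane, coe_mem_halfPlane, inner_add_right, add_lt_add_iff_right]

lemma le_of_halfPlane_subset (hn : ‖n‖ = 1) (h : halfPlane n k ⊆ halfPlane n l) : l ≤ k := by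
  have hinner (t : ℝ) : inner ℝ n (t • n) = t := by
    rw [real_inner_smul_right, real_inner_self_eq_norm_sq, hn, one_pow, mul_one]
  by_contra! hlt
  have hmem := coe_mem_halfPlane.1 (h (coe_mem_halfPlane.2 (hlt.trans_eq (hinner l).symm)))
  exact lt_irrefl l (hmem.trans_eq (hinner l))

lemma add_eq_inner_of_image_transl (hn : ‖n‖ = 1)
    (h : transl τ '' (closure (halfPlane (-n) l))ᶜ = halfPlane n k) : k + l = inner ℝ n τ := by
  rw [closure_halfPlane (neg_ne_zero.2 (norm_ne_zero_iff.1 (hn ▸ one_ne_zero))), neg_neg,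
    compl_compl, image_transl_halfPlane] at h
  linarith [le_of_halfPlane_subset hn h.le, le_of_halfPlane_subset hn h.ge]

lemma nonneg_of_zero_notMem_halfPlane (h : ((0 : ℂ) : Sphere) ∉ halfPlane n k) : 0 ≤ k := by
  simpa only [coe_mem_halfPlane, inner_zero_right, not_lt] using h

lemma exists_halfPlanes (hD : IsDisc D) (hE : IsDisc E) (hDE : Disjoint D E)
    (hcD : ∞ ∈ closure D) (hcE : ∞ ∈ closure E) (h : transl τ '' (closure E)ᶜ = D) :
    ∃ (n : ℂ) (k l : ℝ), ‖n‖ = 1 ∧ D = halfPlane n k ∧ E = halfPlane (-n) l ∧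
      k + l = inner ℝ n τ := by
  obtain ⟨n, k, l, hn, hk, hl, -⟩ := hD.exists_halfPlane_of_tangent hE hDE hcD hcE
    (one_mem moebiusGroup) rfl
  rw [Equiv.Perm.coe_one, Set.image_id] at hk hl
  exact ⟨n, k, l, hn, hk, hl, add_eq_inner_of_image_transl hn (hk ▸ hl ▸ h)⟩

/-- The disc of the `z` with `l * ‖z‖ ^ 2 < ⟪m, z⟫`, which touches at `0` the line orthogonal to
`m`; a half-plane when `l = 0`. -/
def tangentDisc (m : ℂ) (l : ℝ) : Set Sphere := swap '' halfPlane (conj m) l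

lemma inner_conj_inv (m z : ℂ) : inner ℝ (conj m) z⁻¹ = inner ℝ m z / ‖z‖ ^ 2 := by
  rw [inner_eq_re_mul_re_add_im_mul_im, inner_eq_re_mul_re_add_im_mul_im, Complex.inv_re,
    Complex.inv_im, Complex.conj_re, Complex.conj_im, Complex.normSq_eq_norm_sq]
  ring

lemma coe_mem_tangentDisc {z : ℂ} :
    (z : Sphere) ∈ tangentDisc m l ↔ l * ‖z‖ ^ 2 < inner ℝ m z := by
  have hswap : (z : Sphere) ∈ tangentDisc m l ↔ swap z ∈ halfPlane (conj m) l := by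
    conv_lhs => rw [← swap_swap z]
    exact swap.injective.mem_set_image
  rcases eq_or_ne z 0 with rfl | hz
  · simp [hswap, swap_zero, infty_notMem_halfPlane]
  · rw [hswap, swap_coe hz, coe_mem_halfPlane, inner_conj_inv,
      lt_div_iff₀ (pow_pos (norm_pos_iff.2 hz) 2)]

lemma exists_tangentDiscs (hD : IsDisc D) (hE : IsDisc E) (hDE : Disjoint D E)
    (hcD : ((0 : ℂ) : Sphere) ∈ closure D) (hcE : ((0 : ℂ) : Sphere) ∈ closure E)
    (hD' : ∞ ∉ D) (hE' : ∞ ∉ E) (h : coTransl σ '' (closure E)ᶜ = D) :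
    ∃ (m : ℂ) (k l : ℝ), ‖m‖ = 1 ∧ 0 ≤ k ∧ 0 ≤ l ∧ D = tangentDisc m k ∧
      E = tangentDisc (-m) l ∧ k + l = inner ℝ (conj m) σ := by
  have hclosure {F : Set Sphere} (hF : ((0 : ℂ) : Sphere) ∈ closure F) :
      ∞ ∈ closure (swap '' F) := by
    rw [← image_closure_of_mem swap_mem, ← swap_zero]
    exact Set.mem_image_of_mem swap hF
  have hzero {F : Set Sphere} (hF : ∞ ∉ F) : ((0 : ℂ) : Sphere) ∉ swap '' F := by
    rwa [← swap_infty, swap.injective.mem_set_image]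
  have htransl : transl σ '' (closure (swap '' E))ᶜ = swap '' D := by
    rw [← image_closure_of_mem swap_mem, ← Set.image_compl_eq swap.bijective, transl_eq, ← h,
      ← Set.image_comp, ← Set.image_comp]
    congr 1
    funext z
    simp
  have hswap (F : Set Sphere) : swap '' (swap '' F) = F := by
    rw [← Set.image_comp, ← Equiv.Perm.coe_mul, swap_mul_swap, Equiv.Perm.coe_one, Set.image_id]
  obtain ⟨n, k, l, hn, hk, hl, hkl⟩ := exists_halfPlanes (hD.image swap_mem) (hE.image swap_mem)
    ((Set.disjoint_image_iff swap.injective).2 hDE) (hclosure hcD) (hclosure hcE) htransl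
  refine ⟨conj n, k, l, (Complex.norm_conj n).trans hn,
    nonneg_of_zero_notMem_halfPlane (hk ▸ hzero hD'),
    nonneg_of_zero_notMem_halfPlane (hl ▸ hzero hE'), ?_, ?_, ?_⟩
  · rw [tangentDisc, Complex.conj_conj, ← hk, hswap]
  · rw [tangentDisc, map_neg, Complex.conj_conj, ← hl, hswap]
  · rw [Complex.conj_conj, hkl]

lemma norm_add_sq_of_norm_eq_one (hm : ‖m‖ = 1) (hn : ‖n‖ = 1) :
    ‖m + n‖ ^ 2 = 2 * (1 + inner ℝ n m) := by
  rw [norm_add_sq_real, hm, hn, real_inner_comm]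
  ring

/-- For `L > l` the disc `tangentDisc m l` contains `(m + n) / (2 * L)`, the point of
`tangentDisc m L` that is farthest in the direction `n`. -/
lemma one_add_inner_le (hk : 0 ≤ k) (hl : 0 ≤ l) (hm : ‖m‖ = 1) (hn : ‖n‖ = 1)
    (h : Disjoint (tangentDisc m l) (halfPlane n k)) : 1 + inner ℝ n m ≤ 2 * l * k := by
  by_cases hc : 1 + inner ℝ n m ≤ 0
  · exact hc.trans (by positivity)
  push Not at hc
  have hlt {L : ℝ} (hL : l < L) : 1 + inner ℝ n m ≤ 2 * L * k := by
    have hL₀ : 0 < L := hl.trans_lt hL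
    have hmem : (((2 * L)⁻¹ • (m + n) : ℂ) : Sphere) ∈ tangentDisc m l := by
      rw [coe_mem_tangentDisc, norm_smul, mul_pow, norm_add_sq_of_norm_eq_one hm hn,
        real_inner_smul_right, inner_add_right, real_inner_self_eq_norm_sq, hm, one_pow,
        real_inner_comm n m, Real.norm_of_nonneg (by positivity)]
      field_simp
      exact hL
    have hle : inner ℝ n ((2 * L)⁻¹ • (m + n)) ≤ k :=
      not_lt.1 (mt coe_mem_halfPlane.2 (Set.disjoint_left.1 h hmem))
    rw [real_inner_smul_right, inner_add_right, real_inner_self_eq_norm_sq, hn, one_pow,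
      inv_mul_le_iff₀ (by positivity)] at hle
    linarith
  have htendsto : Tendsto (fun L : ℝ => 2 * L * k) (𝓝[>] l) (𝓝 (2 * l * k)) :=
    (by fun_prop : Continuous fun L : ℝ => 2 * L * k).continuousWithinAt
  exact ge_of_tendsto htendsto (eventually_mem_nhdsWithin.mono fun L hL => hlt hL)

lemma ball_subset_tangentDisc (hl : 0 < l) (hm : ‖m‖ = 1) :
    (↑) '' Metric.ball ((2 * l)⁻¹ • m) (2 * l)⁻¹ ⊆ tangentDisc m l := by
  rintro _ ⟨z, hz, rfl⟩
  rw [mem_ball_iff_norm] at hz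
  have hsq := pow_lt_pow_left₀ hz (norm_nonneg _) two_ne_zero
  rw [norm_sub_sq_real, norm_smul, hm, Real.norm_of_nonneg (by positivity), mul_one,
    real_inner_smul_right, real_inner_comm] at hsq
  have hlt : ‖z‖ ^ 2 < inner ℝ m z / l := by
    rw [div_eq_inv_mul]
    rw [mul_inv] at hsq
    linarith
  rw [coe_mem_tangentDisc, mul_comm]
  exact (lt_div_iff₀ hl).1 hlt

lemma inner_mul_inv_add_inv_le (hk : 0 < k) (hl : 0 < l) (hn : ‖n‖ = 1)
    (h : Disjoint (tangentDisc n k) (transl τ '' tangentDisc (-n) l)) :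
    inner ℝ n τ * (k⁻¹ + l⁻¹) ≤ ‖τ‖ ^ 2 := by
  have hballs : Disjoint (Metric.ball ((2 * k)⁻¹ • n) (2 * k)⁻¹)
      (Metric.ball ((2 * l)⁻¹ • (-n) + τ) (2 * l)⁻¹) := by
    refine Set.disjoint_left.2 fun z hz hz' => Set.disjoint_left.1 h
      (ball_subset_tangentDisc hk hn ⟨z, hz, rfl⟩) ⟨((z - τ : ℂ) : Sphere), ?_, ?_⟩
    · refine ball_subset_tangentDisc hl (by rwa [norm_neg]) ⟨z - τ, ?_, rfl⟩
      rw [mem_ball_iff_norm] at hz' ⊢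
      rwa [sub_sub, add_comm τ]
    · rw [transl_coe, sub_add_cancel]
  rw [disjoint_ball_ball_iff (by positivity) (by positivity), dist_eq_norm] at hballs
  set r : ℝ := (2 * k)⁻¹ + (2 * l)⁻¹ with hr
  have hcenters : (2 * k)⁻¹ • n - ((2 * l)⁻¹ • (-n) + τ) = r • n - τ := by
    rw [hr, add_smul, smul_neg]
    ring
  have hr₀ : 0 ≤ r := by positivity
  have hsq := pow_le_pow_left₀ hr₀ hballs 2
  rw [hcenters, norm_sub_sq_real, norm_smul, hn, mul_one, Real.norm_of_nonneg hr₀,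
    real_inner_smul_left] at hsq
  rw [mul_inv, mul_inv] at hr
  linear_combination hsq + 2 * inner ℝ n τ * hr

end TangentDisc

section Inequalities

open ComplexConjugate

variable {m n τ σ w u S T : ℂ} {k k' l l' : ℝ}

lemma two_mul_re_mul_re_le (T S : ℂ) : 2 * (T.re * S.re) ≤ ‖T * S‖ + (T * S).re := by
  have hle : (conj T * S).re ≤ ‖T * S‖ :=
    (Complex.re_le_norm _).trans_eq (by rw [norm_mul, norm_mul, Complex.norm_conj])
  rw [Complex.mul_re, Complex.conj_re, Complex.conj_im] at hle
  rw [Complex.mul_re]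
  linarith

lemma four_le_of_le_norm_add_re (hu : ‖u‖ = 1) (h : 4 * (1 + |u.re|) ≤ ‖w‖ + (u * w).re) :
    4 ≤ ‖w‖ + |w.im| := by
  by_contra! hlt
  have hre : (u * w).re ≤ |u.re| * |w.re| + |w.im| := by
    have him : |u.im| * |w.im| ≤ 1 * |w.im| := by
      gcongr
      exact hu ▸ Complex.abs_im_le_norm u
    rw [Complex.mul_re, ← abs_mul]
    rw [one_mul, ← abs_mul] at him
    linarith [le_abs_self (u.re * w.re), neg_abs_le (u.im * w.im)]
  have hmul : |u.re| * |w.re| ≤ |u.re| * 4 := by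
    gcongr
    linarith [abs_nonneg w.im, Complex.abs_re_le_norm w]
  linarith [abs_nonneg u.re]

lemma four_le_of_inner_mul_inner (hm : ‖m‖ = 1) (hn : ‖n‖ = 1)
    (h : 2 * (1 + |inner ℝ n m|) ≤ inner ℝ n τ * inner ℝ (conj m) σ) :
    4 ≤ ‖τ * σ‖ + |(τ * σ).im| := by
  have hu : ‖conj n * m‖ = 1 := by rw [norm_mul, Complex.norm_conj, hm, hn, one_mul]
  refine four_le_of_le_norm_add_re hu ?_
  have hle := two_mul_re_mul_re_le (conj n * τ) (m * σ)
  rw [mul_mul_mul_comm, norm_mul, hu, one_mul] at hle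
  rw [Complex.inner, Complex.inner, Complex.inner, Complex.conj_conj, mul_comm m, mul_comm τ,
    mul_comm σ] at h
  linarith

lemma four_le_of_le_norm_sq_mul_re (hT : 0 < T.re) (h : 2 ≤ T.re * S.re)
    (h' : 4 * T.re ≤ ‖T‖ ^ 2 * S.re) : 4 ≤ ‖T * S‖ + |(T * S).im| := by
  by_contra! hlt
  set w := T * S with hw
  have him : |w.im| < 2 := by linarith [Complex.abs_im_le_norm w]
  have hsq : ‖T‖ ^ 2 = T.re ^ 2 + |T.im| ^ 2 := by
    rw [Complex.sq_norm, Complex.normSq_apply, sq_abs]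
    ring
  have hle : ‖T‖ ^ 2 * S.re ≤ T.re * |w.re| + |T.im| * |w.im| := by
    have hid : ‖T‖ ^ 2 * S.re = T.re * w.re + T.im * w.im := by
      rw [hsq, sq_abs, hw, Complex.mul_re, Complex.mul_im]
      ring
    rw [hid, ← abs_mul T.im]
    exact add_le_add (mul_le_mul_of_nonneg_left (le_abs_self _) hT.le) (le_abs_self _)
  have hre : T.re * |w.re| < T.re * (4 - |w.im|) :=
    mul_lt_mul_of_pos_left (by linarith [Complex.abs_re_le_norm w]) hT
  rcases le_total |T.im| T.re with hq | hq
  · linarith [mul_le_mul_of_nonneg_right hq (abs_nonneg w.im)]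
  · have hlt' : ‖T‖ ^ 2 * S.re < 2 * (T.re + |T.im|) := by
      linarith [mul_le_mul_of_nonneg_left him.le (sub_nonneg.2 hq)]
    have hupper := mul_lt_mul_of_pos_left hlt' hT
    have hlower := mul_le_mul_of_nonneg_left h (sq_nonneg ‖T‖)
    rw [hsq] at hupper hlower
    nlinarith [mul_le_mul_of_nonneg_right hq (abs_nonneg T.im)]

lemma two_mul_le_add_mul_add {e p q r s : ℝ} (hp : 0 ≤ p) (hq : 0 ≤ q) (hr : 0 ≤ r) (hs : 0 ≤ s)
    (h : e ≤ 2 * p * q) (h' : e ≤ 2 * r * s) : 2 * e ≤ (p + r) * (q + s) := by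
  rcases le_total e 0 with he | he
  · exact (by linarith : 2 * e ≤ 0).trans (by positivity)
  have hcross : e ≤ p * s + r * q := by
    refine le_of_sq_le_sq ?_ (by positivity)
    calc e ^ 2 = e * e := sq e
      _ ≤ (2 * p * q) * (2 * r * s) := by gcongr
      _ ≤ (p * s + r * q) ^ 2 := by linarith [sq_nonneg (p * s - r * q)]
  linarith

lemma two_mul_one_add_abs_inner_le (hk : 0 ≤ k) (hk' : 0 ≤ k') (hl : 0 ≤ l) (hl' : 0 ≤ l')
    (hm : ‖m‖ = 1) (hn : ‖n‖ = 1) (h₁ : Disjoint (tangentDisc m l) (halfPlane n k))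
    (h₂ : Disjoint (tangentDisc m l) (halfPlane (-n) k'))
    (h₃ : Disjoint (tangentDisc (-m) l') (halfPlane n k))
    (h₄ : Disjoint (tangentDisc (-m) l') (halfPlane (-n) k')) :
    2 * (1 + |inner ℝ n m|) ≤ (k + k') * (l + l') := by
  have hm' : ‖-m‖ = 1 := by rwa [norm_neg]
  have hn' : ‖-n‖ = 1 := by rwa [norm_neg]
  have h₁ := one_add_inner_le hk hl hm hn h₁
  have h₂ := one_add_inner_le hk' hl hm hn' h₂
  have h₃ := one_add_inner_le hk hl' hm' hn h₃
  have h₄ := one_add_inner_le hk' hl' hm' hn' h₄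
  rw [inner_neg_left] at h₂
  rw [inner_neg_right] at h₃
  rw [inner_neg_neg] at h₄
  rw [mul_comm (k + k')]
  rcases abs_cases (inner ℝ n m) with ⟨habs, -⟩ | ⟨habs, -⟩
  · rw [habs]
    exact two_mul_le_add_mul_add hl hk hl' hk' h₁ h₄
  · rw [habs, add_comm k]
    exact two_mul_le_add_mul_add hl hk' hl' hk h₂ h₃

lemma eq_of_disjoint_tangentDisc (hl : 0 ≤ l) (hm : ‖m‖ = 1) (hn : ‖n‖ = 1)
    (h : Disjoint (tangentDisc m l) (halfPlane (-n) 0)) : n = m := by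
  have hge := one_add_inner_le le_rfl hl hm (by rwa [norm_neg]) h
  rw [inner_neg_left] at hge
  refine (inner_eq_one_iff_of_norm_eq_one (𝕜 := ℝ) hn hm).1 (le_antisymm ?_ (by linarith))
  simpa [hm, hn] using real_inner_le_norm n m

lemma four_le_inv_add_inv_mul_add (hl : 0 < l) (hl' : 0 < l') :
    4 ≤ (l⁻¹ + l'⁻¹) * (l + l') := by
  have hid : (l⁻¹ + l'⁻¹) * (l + l') = 4 + (l - l') ^ 2 / (l * l') := by
    field_simp
    ring
  rw [hid]
  exact le_add_of_nonneg_right (by positivity)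

lemma four_le_of_tangentDisc (hl : 0 ≤ l) (hl' : 0 ≤ l') (hτ : 0 ≤ inner ℝ n τ)
    (hm : ‖m‖ = 1) (hn : ‖n‖ = 1) (hσ : l + l' = inner ℝ (conj m) σ)
    (h₁ : Disjoint (tangentDisc m l) (halfPlane n (inner ℝ n τ)))
    (h₂ : Disjoint (tangentDisc m l) (halfPlane (-n) 0))
    (h₃ : Disjoint (transl τ '' tangentDisc (-m) l') (halfPlane (-n) 0))
    (h₄ : Disjoint (tangentDisc m l) (transl τ '' tangentDisc (-m) l')) :
    4 ≤ ‖τ * σ‖ + |(τ * σ).im| := by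
  obtain rfl := eq_of_disjoint_tangentDisc hl hm hn h₂
  have hn' : ‖-n‖ = 1 := by rwa [norm_neg]
  have hnn : inner ℝ n n = 1 := by rw [real_inner_self_eq_norm_sq, hn, one_pow]
  have hlτ : 1 ≤ l * inner ℝ n τ := by
    linarith [hnn, one_add_inner_le hτ hl hn hn h₁]
  have hlτ' : 1 ≤ l' * inner ℝ n τ := by
    have hpre : transl τ '' halfPlane (-n) (inner ℝ n τ) = halfPlane (-n) 0 := by
      rw [image_transl_halfPlane, inner_neg_left, add_neg_cancel]
    rw [← hpre, Set.disjoint_image_iff (transl τ).injective] at h₃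
    have hle := one_add_inner_le hτ hl' hn' hn' h₃
    rw [inner_neg_neg] at hle
    linarith
  have hl₀ : 0 < l := pos_of_mul_pos_left (one_pos.trans_le hlτ) hτ
  have hl₀' : 0 < l' := pos_of_mul_pos_left (one_pos.trans_le hlτ') hτ
  have hτ₀ : 0 < inner ℝ n τ := pos_of_mul_pos_right (one_pos.trans_le hlτ) hl
  have hsq := inner_mul_inv_add_inv_le hl₀ hl₀' hn h₄
  have hharm := four_le_inv_add_inv_mul_add hl₀ hl₀'
  have hprod : conj n * τ * (n * σ) = τ * σ := by
    rw [mul_mul_mul_comm, Complex.conj_mul', hn]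
    norm_num
  have hT : (conj n * τ).re = inner ℝ n τ := by rw [Complex.inner, mul_comm]
  have hS : (n * σ).re = l + l' := by rw [hσ, Complex.inner, Complex.conj_conj, mul_comm]
  rw [← hprod]
  refine four_le_of_le_norm_sq_mul_re (hT ▸ hτ₀) ?_ ?_
  · rw [hT, hS]
    linarith
  · rw [hT, hS, norm_mul, Complex.norm_conj, hn, one_mul]
    calc 4 * inner ℝ n τ ≤ (l⁻¹ + l'⁻¹) * (l + l') * inner ℝ n τ := by gcongr
      _ = inner ℝ n τ * (l⁻¹ + l'⁻¹) * (l + l') := by ring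
      _ ≤ ‖τ‖ ^ 2 * (l + l') := by gcongr

end Inequalities

namespace PingPong

variable {α : Type*} {g : α → Equiv.Perm Sphere} {D : α × Bool → Set Sphere} {x y : α × Bool}
  {τ σ : ℂ} {q : Sphere}

lemma disjoint_of_fst_ne (hD : PingPong g D) (hxy : x.1 ≠ y.1) : Disjoint (D x) (D y) :=
  hD.disjoint x y fun h => hxy (congrArg Prod.fst h)

lemma disjoint_linv (hD : PingPong g D) (x : α × Bool) : Disjoint (D x) (D (linv x)) :=
  hD.disjoint x (linv x) (linv_ne x).symm

lemma mem_closure_of_letter (hD : PingPong g D) (hq : IsParabolicAt (letter g x) q) :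
    q ∈ closure (D x) :=
  hq.mem_closure (hD.isDisc x).nonempty (hD.letter_image_subset (linv_ne x).symm)

lemma mem_closure_linv_of_letter (hD : PingPong g D) (hq : IsParabolicAt (letter g x) q) :
    q ∈ closure (D (linv x)) :=
  hD.mem_closure_of_letter (letter_linv g x ▸ hq.inv)

lemma notMem_of_letter (hD : PingPong g D) (hxy : x.1 ≠ y.1) (hq : IsParabolicAt (letter g x) q) :
    q ∉ D y :=
  notMem_of_mem_closure (hD.isDisc y).isOpen (hD.disjoint_of_fst_ne hxy.symm)
    (hD.mem_closure_of_letter hq)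

lemma exists_halfPlanes (hD : PingPong g D) (hτ : τ ≠ 0) (hx : letter g x = transl τ) :
    ∃ (n : ℂ) (k l : ℝ), ‖n‖ = 1 ∧ D x = halfPlane n k ∧ D (linv x) = halfPlane (-n) l ∧
      k + l = inner ℝ n τ :=
  have hq := hx ▸ isParabolicAt_transl hτ
  TSchottky.exists_halfPlanes (hD.isDisc x) (hD.isDisc _) (hD.disjoint_linv x)
    (hD.mem_closure_of_letter hq) (hD.mem_closure_linv_of_letter hq) (hx ▸ hD.image x)

lemma four_le_of_letters (hD : PingPong g D) (hxy : x.1 ≠ y.1) (hτ : τ ≠ 0) (hσ : σ ≠ 0)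
    (hx : letter g x = transl τ) (hy : letter g y = coTransl σ) :
    4 ≤ ‖τ * σ‖ + |(τ * σ).im| := by
  have hp : IsParabolicAt (letter g x) ∞ := hx ▸ isParabolicAt_transl hτ
  have hq : IsParabolicAt (letter g y) ((0 : ℂ) : Sphere) := hy ▸ isParabolicAt_coTransl hσ
  obtain ⟨n, k, k', hn, hk, hk', hkτ⟩ := hD.exists_halfPlanes hτ hx
  obtain ⟨m, l, l', hm, hl₀, hl₀', hl, hl', hlσ⟩ := exists_tangentDiscs (hD.isDisc y)
    (hD.isDisc (linv y)) (hD.disjoint_linv y) (hD.mem_closure_of_letter hq)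
    (hD.mem_closure_linv_of_letter hq) (hD.notMem_of_letter hxy hp)
    (hD.notMem_of_letter (y := linv y) hxy hp) (hy ▸ hD.image y)
  have hk₀ := nonneg_of_zero_notMem_halfPlane (hk ▸ hD.notMem_of_letter hxy.symm hq)
  have hk₀' := nonneg_of_zero_notMem_halfPlane
    (hk' ▸ hD.notMem_of_letter (y := linv x) hxy.symm hq)
  refine four_le_of_inner_mul_inner hm hn ?_
  rw [← hkτ, ← hlσ]
  apply two_mul_one_add_abs_inner_le hk₀ hk₀' hl₀ hl₀' hm hn
  · exact hl ▸ hk ▸ hD.disjoint_of_fst_ne hxy.symm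
  · exact hl ▸ hk' ▸ hD.disjoint_of_fst_ne (y := linv x) hxy.symm
  · exact hl' ▸ hk ▸ hD.disjoint_of_fst_ne (x := linv y) hxy.symm
  · exact hl' ▸ hk' ▸ hD.disjoint_of_fst_ne (x := linv y) (y := linv x) hxy.symm

end PingPong

lemma window_eq_pow {α H : Type*} [Group H] (g : α → H) {x : ℤ → α × Bool} {a : α × Bool} {i : ℤ}
    {k : ℕ} (h : ∀ j : ℕ, j < k → x (i + j) = a) : window g x i k = letter g a ^ k := by
  induction k with
  | zero => rw [window_zero, pow_zero]
  | succ k ih =>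
    rw [window_add, window_one, h k k.lt_succ_self, ih fun j hj => h j (hj.trans k.lt_succ_self),
      pow_succ]

/-- The periodic sequence of letters spelling `y * x ^ N`. -/
def mulPowWord {α : Type*} (x y : α × Bool) (N : ℕ) (i : ℤ) : α × Bool :=
  open Classical in if ((N + 1 : ℕ) : ℤ) ∣ i then y else x

namespace PingPong

variable {α : Type*} {g : α → Equiv.Perm Sphere} {D : α × Bool → Set Sphere} {x y : α × Bool}
  {τ σ : ℂ} {q : Sphere} {N : ℕ}

lemma exists_itinerary_mul_pow (hD : PingPong g D) (hxy : x.1 ≠ y.1)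
    (hq : IsParabolicAt (letter g y * letter g x ^ N) q) :
    ∃ p, Itinerary g D (N + 1) (mulPowWord x y N) p ∧ p 0 = q := by
  refine hD.exists_itinerary N.succ_pos (fun i heq => ?_) (fun i => ?_) ?_
  · unfold mulPowWord at heq
    split_ifs at heq
    · exact linv_ne y heq.symm
    · exact hxy (congrArg Prod.fst heq).symm
    · exact hxy (congrArg Prod.fst heq :)
    · exact linv_ne x heq.symm
  · simp only [mulPowWord, Nat.succ_eq_add_one, dvd_add_self_right]
  · have hpow : window g (mulPowWord x y N) (0 + 1) N = letter g x ^ N :=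
      window_eq_pow g fun j hj => if_neg fun hdvd => by
        have := Int.le_of_dvd (by omega) hdvd
        omega
    rwa [window_succ, hpow, mulPowWord, if_pos (dvd_zero _)]

lemma not_isParabolicAt_mul_pow (hD : PingPong g D) (hxy : x.1 ≠ y.1) {p : Sphere}
    (hp : IsParabolicAt (letter g x) p) :
    ¬ IsParabolicAt (letter g y * letter g x ^ (N + 2)) q := by
  intro hq
  have : Nontrivial α := nontrivial_of_ne _ _ hxy
  obtain ⟨_, hword, -⟩ := hD.exists_itinerary_mul_pow hxy hq
  obtain ⟨_, hconst, -⟩ := hD.exists_itinerary (x := fun _ => x) one_pos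
    (fun _ => (linv_ne x).symm) (fun _ => rfl) (by rwa [window_one])
  have hx (j : ℕ) (hj : 0 < j) (hjN : j < N + 3) : mulPowWord x y (N + 2) j = x :=
    if_neg fun hdvd => by
      have := Int.le_of_dvd (by omega) hdvd
      omega
  have heq := hword.eq_of_eq hD hconst (i := 1) (j := 0) (hx 1 one_pos (by omega))
    (hx 2 two_pos (by omega)) (-1)
  rw [add_neg_cancel, mulPowWord, if_pos (dvd_zero _)] at heq
  exact hxy (congrArg Prod.fst heq).symm

lemma mem_closure_of_mul (hD : PingPong g D) (hxy : x.1 ≠ y.1)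
    (hq : IsParabolicAt (letter g y * letter g x) q) :
    q ∈ closure (D y) ∧ q ∈ closure (D (linv x)) ∧
      q ∈ closure (⇑(letter g (linv x)) '' D (linv y)) := by
  obtain ⟨p, hp, rfl⟩ := hD.exists_itinerary_mul_pow (N := 1) hxy (by rwa [pow_one])
  have hzero : mulPowWord x y 1 0 = y := if_pos (dvd_zero _)
  have hneg : mulPowWord x y 1 (-1) = x := if_neg (by decide)
  have hnegtwo : mulPowWord x y 1 (-2) = y := if_pos (by decide)
  refine ⟨hzero ▸ hp.mem_closure 0, hneg ▸ hp.mem_closure_linv (-1), ?_⟩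
  rw [← image_closure_of_mem (hD.letter_mem _), letter_linv, show (0 : ℤ) = -1 + 1 from rfl,
    hp.step, hneg]
  exact Set.mem_image_of_mem _ (hnegtwo ▸ hp.mem_closure_linv (-2))

lemma four_le_of_mul (hD : PingPong g D) (hxy : x.1 ≠ y.1) (hτ : τ ≠ 0) (hσ : σ ≠ 0)
    (hx : letter g x = transl τ) (hy : letter g y * letter g x = coTransl σ) :
    4 ≤ ‖τ * σ‖ + |(τ * σ).im| := by
  have hp : IsParabolicAt (letter g x) ∞ := hx ▸ isParabolicAt_transl hτ
  have hq : IsParabolicAt (letter g y * letter g x) ((0 : ℂ) : Sphere) :=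
    hy ▸ isParabolicAt_coTransl hσ
  obtain ⟨hcy, hcx, hcE⟩ := hD.mem_closure_of_mul hxy hq
  set E : Set Sphere := ⇑(letter g (linv x)) '' D (linv y) with hE
  have hEx : E ⊆ D (linv x) :=
    hD.letter_image_subset fun h => hxy (by simpa [linv] using (congrArg Prod.fst h).symm)
  have hxE : transl τ '' E = D (linv y) := by
    rw [hE, ← hx, letter_linv, ← Set.image_comp, ← Equiv.Perm.coe_mul, mul_inv_cancel,
      Equiv.Perm.coe_one, Set.image_id]
  have himage : coTransl σ '' (closure E)ᶜ = D y := by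
    rw [← hy, ← hD.image y, ← hxE, ← hx, ← image_closure_of_mem (hD.letter_mem x),
      ← Set.image_compl_eq (letter g x).bijective, ← Set.image_comp, Equiv.Perm.coe_mul]
  obtain ⟨n, k, k', hn, hk, hk', hkτ⟩ := hD.exists_halfPlanes hτ hx
  have hyx : Disjoint (D y) (D (linv x)) := hD.disjoint_of_fst_ne (y := linv x) hxy.symm
  obtain ⟨m, l, l', hm, hl₀, hl₀', hl, hl', hlσ⟩ := exists_tangentDiscs (hD.isDisc y)
    ((hD.isDisc (linv y)).image (hD.letter_mem _)) (hyx.mono_right hEx) hcy hcE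
    (hD.notMem_of_letter hxy hp) (fun h => infty_notMem_halfPlane (hk' ▸ hEx h)) himage
  have hk₀ : 0 ≤ k := nonneg_of_zero_notMem_halfPlane
    (hk ▸ notMem_of_mem_closure (hD.isDisc x).isOpen (hD.disjoint_of_fst_ne hxy) hcy)
  obtain rfl : k' = 0 := by
    refine le_antisymm ?_ (nonneg_of_zero_notMem_halfPlane
      (hk' ▸ notMem_of_mem_closure (hD.isDisc _).isOpen hyx.symm hcy))
    rw [hk', closure_halfPlane (neg_ne_zero.2 (norm_ne_zero_iff.1 (hn ▸ one_ne_zero))),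
      Set.mem_compl_iff] at hcx
    simpa using nonneg_of_zero_notMem_halfPlane hcx
  rw [add_zero] at hkτ
  subst hkτ
  refine four_le_of_tangentDisc hl₀ hl₀' hk₀ hm hn hlσ ?_ ?_ ?_ ?_
  · exact hl ▸ hk ▸ hD.disjoint_of_fst_ne hxy.symm
  · exact hl ▸ hk' ▸ hyx
  · rw [← hl', hxE, ← hk']
    exact hD.disjoint_of_fst_ne (x := linv y) (y := linv x) hxy.symm
  · rw [← hl', ← hl, hxE]
    exact hD.disjoint_linv y

end PingPong

/-! ### Free bases of parabolic elements -/

lemma letter_conj {α H : Type*} [Group H] (g : α → H) (f : H) (x : α × Bool) :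
    letter (fun i => f * g i * f⁻¹) x = f * letter g x * f⁻¹ :=
  (map_letter (MulAut.conj f).toMonoidHom g x).symm

lemma lift_letter {α H : Type*} [Group H] (g : α → H) (x : α × Bool) :
    FreeGroup.lift g (letter FreeGroup.of x) = letter g x := by
  rw [map_letter, lift_comp_of]

lemma closure_conj_pair_eq_top {H : Type*} [Group H] {s t : H} (h : H)
    (hst : Subgroup.closure {s, t} = ⊤) :
    Subgroup.closure {h * s * h⁻¹, h * t * h⁻¹} = ⊤ := by
  rw [← Subgroup.map_top_of_surjective (MulAut.conj h).toMonoidHom (MulAut.conj h).surjective,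
    ← hst, MonoidHom.map_closure, Set.image_pair]
  rfl

lemma exists_eq_letter_zpow {x : Fin 2 × Bool} {t : FreeGroup (Fin 2)}
    (h : Subgroup.closure {letter FreeGroup.of x, t} = ⊤) :
    ∃ (y : Fin 2 × Bool) (m n : ℤ), x.1 ≠ y.1 ∧
      t = letter FreeGroup.of x ^ m * letter FreeGroup.of y * letter FreeGroup.of x ^ n := by
  obtain ⟨i, e⟩ := x
  obtain ⟨j, hji⟩ := exists_ne i
  cases e
  · have htop : Subgroup.closure {FreeGroup.of i, t} = ⊤ := by
      rw [eq_top_iff, ← h, Subgroup.closure_le, Set.pair_subset_iff]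
      exact ⟨inv_mem (Subgroup.subset_closure (Set.mem_insert _ _)),
        Subgroup.subset_closure (Set.mem_insert_of_mem _ rfl)⟩
    obtain ⟨m, n, b, ht⟩ := exists_eq_of_closure_eq_top hji.symm htop
    exact ⟨(j, b), -m, -n, hji.symm, by simpa [letter] using ht⟩
  · obtain ⟨m, n, b, ht⟩ := exists_eq_of_closure_eq_top hji.symm h
    exact ⟨(j, b), m, n, hji.symm, ht⟩

namespace PingPong

section

variable {α : Type*} {g : α → Equiv.Perm Sphere} {D : α × Bool → Set Sphere} {x y : α × Bool}
  {τ σ : ℂ}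

lemma conj (hD : PingPong g D) {f : Equiv.Perm Sphere} (hf : f ∈ moebiusGroup) :
    PingPong (fun i => f * g i * f⁻¹) (fun x => f '' D x) where
  isDisc x := (hD.isDisc x).image hf
  disjoint x y h := (Set.disjoint_image_iff f.injective).2 (hD.disjoint x y h)
  mem_moebiusGroup i := mul_mem (mul_mem hf (hD.mem_moebiusGroup i)) (inv_mem hf)
  image x := by
    rw [letter_conj, ← image_closure_of_mem hf, ← Set.image_compl_eq f.bijective, ← hD.image x,
      ← Set.image_comp, ← Set.image_comp, ← Equiv.Perm.coe_mul, ← Equiv.Perm.coe_mul,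
      inv_mul_cancel_right]

lemma four_le_of_mul_zpow (hD : PingPong g D) (hxy : x.1 ≠ y.1) (hτ : τ ≠ 0) (hσ : σ ≠ 0)
    (hx : letter g x = transl τ) {N : ℤ} (hy : letter g y * letter g x ^ N = coTransl σ) :
    4 ≤ ‖τ * σ‖ + |(τ * σ).im| := by
  have of_nat {x : α × Bool} {τ : ℂ} (N : ℕ) (hxy : x.1 ≠ y.1) (hτ : τ ≠ 0)
      (hx : letter g x = transl τ) (hy : letter g y * letter g x ^ N = coTransl σ) :
      4 ≤ ‖τ * σ‖ + |(τ * σ).im| := by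
    rcases N with _ | _ | N
    · exact hD.four_le_of_letters hxy hτ hσ hx (by rw [← hy, pow_zero, mul_one])
    · exact hD.four_le_of_mul hxy hτ hσ hx (by rwa [zero_add, pow_one] at hy)
    · exact absurd (hy ▸ isParabolicAt_coTransl hσ)
        (hD.not_isParabolicAt_mul_pow hxy (hx ▸ isParabolicAt_transl hτ))
  obtain ⟨N, rfl | rfl⟩ := N.eq_nat_or_neg
  · exact of_nat N hxy hτ hx (by rwa [zpow_natCast] at hy)
  · have hle := of_nat (x := linv x) (τ := -τ) N hxy (neg_ne_zero.2 hτ)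
      (by rw [letter_linv, hx, transl_inv]) (by
      rwa [letter_linv, inv_pow, ← zpow_natCast, ← zpow_neg])
    rwa [neg_mul, norm_neg, Complex.neg_im, abs_neg] at hle

lemma exists_itinerary_of_isParabolicAt (hD : PingPong g D) {u : FreeGroup α} {p : Sphere}
    (hu : IsParabolicAt (FreeGroup.lift g u) p) :
    ∃ (h : FreeGroup α) (k : ℕ) (x : ℤ → α × Bool) (q : ℤ → Sphere),
      u = h * window FreeGroup.of x 0 k * h⁻¹ ∧ Itinerary g D k x q := by
  obtain ⟨h, k, x, hk, hx, hper, rfl⟩ :=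
    exists_conj_window fun h1 : u = 1 => hu.ne_one (h1 ▸ map_one _)
  have hw := hu.conj (inv_mem (hD.lift_mem h))
  rw [← map_inv, ← map_inv, ← map_mul, ← map_mul, inv_inv,
    show h⁻¹ * (h * window FreeGroup.of x 0 k * h⁻¹) * h = window FreeGroup.of x 0 k by group,
    map_window, lift_comp_of] at hw
  obtain ⟨q, hq, -⟩ := hD.exists_itinerary hk hx hper hw
  exact ⟨h, k, x, q, rfl, hq⟩

end

variable {g : Fin 2 → Equiv.Perm Sphere} {D : Fin 2 × Bool → Set Sphere} {τ σ : ℂ}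

lemma four_le_of_conj_letter (hD : PingPong g D) (hτ : τ ≠ 0) (hσ : σ ≠ 0)
    {f : Equiv.Perm Sphere} (hf : f ∈ moebiusGroup) {s t h : FreeGroup (Fin 2)}
    (hst : Subgroup.closure {s, t} = ⊤) {x : Fin 2 × Bool}
    (hs : s = h * letter FreeGroup.of x * h⁻¹) (hsτ : f * FreeGroup.lift g s * f⁻¹ = transl τ)
    (htσ : f * FreeGroup.lift g t * f⁻¹ = coTransl σ) : 4 ≤ ‖τ * σ‖ + |(τ * σ).im| := by
  have htop := closure_conj_pair_eq_top h⁻¹ hst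
  rw [show h⁻¹ * s * h⁻¹⁻¹ = letter FreeGroup.of x by rw [hs]; group] at htop
  obtain ⟨y, m, n, hxy, hy⟩ := exists_eq_letter_zpow htop
  set u := h * letter FreeGroup.of x ^ m with hu
  have hsu : s = u * letter FreeGroup.of x * u⁻¹ := by
    rw [hs, hu]
    group
  have htu : t = u * (letter FreeGroup.of y * letter FreeGroup.of x ^ (m + n)) * u⁻¹ := by
    calc t = h * (h⁻¹ * t * h⁻¹⁻¹) * h⁻¹ := by group
      _ = u * (letter FreeGroup.of y * letter FreeGroup.of x ^ (m + n)) * u⁻¹ := by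
        rw [hy, hu]
        group
  refine (hD.conj (mul_mem hf (hD.lift_mem u))).four_le_of_mul_zpow hxy hτ hσ (N := m + n) ?_ ?_
  · rw [letter_conj, ← hsτ, hsu, ← lift_letter g]
    simp only [map_mul, map_inv, mul_inv_rev, mul_assoc]
  · rw [letter_conj, letter_conj, conj_zpow, ← htσ, htu, ← lift_letter g, ← lift_letter g]
    simp only [map_mul, map_inv, map_zpow, mul_inv_rev, mul_assoc, inv_mul_cancel_left]

lemma four_le_of_closure_eq_top (hD : PingPong g D) (hτ : τ ≠ 0) (hσ : σ ≠ 0)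
    {s t : FreeGroup (Fin 2)} (hst : Subgroup.closure {s, t} = ⊤)
    (hs : FreeGroup.lift g s = coTransl σ) (ht : FreeGroup.lift g t = transl τ) :
    4 ≤ ‖τ * σ‖ + |(τ * σ).im| := by
  obtain ⟨h, k, x, p, hsx, hx⟩ :=
    hD.exists_itinerary_of_isParabolicAt (hs ▸ isParabolicAt_coTransl hσ)
  obtain ⟨h', l, y, q, hty, hy⟩ :=
    hD.exists_itinerary_of_isParabolicAt (ht ▸ isParabolicAt_transl hτ)
  have hdet := isUnit_exponentDet hst
  rw [exponentDet, hsx, hty, exponents_conj, exponents_conj] at hdet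
  rcases hx.length_eq_one hD hy hdet with rfl | rfl
  · rw [window_one] at hsx
    rw [mul_comm]
    exact hD.four_le_of_conj_letter hσ hτ swap_mem hst hsx (hs ▸ (transl_eq σ).symm)
      (by rw [ht, swap_inv, coTransl_eq])
  · rw [window_one] at hty
    exact hD.four_le_of_conj_letter hτ hσ (one_mem _) (Set.pair_comm s t ▸ hst) hty
      (by rw [ht, one_mul, inv_one, mul_one]) (by rw [hs, one_mul, inv_one, mul_one])

end PingPong

/-! ### Groups generated by two parabolic elements -/

lemma nontrivial_of_not_commute {ι H : Type*} [Group H] {g : ι → H} {s t : H}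
    (hg : Subgroup.closure (Set.range g) = Subgroup.closure {s, t}) (hst : ¬ Commute s t) :
    Nontrivial ι := by
  by_contra hsub
  rw [not_nontrivial_iff_subsingleton] at hsub
  have hcomm : IsMulCommutative (Subgroup.closure (Set.range g)) :=
    Subgroup.isMulCommutative_closure (by
      rintro _ ⟨i, rfl⟩ _ ⟨j, rfl⟩
      rw [Subsingleton.elim i j])
  have hmem : s ∈ Subgroup.closure (Set.range g) ∧ t ∈ Subgroup.closure (Set.range g) := by
    rw [hg]
    exact ⟨Subgroup.subset_closure (Set.mem_insert _ _),
      Subgroup.subset_closure (Set.mem_insert_of_mem _ rfl)⟩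
  exact hst (congrArg Subtype.val (hcomm.is_comm.comm ⟨s, hmem.1⟩ ⟨t, hmem.2⟩))

lemma IsClassicalTSchottky.exists_pingPong {s t : Equiv.Perm Sphere} (hst : ¬ Commute s t)
    (h : IsClassicalTSchottky (Subgroup.closure {s, t})) :
    ∃ (g : Fin 2 → Equiv.Perm Sphere) (D : Fin 2 × Bool → Set Sphere)
      (u v : FreeGroup (Fin 2)), PingPong g D ∧ Subgroup.closure {u, v} = ⊤ ∧
      FreeGroup.lift g u = s ∧ FreeGroup.lift g v = t := by
  obtain ⟨n, g, hg, hcl⟩ := h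
  obtain ⟨D, hD⟩ := hcl.exists_pingPong
  have hnt : Nontrivial (Fin n) := nontrivial_of_not_commute hg hst
  have hrange : (FreeGroup.lift g).range = Subgroup.closure {s, t} := by
    rw [FreeGroup.range_lift_eq_closure, hg]
  obtain ⟨u, hu⟩ : s ∈ (FreeGroup.lift g).range :=
    hrange ▸ Subgroup.subset_closure (Set.mem_insert _ _)
  obtain ⟨v, hv⟩ : t ∈ (FreeGroup.lift g).range :=
    hrange ▸ Subgroup.subset_closure (Set.mem_insert_of_mem _ rfl)
  have huv : Subgroup.closure {u, v} = ⊤ := by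
    apply Subgroup.map_injective hD.lift_injective
    rw [MonoidHom.map_closure, Set.image_pair, ← MonoidHom.range_eq_map, hu, hv, hrange]
  have hle : Fintype.card (Fin n) ≤ ({u, v} : Finset _).card :=
    card_le_of_closure_eq_top (by rwa [Finset.coe_pair])
  obtain rfl : n = 2 := le_antisymm (Fintype.card_fin n ▸ hle.trans Finset.card_le_two)
    (Fin.nontrivial_iff_two_le.1 hnt)
  exact ⟨g, D, u, v, hD, huv, hu, hv⟩

lemma not_commute_coTransl_transl {σ τ : ℂ} (hσ : σ ≠ 0) (hτ : τ ≠ 0) :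
    ¬ Commute (coTransl σ) (transl τ) := by
  intro hcomm
  have hq := isParabolicAt_coTransl hσ
  have hconj := hq.conj (transl_mem τ)
  rw [← hcomm.eq, mul_inv_cancel_right, transl_coe, zero_add] at hconj
  exact hτ (OnePoint.coe_injective (hconj.unique hq))

lemma IsClassicalTSchottky.four_le {σ τ : ℂ} (hσ : σ ≠ 0) (hτ : τ ≠ 0)
    (h : IsClassicalTSchottky (Subgroup.closure {coTransl σ, transl τ})) :
    4 ≤ ‖τ * σ‖ + |(τ * σ).im| := by
  obtain ⟨g, D, s, t, hD, hst, hs, ht⟩ := h.exists_pingPong (not_commute_coTransl_transl hσ hτ)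
  exact hD.four_le_of_closure_eq_top hτ hσ hst hs ht

lemma moebius_matS : moebius (matS : GL (Fin 2) ℂ) = coTransl 1 := by
  rw [coTransl]
  congr 1
  ext i j
  change (matS : Matrix (Fin 2) (Fin 2) ℂ) i j = _
  fin_cases i <;> fin_cases j <;> simp [matS, glMk]

lemma moebius_matT (l : ℂ) : moebius (matT l : GL (Fin 2) ℂ) = transl (2 * l) := by
  rw [transl]
  congr 1
  ext i j
  change (matT l : Matrix (Fin 2) (Fin 2) ℂ) i j = _
  fin_cases i <;> fin_cases j <;> simp [matT, affineGL, glMk]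

lemma norm_add_abs_im_lt {l : ℂ} (h : |l.im| < 1 - l.re ^ 2 / 4) : ‖l‖ + |l.im| < 2 := by
  have hlt : ‖l‖ < 2 - |l.im| := by
    refine lt_of_pow_lt_pow_left₀ 2 (by nlinarith [sq_nonneg l.re]) ?_
    rw [Complex.sq_norm, Complex.normSq_apply]
    nlinarith [sq_abs l.im]
  linarith

lemma not_isClassicalTSchottky_groupG {l : ℂ} (hl : l ≠ 0) (h : |l.im| < 1 - l.re ^ 2 / 4) :
    ¬ IsClassicalTSchottky (groupG l) := by
  intro hcl
  rw [groupG, twoGenerator, moebius_matS, moebius_matT] at hcl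
  have hle := hcl.four_le one_ne_zero (mul_ne_zero two_ne_zero hl)
  have him : (2 * l).im = 2 * l.im := by simp
  rw [mul_one, norm_mul, Complex.norm_two, him, abs_mul, abs_two] at hle
  linarith [norm_add_abs_im_lt h]

end TSchottky

end

theorem theorem7p2_general :
    (∀ l : ℂ, 0 ≤ l.re → 0 ≤ l.im → l ∉ interior TSchottky.regionK →
      TSchottky.IsTSchottky (TSchottky.groupG l)) ∧
    (∀ l : ℂ, l ≠ 0 → |l.im| < 1 - l.re ^ 2 / 4 →
      ¬ TSchottky.IsClassicalTSchottky (TSchottky.groupG l)) ∧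
    (∀ S T : Matrix.SpecialLinearGroup (Fin 2) ℂ,
      (S : Matrix (Fin 2) (Fin 2) ℂ).trace = 2 → (T : Matrix (Fin 2) (Fin 2) ℂ).trace = 2 →
      ∀ w : ℂ, w = ((S * T : Matrix.SpecialLinearGroup (Fin 2) ℂ) :
          Matrix (Fin 2) (Fin 2) ℂ).trace - 2 →
      ((2 ≤ ‖w‖ ∧ Real.pi / 3 ≤ w.arg ∧ w.arg ≤ Real.pi / 2) ∨
        2 ≤ (w * Complex.exp (-(Real.pi / 3 * Complex.I))).re) →
      TSchottky.IsTSchottky (TSchottky.twoGenerator S T)) :=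
  ⟨fun _ => TSchottky.isTSchottky_groupG, fun _ => TSchottky.not_isClassicalTSchottky_groupG,
    fun S T hS hT _ => TSchottky.isTSchottky_twoGenerator S T hS hT⟩

theorem theorem7p2 :
    (∀ l : ℂ, 0 ≤ l.re → 0 ≤ l.im → l.im < 1 - l.re ^ 2 / 4 →
      l ∉ interior TSchottky.regionK →
      TSchottky.IsNonClassicalTSchottky (TSchottky.groupG l)) ∧
    (∀ S T : Matrix.SpecialLinearGroup (Fin 2) ℂ,
      (S : Matrix (Fin 2) (Fin 2) ℂ).trace = 2 → (T : Matrix (Fin 2) (Fin 2) ℂ).trace = 2 →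
      ∀ w : ℂ, w = ((S * T : Matrix.SpecialLinearGroup (Fin 2) ℂ) :
          Matrix (Fin 2) (Fin 2) ℂ).trace - 2 →
      ((2 ≤ ‖w‖ ∧ Real.pi / 3 ≤ w.arg ∧ w.arg ≤ Real.pi / 2) ∨
        (2 ≤ (w * Complex.exp (-(Real.pi / 3 * Complex.I))).re ∧
          0 ≤ w.arg ∧ w.arg ≤ Real.pi / 3)) →
      TSchottky.IsTSchottky (TSchottky.twoGenerator S T)) := by
  obtain ⟨hT, hcl, htr⟩ := theorem7p2_general
  exact ⟨fun l hre him hpar hK => ⟨hT l hre him hK,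
      hcl l (TSchottky.ne_zero_of_notMem_interior_regionK hK) (by rwa [abs_of_nonneg him])⟩,
    fun S T hS hT w hw h => htr S T hS hT w hw (h.imp_right And.left)⟩
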